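/- **Theorem.** Let $G=(V,E)$ be a finite directed graph with edge weights $w:E\to\mathbb R_{\ge 0}$. The random walk on $G$, when at a vertex $v$, uses an edge $f$ leaving $v$ with probability $w(f)/\sum_{g\text{ leaving }v}w(g)$ and moves to the endpoint of $f$ (it stops at $v$ if all these weights are $0$). Let $\mathcal S\subseteq V$ be the disjoint union of $\mathcal S_1,\dots,\mathcal S_k$, where $\mathcal S$ and every $\mathcal S_i$ is nonempty and strongly connected (any two of its vertices are joined by a path of edges inside the set). Let $v_0\in\mathcal S$, let $e\in E$ be an edge from a vertex of $\mathcal S$ to a vertex outside $\mathcal S$, and let $L\in\mathbb N$. Assume that with positive probability the random walk started at $v_0$ leaves $\mathcal S$ and first does so through $e$, and condition on this event. Let $e_1,e_2,\dots,e_r=e$ be the edges, in order of use, through which the conditioned walk leaves the set $\mathcal S_i$ it is currently in, up to and including its exit from $\mathcal S$ through $e$. For $v\in\mathcal S$ let $\mathcal S_v$ be the set $\mathcal S_i$ that contains $v$, and let $v_j$ be the endpoint of $e_j$. The *transcript* of the first $L$ jumping edges is $$\mathcal S_{v_0},e_1,\mathcal S_{v_1},e_2,\dots,\mathcal S_{v_{r-1}},e_r=e\quad\text{if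 } r\le L,\qquad \mathcal S_{v_0},e_1,\dots,\mathcal S_{v_{L-1}},e_L,\mathcal S,e\quad\text{if } r>L.$$ There is a randomized PRAM algorithm (one fixed program) that, on input $G,w,\mathcal S_1,\dots,\mathcal S_k,v_0,e,L$, outputs a list distributed exactly as the transcript of the first $L$ jumping edges of the conditioned walk. It uses $\mathrm{poly}(|E|,L)$ processors and always halts within $\mathrm{polylog}(|E|,L)$ time. Here a PRAM consists of synchronous processors with a shared memory. It works with words, which are natural numbers bounded by a polynomial in $|V|+|E|+L$ and serve as addresses and as names of vertices, edges and clusters, and with real numbers. Arithmetic operations, comparisons, memory accesses and drawing an independent uniformly random number from $[0,1]$ take unit time; if several processors write to the same memory cell in one step, the one with the least number succeeds. -/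

import Mathlib

open MeasureTheory
open scoped NNReal ENNReal

/-! ### Weighted directed graphs and random walks -/

/-- A directed graph with vertex set `Fin n`, edge set `Fin m` (parallel edges and loops are
allowed) and nonnegative real edge weights. -/
structure WDigraph (n m : ℕ) where
  src : Fin m → Fin n
  dst : Fin m → Fin n
  weight : Fin m → ℝ≥0

namespace WDigraph

variable {n m k : ℕ}

/-- Total weight of the edges that leave `v`. -/
noncomputable def outWeight (G : WDigraph n m) (v : Fin n) : ℝ≥0 :=
  ∑ f : Fin m, if G.src f = v then G.weight f else 0

/-- Probability that the random walk, currently at `v`, uses the edge `f` for its next step: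
proportional to the weight among the edges that leave `v`. (If all these weights are `0`, the walk
makes no further step.) -/
noncomputable def stepProb (G : WDigraph n m) (v : Fin n) (f : Fin m) : ℝ≥0 :=
  if G.src f = v then G.weight f / G.outWeight v else 0

/-- `G.pathProb v [f₁, …, f_t]` is the probability that the first `t` edges used by the random walk
started at `v` are `f₁, …, f_t`, in this order. -/
noncomputable def pathProb (G : WDigraph n m) : Fin n → List (Fin m) → ℝ≥0∞
  | _, [] => 1
  | v, f :: p => (G.stepProb v f : ℝ≥0∞) * G.pathProb (G.dst f) p

/-- A vertex set is strongly connected if it is nonempty and any vertex of it can be reached from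
any other one along edges inside the set. -/
def StronglyConnected (G : WDigraph n m) (T : Set (Fin n)) : Prop :=
  T.Nonempty ∧ ∀ s ∈ T, ∀ t ∈ T,
    Relation.ReflTransGen (fun a b => a ∈ T ∧ b ∈ T ∧ ∃ f, G.src f = a ∧ G.dst f = b) s t

/-- `p` is the sequence of edges used by a walk (started inside `S`) up to and including its first
exit from `S`, and this exit uses the edge `e`. -/
def ExitsVia (G : WDigraph n m) (S : Set (Fin n)) (e : Fin m) (p : List (Fin m)) : Prop :=
  ∃ q : List (Fin m), p = q ++ [e] ∧ (∀ f ∈ q, G.dst f ∈ S) ∧ G.dst e ∉ S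

/-- Probability that the random walk started at `v` leaves `S` and first does so through `e`. -/
noncomputable def exitProb (G : WDigraph n m) (S : Set (Fin n)) (v : Fin n) (e : Fin m) : ℝ≥0∞ :=
  ∑' p : {p : List (Fin m) // G.ExitsVia S e p}, G.pathProb v p

/-- Conditional probability, given that the random walk started at `v` first leaves `S` through
`e`, that the sequence of the edges it uses up to this exit belongs to `A`. -/
noncomputable def condExitProb (G : WDigraph n m) (S : Set (Fin n)) (v : Fin n) (e : Fin m)
    (A : Set (List (Fin m))) : ℝ≥0∞ :=
  (∑' p : {p : List (Fin m) // G.ExitsVia S e p ∧ p ∈ A}, G.pathProb v p) / G.exitProb S v e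

/-- The edges of the walk `p` that leave the cluster they start in, in the order of their use.
Disjoint clusters `S_i` are given by `part`: `part v = some i` if `v ∈ S_i`, and `part v = none` if
`v` lies outside `S = ⋃ i, S_i`. -/
def crossings (G : WDigraph n m) (part : Fin n → Option (Fin k)) (p : List (Fin m)) :
    List (Fin m) :=
  p.filter fun f => part (G.src f) ≠ part (G.dst f)

/-- The transcript of the first `L` jumping edges of a walk `p` that exits `S` through `e`.
It is the alternating sequence `S_{v₀}, e₁, S_{v₁}, e₂, …` of clusters and of edges through which
they are left, written as a list of pairs. It ends with `e` if this is among the first `L` of these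
edges; otherwise it is cut after `L` edges and closed with the pair `(S, e)`, the whole set `S`
being written as `none`. -/
def transcript (G : WDigraph n m) (part : Fin n → Option (Fin k)) (e : Fin m) (L : ℕ)
    (p : List (Fin m)) : List (Option (Fin k) × Fin m) :=
  ((G.crossings part p).take L).map (fun f => (part (G.src f), f)) ++
    if (G.crossings part p).length ≤ L then [] else [(none, e)]

end WDigraph

/-! ### The parallel random access machine

Synchronous processors run one common finite program. Every processor has its own program counter
and its own word and real registers, and all share a memory of words and one of reals. Words are
natural numbers below a bound `W`. In one time step every processor that has not halted executes
one instruction. Real arithmetic and comparison are exact and have unit cost, and a processor can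
draw a uniformly random real number from `[0,1]`. -/

namespace PRAM

/-- Operations on words; `sub` is truncated at `0`. -/
inductive WordOp
  | add | sub | mul | div | mod

/-- Operations on reals. -/
inductive RealOp
  | add | sub | mul | div

/-- Instructions; arguments `d`, `a`, `b`, `s` are numbers of registers of the processor, and `j`
is a position in the program. -/
inductive Instr
  /-- word register `d` := the constant `x` -/
  | wconst (d x : ℕ)
  /-- word register `d` := result of the operation on word registers `a` and `b` -/
  | wop (o : WordOp) (d a b : ℕ)
  /-- word register `d` := shared word at the address in word register `a` -/
  | wload (d a : ℕ)
  /-- shared word at the address in word register `a` := word register `s` -/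
  | wstore (a s : ℕ)
  /-- real register `d` := word register `a`, as a real number -/
  | cast (d a : ℕ)
  /-- real register `d` := result of the operation on real registers `a` and `b` -/
  | rop (o : RealOp) (d a b : ℕ)
  /-- real register `d` := shared real at the address in word register `a` -/
  | rload (d a : ℕ)
  /-- shared real at the address in word register `a` := real register `s` -/
  | rstore (a s : ℕ)
  /-- real register `d` := a fresh random number, uniform on `[0,1]` -/
  | rand (d : ℕ)
  /-- continue at position `j` -/
  | jump (j : ℕ)
  /-- continue at position `j` if word register `a` is less than word register `b` -/
  | wjump (a b j : ℕ)
  /-- continue at position `j` if real register `a` is less than real register `b` -/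
  | rjump (a b j : ℕ)

/-- Local state of one processor. -/
structure Proc where
  pc : ℕ
  word : ℕ → ℕ
  real : ℕ → ℝ

/-- State of a machine with `P` processors. -/
structure Config (P : ℕ) where
  proc : Fin P → Proc
  wmem : ℕ → ℕ
  rmem : ℕ → ℝ

def WordOp.eval : WordOp → ℕ → ℕ → ℕ
  | .add, x, y => x + y
  | .sub, x, y => x - y
  | .mul, x, y => x * y
  | .div, x, y => x / y
  | .mod, x, y => x % y

noncomputable def RealOp.eval : RealOp → ℝ → ℝ → ℝ
  | .add, x, y => x + y
  | .sub, x, y => x - y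
  | .mul, x, y => x * y
  | .div, x, y => x / y

namespace Proc

/-- Store `x` in word register `d` and go to the next instruction. -/
def setWord (q : Proc) (d x : ℕ) : Proc :=
  { q with pc := q.pc + 1, word := Function.update q.word d x }

/-- Store `x` in real register `d` and go to the next instruction. -/
def setReal (q : Proc) (d : ℕ) (x : ℝ) : Proc :=
  { q with pc := q.pc + 1, real := Function.update q.real d x }

end Proc

namespace Instr

/-- Effect of an instruction on the processor that executes it. Results of word operations are
reduced modulo `W`; `u` is the random number available to the processor in this step. -/
noncomputable def exec (W : ℕ) (u : ℝ) (wmem : ℕ → ℕ) (rmem : ℕ → ℝ) (q : Proc) : Instr → Proc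
  | wconst d x => q.setWord d (x % W)
  | wop o d a b => q.setWord d (o.eval (q.word a) (q.word b) % W)
  | wload d a => q.setWord d (wmem (q.word a))
  | wstore _ _ => { q with pc := q.pc + 1 }
  | cast d a => q.setReal d (q.word a : ℝ)
  | rop o d a b => q.setReal d (o.eval (q.real a) (q.real b))
  | rload d a => q.setReal d (rmem (q.word a))
  | rstore _ _ => { q with pc := q.pc + 1 }
  | rand d => q.setReal d u
  | jump j => { q with pc := j }
  | wjump a b j => { q with pc := if q.word a < q.word b then j else q.pc + 1 }
  | rjump a b j => { q with pc := if q.real a < q.real b then j else q.pc + 1 }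

/-- Address and value that an instruction writes to the shared word memory, if any. -/
def wordWrite (q : Proc) : Instr → Option (ℕ × ℕ)
  | wstore a s => some (q.word a, q.word s)
  | _ => none

/-- Address and value that an instruction writes to the shared real memory, if any. -/
def realWrite (q : Proc) : Instr → Option (ℕ × ℝ)
  | rstore a s => some (q.word a, q.real s)
  | _ => none

end Instr

/-- A shared memory after the given simultaneous write requests. If several processors write to the
same cell, the one with the least number succeeds. -/
def resolve {P : ℕ} {α : Type} (req : Fin P → Option (ℕ × α)) (mem : ℕ → α) (a : ℕ) : α :=
  ((List.finRange P).findSome? fun p =>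
    (req p).bind fun r => if r.1 = a then some r.2 else none).getD (mem a)

/-- One synchronous step. All reads precede all writes. A processor whose program counter points
outside the program has halted. `u p` is the random number available to processor `p`. -/
noncomputable def step {P : ℕ} (W : ℕ) (prog : List Instr) (u : Fin P → ℝ) (c : Config P) :
    Config P where
  proc p := match prog[(c.proc p).pc]? with
    | none => c.proc p
    | some i => i.exec W (u p) c.wmem c.rmem (c.proc p)
  wmem := resolve (fun p => prog[(c.proc p).pc]?.bind (Instr.wordWrite (c.proc p))) c.wmem
  rmem := resolve (fun p => prog[(c.proc p).pc]?.bind (Instr.realWrite (c.proc p))) c.rmem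

/-- Start: all processors are at the beginning of the program, word register `0` holds the number of
the processor and all other registers hold `0`, and the input is in the shared memory. -/
def start (P : ℕ) (wmem : ℕ → ℕ) (rmem : ℕ → ℝ) : Config P where
  proc p := { pc := 0, word := fun r => if r = 0 then (p : ℕ) else 0, real := fun _ => 0 }
  wmem := wmem
  rmem := rmem

/-- The random numbers available to processor `p` in step `t`. -/
abbrev Randomness (P : ℕ) : Type := ℕ × Fin P → unitInterval

/-- All these random numbers are independent and uniform on `[0,1]`. -/
noncomputable def randomLaw (P : ℕ) : Measure (Randomness P) :=
  Measure.infinitePi fun _ => (volume : Measure unitInterval)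

/-- State after a number of steps. -/
noncomputable def run {P : ℕ} (W : ℕ) (prog : List Instr) (c : Config P) (ω : Randomness P) :
    ℕ → Config P
  | 0 => c
  | t + 1 => step W prog (fun p => (ω (t, p) : ℝ)) (run W prog c ω t)

/-- All processors have halted. -/
def Halted {P : ℕ} (prog : List Instr) (c : Config P) : Prop :=
  ∀ p, prog.length ≤ (c.proc p).pc

end PRAM

/-! ### Input and output -/

/-- Code of a cluster: `0` for none, `i + 1` for the cluster number `i`. -/
def clusterCode {k : ℕ} : Option (Fin k) → ℕ
  | none => 0
  | some i => (i : ℕ) + 1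

/-- Input words: the numbers of vertices, edges and clusters, the length `L`, the first vertex, the
exit edge, then the sources and the targets of all edges and the clusters of all vertices.
All further cells hold `0`. -/
def inputWords {n m k : ℕ} (G : WDigraph n m) (part : Fin n → Option (Fin k)) (v₀ : Fin n)
    (e : Fin m) (L : ℕ) (a : ℕ) : ℕ :=
  ([n, m, k, L, (v₀ : ℕ), (e : ℕ)] ++ List.ofFn (fun f => (G.src f : ℕ)) ++
    List.ofFn (fun f => (G.dst f : ℕ)) ++ List.ofFn (fun v => clusterCode (part v))).getD a 0

/-- Input reals: the edge weights. All further cells hold `0`. -/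
noncomputable def inputReals {n m : ℕ} (G : WDigraph n m) (a : ℕ) : ℝ :=
  (List.ofFn fun f => (G.weight f : ℝ)).getD a 0

/-- The list of pairs that is stored in a word memory: its length is at address `0`, and the pairs
follow in order. -/
def readPairs (wmem : ℕ → ℕ) : List (ℕ × ℕ) :=
  (List.range (wmem 0)).map fun i => (wmem (1 + 2 * i), wmem (2 + 2 * i))

/-- The numbers that stand for a transcript. -/
def transcriptCode {m k : ℕ} (τ : List (Option (Fin k) × Fin m)) : List (ℕ × ℕ) :=
  τ.map fun x => (clusterCode x.1, (x.2 : ℕ))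

/-! The walk is read as a Markov chain on the edges, with one additional index `m` for the start
(`WDigraph.chain`). Let `h i` be the probability of leaving `S` through `e` after the edge `i`.
Conditioned on this exit, the jumping edges form a Markov chain themselves. Its transition
probabilities `q i j` come from summing over all ways to stay in the current cluster, which gives
`(1 - stay)⁻¹`, then jumping through `j`, and reweighting by the exit probabilities after `j` and
after `i`. With `e` made absorbing, the first `L` jumping edges follow the product law of
`ExitChain.kernel` (`toReal_pathSum_states`), and the transcript is a function of them
(`condExitProb_transcript`).

The matrices `1 - stay` and `1 - inner` are invertible because the columns of states from which `e`
cannot be reached are set to zero. A minimum principle (`nonneg_of_mulVec_le`) then gives uniqueness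
for the linear systems and nonnegativity of the inverses. Reachability itself is read off from the
support of a matrix power (`reach_iff_pos`).

Stepping through the `L` jumps one by one would be too slow. Instead one uniform number is drawn for
every time `t` and every state `i`, and it selects the successor of `i` at time `t`. This yields a
random self-map of the states for every `t`, and these maps are composed by parallel prefix
(`Comp.traj`). The resulting trajectory consults just one number at each time, at places that differ
for different times, so it has the product law (`volume_select`, `randomLaw_states`).

All linear algebra is reduced to powers of matrices, which parallel prefix delivers at once
(`MComp.pow`). Newton's identities express the coefficients of `det (1 - X M)` through traces of
powers by a triangular recursion. Its matrix is nilpotent, so the solution is a finite sum of powers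
again (`revCoeff_eq_sum_newton`), and Cayley–Hamilton yields the inverse (`inv_eq_sum_revCoeff`).

On the machine, after one initial random draw, the processors stay in lock-step between code
fragments, so a fragment acts as a state transformer (`Exec`). `Comp C f` states that code of
polylogarithmic running time computes `f x p` on every processor `p`. This notion is closed under
arithmetic, branching, reading from other processors and doubling loops; arrays are stored by taking
the base-`D` digits of the processor number as indices. -/

/-! ### Lock-step execution -/

namespace PRAM

/-- Registers and memories of a machine whose processors run in lock-step. -/
@[ext] structure SIMD (P : ℕ) where
  word : Fin P → ℕ → ℕ
  real : Fin P → ℕ → ℝ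
  wmem : ℕ → ℕ
  rmem : ℕ → ℝ

namespace SIMD

variable {P : ℕ}

/-- The configuration in which all program counters are at `pc`. -/
def config (s : SIMD P) (pc : ℕ) : Config P where
  proc p := ⟨pc, s.word p, s.real p⟩
  wmem := s.wmem
  rmem := s.rmem

end SIMD

/-- Execution with a given stream of random numbers. -/
noncomputable def runWith {P : ℕ} (W : ℕ) (prog : List Instr) :
    (ℕ → Fin P → ℝ) → ℕ → Config P → Config P
  | _, 0, c => c
  | u, t + 1, c => runWith W prog (fun i => u (i + 1)) t (step W prog (u 0) c)

theorem runWith_add {P : ℕ} (W : ℕ) (prog : List Instr) (u : ℕ → Fin P → ℝ) (s t : ℕ)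
    (c : Config P) :
    runWith W prog u (s + t) c =
      runWith W prog (fun i => u (s + i)) t (runWith W prog u s c) := by
  induction s generalizing u c with
  | zero => simp [runWith]
  | succ s ih =>
    rw [show s + 1 + t = (s + t) + 1 by omega, runWith, ih, runWith]
    congr 1
    funext i
    congr 1
    omega

theorem run_eq_runWith {P : ℕ} (W : ℕ) (prog : List Instr) (c : Config P) (ω : Randomness P)
    (t : ℕ) : run W prog c ω t = runWith W prog (fun i p => (ω (i, p) : ℝ)) t c := by
  induction t with
  | zero => rfl
  | succ t ih => rw [runWith_add, ← ih]; rfl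

/-- Every execution leads from `c` to `c'` in `t` steps, whatever the random numbers. -/
def StepsTo {P : ℕ} (W : ℕ) (prog : List Instr) (t : ℕ) (c c' : Config P) : Prop :=
  ∀ u, runWith W prog u t c = c'

theorem StepsTo.refl {P : ℕ} (W : ℕ) (prog : List Instr) (c : Config P) :
    StepsTo W prog 0 c c := fun _ => rfl

theorem StepsTo.trans {P : ℕ} {W : ℕ} {prog : List Instr} {s t : ℕ} {c c' c'' : Config P}
    (h : StepsTo W prog s c c') (h' : StepsTo W prog t c' c'') :
    StepsTo W prog (s + t) c c'' := fun u => by rw [runWith_add, h, h']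

theorem StepsTo.of_step {P : ℕ} {W : ℕ} {prog : List Instr} {c c' : Config P}
    (h : ∀ u, step W prog u c = c') : StepsTo W prog 1 c c' := fun u => h (u 0)

namespace Instr

/-- The instruction with its jump target moved by `o`. -/
def shift (o : ℕ) : Instr → Instr
  | jump j => jump (o + j)
  | wjump a b j => wjump a b (o + j)
  | rjump a b j => rjump a b (o + j)
  | i => i

theorem shift_shift (o o' : ℕ) (i : Instr) : (i.shift o').shift o = i.shift (o + o') := by
  cases i <;> simp [shift, add_assoc]

/-- Instructions that only change registers, deterministically, and do not jump. -/
def IsLocal : Instr → Prop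
  | wstore _ _ | rstore _ _ | rand _ | jump _ | wjump _ _ _ | rjump _ _ _ => False
  | _ => True

theorem IsLocal.shift {i : Instr} (h : i.IsLocal) (o : ℕ) : i.shift o = i := by
  cases i <;> simp_all [IsLocal, Instr.shift]

theorem IsLocal.wordWrite {i : Instr} (h : i.IsLocal) (q : Proc) : i.wordWrite q = none := by
  cases i <;> simp_all [IsLocal, Instr.wordWrite]

theorem IsLocal.realWrite {i : Instr} (h : i.IsLocal) (q : Proc) : i.realWrite q = none := by
  cases i <;> simp_all [IsLocal, Instr.realWrite]

/-- A local instruction uses neither the program counter nor the random number, so its effect on the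
registers can be evaluated at counter `0` with random number `0`. -/
theorem IsLocal.exec_eq {i : Instr} (h : i.IsLocal) (W : ℕ) (u : ℝ) (wm : ℕ → ℕ) (rm : ℕ → ℝ)
    (pc : ℕ) (w : ℕ → ℕ) (r : ℕ → ℝ) :
    i.exec W u wm rm ⟨pc, w, r⟩ =
      ⟨pc + 1, (i.exec W 0 wm rm ⟨0, w, r⟩).word, (i.exec W 0 wm rm ⟨0, w, r⟩).real⟩ := by
  cases i <;> simp_all [IsLocal, Instr.exec, Proc.setWord, Proc.setReal]

end Instr

theorem resolve_none {P : ℕ} {α : Type} (mem : ℕ → α) :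
    resolve (fun _ : Fin P => none) mem = mem := by
  funext a
  simp [resolve, List.findSome?_eq_none_iff.mpr]

/-- Distinct addresses exclude write conflicts, so the priority rule never comes into play. All
stores of the algorithm are of this kind: they go to the address `p`, or to `p` plus a common
offset. -/
theorem resolve_of_injective {P : ℕ} {α : Type} (addr : Fin P → ℕ) (val : Fin P → α)
    (mem : ℕ → α) (hinj : Function.Injective addr) (p : Fin P) :
    resolve (fun p => some (addr p, val p)) mem (addr p) = val p := by
  unfold resolve
  have h : ((List.finRange P).findSome? fun q =>
      (some (addr q, val q)).bind fun r => if r.1 = addr p then some r.2 else none).isSome := by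
    rw [List.findSome?_isSome_iff]
    exact ⟨p, List.mem_finRange p, by simp⟩
  obtain ⟨v, hv⟩ := Option.isSome_iff_exists.mp h
  rw [hv]
  obtain ⟨q, -, hq⟩ := List.exists_of_findSome?_eq_some hv
  simp only [Option.bind_some] at hq
  split_ifs at hq with hqp
  simpa [hinj hqp] using hq.symm

theorem resolve_of_ne {P : ℕ} {α : Type} (req : Fin P → Option (ℕ × α))
    (mem : ℕ → α) (a : ℕ) (h : ∀ p r, req p = some r → r.1 ≠ a) :
    resolve req mem a = mem a := by
  unfold resolve
  rw [List.findSome?_eq_none_iff.mpr]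
  · rfl
  · intro p _
    cases hp : req p with
    | none => rfl
    | some r => simp [h p r hp]

/-! ### Code fragments and their execution in lock-step -/

/-- The instructions `F`, written for offset `0`, stand at position `o` of the program. -/
def HasAt (prog : List Instr) (o : ℕ) (F : List Instr) : Prop :=
  ∀ i, i < F.length → prog[o + i]? = F[i]?.map (Instr.shift o)

/-- Concatenation of code fragments. -/
def seq (F G : List Instr) : List Instr := F ++ G.map (Instr.shift F.length)

@[simp] theorem length_seq (F G : List Instr) : (seq F G).length = F.length + G.length := by
  simp [seq]

theorem HasAt.left {prog : List Instr} {o : ℕ} {F G : List Instr} (h : HasAt prog o (seq F G)) :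
    HasAt prog o F := fun i hi => by
  rw [h i (by simp; omega), seq, List.getElem?_append_left hi]

theorem HasAt.right {prog : List Instr} {o : ℕ} {F G : List Instr} (h : HasAt prog o (seq F G)) :
    HasAt prog (o + F.length) G := fun i hi => by
  rw [add_assoc, h _ (by simp; omega), seq, List.getElem?_append_right (by omega)]
  simp only [Nat.add_sub_cancel_left, List.getElem?_map, Option.map_map]
  congr 1
  funext j
  exact Instr.shift_shift _ _ _

theorem HasAt.prefix {prog : List Instr} {o : ℕ} {F G : List Instr} (h : HasAt prog o (F ++ G)) :
    HasAt prog o F := fun i hi => by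
  rw [h i (by simp; omega), List.getElem?_append_left hi]

theorem HasAt.last {prog : List Instr} {o : ℕ} {F : List Instr} {i : Instr}
    (h : HasAt prog o (F ++ [i])) : prog[o + F.length]? = some (i.shift o) := by
  rw [h _ (by simp)]
  simp

/-- A conditional jump on which all processors agree. -/
theorem step_wjump {P W : ℕ} {prog : List Instr} {o pc d e : ℕ} {u : Fin P → ℝ}
    (h : prog[pc]? = some ((Instr.wjump d e 0).shift o)) (s : SIMD P) (x y : ℕ)
    (hx : ∀ p, s.word p d = x) (hy : ∀ p, s.word p e = y) :
    step W prog u (s.config pc) = s.config (if x < y then o else pc + 1) := by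
  simp only [Instr.shift, add_zero] at h
  simp [step, SIMD.config, h, Instr.wordWrite, Instr.realWrite, resolve_none, Instr.exec, hx, hy]

/-- Running the fragment `F` in lock-step takes `t` steps and changes the state from `s` to `s'`. -/
def Exec {P : ℕ} (W : ℕ) (F : List Instr) (t : ℕ) (s s' : SIMD P) : Prop :=
  ∀ prog o, HasAt prog o F → StepsTo W prog t (s.config o) (s'.config (o + F.length))

theorem Exec.seq {P W : ℕ} {F G : List Instr} {t t' : ℕ} {s s' s'' : SIMD P}
    (h : Exec W F t s s') (h' : Exec W G t' s' s'') : Exec W (seq F G) (t + t') s s'' := by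
  intro prog o ho
  have := (h prog o ho.left).trans (h' prog _ ho.right)
  simpa [add_assoc] using this

/-- Effect of a local instruction on the processors selected by `sel`. -/
noncomputable def SIMD.apply {P : ℕ} (W : ℕ) (i : Instr) (sel : Fin P → Prop) [DecidablePred sel]
    (s : SIMD P) : SIMD P where
  word p := if sel p then (i.exec W 0 s.wmem s.rmem ⟨0, s.word p, s.real p⟩).word else s.word p
  real p := if sel p then (i.exec W 0 s.wmem s.rmem ⟨0, s.word p, s.real p⟩).real else s.real p
  wmem := s.wmem
  rmem := s.rmem

theorem exec_local {P W : ℕ} {i : Instr} (hi : i.IsLocal) (s : SIMD P) :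
    Exec W [i] 1 s (s.apply W i fun _ => True) := by
  intro prog o ho
  have h0 : prog[o]? = some i := by simpa [hi.shift] using ho 0 (by simp)
  refine StepsTo.of_step fun u => ?_
  simp only [step, SIMD.config, h0, Option.bind_some, hi.wordWrite, hi.realWrite, resolve_none]
  simp only [SIMD.apply, if_true, List.length_singleton, Config.mk.injEq, and_true]
  funext p
  exact hi.exec_eq ..

/-- Conditional execution of one local instruction, in the same time in both cases. -/
theorem exec_cond {P W : ℕ} {i cj : Instr} (hi : i.IsLocal) (s : SIMD P) (sel : Fin P → Prop)
    [DecidablePred sel]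
    (hcj : ∀ o u p, (cj.shift o).exec W u s.wmem s.rmem ⟨o, s.word p, s.real p⟩ =
      ⟨if sel p then o + 2 else o + 1, s.word p, s.real p⟩)
    (hw : ∀ o q, (cj.shift o).wordWrite q = none) (hr : ∀ o q, (cj.shift o).realWrite q = none) :
    Exec W [cj, .jump 3, i] 2 s (s.apply W i sel) := by
  intro prog o ho
  have h0 : prog[o]? = some (cj.shift o) := by simpa using ho 0 (by simp)
  have h1 : prog[o + 1]? = some (.jump (o + 3)) := by simpa [Instr.shift] using ho 1 (by simp)
  have h2 : prog[o + 2]? = some i := by simpa [hi.shift] using ho 2 (by simp)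
  -- A selected processor skips to `i` at offset `2`, any other one meets the jump at offset `1`.
  -- Both are at offset `3` after two steps, which restores the lock-step.
  have e1 : StepsTo W prog 1 (s.config o)
      ⟨fun p => ⟨if sel p then o + 2 else o + 1, s.word p, s.real p⟩, s.wmem, s.rmem⟩ := by
    refine StepsTo.of_step fun u => ?_
    simp only [step, SIMD.config, h0, Option.bind_some, hw, hr, resolve_none, hcj]
  refine e1.trans (t := 1) (StepsTo.of_step fun u => ?_)
  have key : ∀ p, prog[if sel p then o + 2 else o + 1]? =
      some (if sel p then i else .jump (o + 3)) := by
    intro p; split_ifs <;> assumption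
  have kw : ∀ p q, Instr.wordWrite q (if sel p then i else .jump (o + 3)) = none := by
    intro p q; split_ifs
    · exact hi.wordWrite q
    · rfl
  have kr : ∀ p q, Instr.realWrite q (if sel p then i else .jump (o + 3)) = none := by
    intro p q; split_ifs
    · exact hi.realWrite q
    · rfl
  simp only [step, SIMD.config, key, Option.bind_some, kw, kr, resolve_none]
  simp only [SIMD.apply, List.length_cons, List.length_nil, Config.mk.injEq, and_true]
  funext p
  by_cases hp : sel p
  · simp only [hp, if_true]
    rw [hi.exec_eq]
  · simp [hp, Instr.exec]

/-- The states agree on the registers below `b` and the memory cells below `B`. -/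
def Agree {P : ℕ} (b B : ℕ) (s s' : SIMD P) : Prop :=
  (∀ p, ∀ r < b, s'.word p r = s.word p r ∧ s'.real p r = s.real p r) ∧
    ∀ a < B, s'.wmem a = s.wmem a ∧ s'.rmem a = s.rmem a

theorem Agree.trans {P b B : ℕ} {s s' s'' : SIMD P} (h : Agree b B s s') (h' : Agree b B s' s'') :
    Agree b B s s'' :=
  ⟨fun p r hr => ⟨(h'.1 p r hr).1.trans (h.1 p r hr).1, (h'.1 p r hr).2.trans (h.1 p r hr).2⟩,
    fun a ha => ⟨(h'.2 a ha).1.trans (h.2 a ha).1, (h'.2 a ha).2.trans (h.2 a ha).2⟩⟩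

theorem Agree.mono {P b b' B : ℕ} {s s' : SIMD P} (h : Agree b B s s') (hb : b' ≤ b) :
    Agree b' B s s' :=
  ⟨fun p r hr => h.1 p r (by omega), h.2⟩

/-- The two kinds of values, words and reals, with their registers, memory and instructions. -/
class Cell (α : Type) where
  get {P : ℕ} : SIMD P → Fin P → ℕ → α
  set {P : ℕ} : SIMD P → ℕ → (Fin P → α) → SIMD P
  mem {P : ℕ} : SIMD P → ℕ → α
  setMem {P : ℕ} : SIMD P → (ℕ → α) → SIMD P
  load : ℕ → ℕ → Instr
  store : ℕ → ℕ → Instr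
  exec_load {P : ℕ} (W d a : ℕ) (s : SIMD P) :
    Exec W [load d a] 1 s (set s d fun p => mem s (s.word p a))
  exec_store {P : ℕ} (W a d : ℕ) (s : SIMD P) :
    Exec W [store a d] 1 s
      (setMem s (resolve (fun p => some (s.word p a, get s p d)) (mem s)))
  load_isLocal (d a : ℕ) : (load d a).IsLocal
  apply_load {P : ℕ} (W d a : ℕ) (s : SIMD P) (sel : Fin P → Prop) [DecidablePred sel] :
    s.apply W (load d a) sel = set s d fun p => if sel p then mem s (s.word p a) else get s p d
  get_set {P : ℕ} (s : SIMD P) (d : ℕ) (f : Fin P → α) (p : Fin P) : get (set s d f) p d = f p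
  agree_set {P : ℕ} (s : SIMD P) (b B d : ℕ) (f : Fin P → α) (h : b ≤ d) : Agree b B s (set s d f)
  mem_setMem {P : ℕ} (s : SIMD P) (m : ℕ → α) : mem (setMem s m) = m
  word_setMem {P : ℕ} (s : SIMD P) (m : ℕ → α) : (setMem s m).word = s.word
  agree_setMem {P : ℕ} (s : SIMD P) (b B : ℕ) (m : ℕ → α) (h : ∀ a < B, m a = mem s a) :
    Agree b B s (setMem s m)
  get_congr {P : ℕ} {s s' : SIMD P} {b B d : ℕ} (h : Agree b B s s') (hd : d < b) (p : Fin P) :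
    get s' p d = get s p d
  mem_congr {P : ℕ} {s s' : SIMD P} {b B a : ℕ} (h : Agree b B s s') (ha : a < B) :
    mem s' a = mem s a
  get_congr_reg {P : ℕ} {s s' : SIMD P} {d : ℕ} (h : ∀ p, s'.word p d = s.word p d)
    (h' : ∀ p, s'.real p d = s.real p d) (p : Fin P) : get s' p d = get s p d

theorem Exec.store {P W : ℕ} {i : Instr} {s : SIMD P} {s' : SIMD P}
    (hs : ∀ o, i.shift o = i)
    (h : ∀ pc (u : Fin P → ℝ), (⟨fun p => i.exec W (u p) s.wmem s.rmem ⟨pc, s.word p, s.real p⟩,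
      resolve (fun p => i.wordWrite ⟨pc, s.word p, s.real p⟩) s.wmem,
      resolve (fun p => i.realWrite ⟨pc, s.word p, s.real p⟩) s.rmem⟩ : Config P) =
      s'.config (pc + 1)) : Exec W [i] 1 s s' := by
  intro prog o ho
  have h0 : prog[o]? = some i := by simpa [hs] using ho 0 (by simp)
  refine StepsTo.of_step fun u => ?_
  simp only [step, SIMD.config, h0, Option.bind_some]
  simpa [SIMD.config] using h o u

noncomputable instance : Cell ℕ where
  get s p d := s.word p d
  set s d f := { s with word := fun p => Function.update (s.word p) d (f p) }
  mem s := s.wmem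
  setMem s m := { s with wmem := m }
  load := .wload
  store := .wstore
  exec_load W d a s := by
    have := exec_local (W := W) (i := .wload d a) (by simp [Instr.IsLocal]) s
    simpa [SIMD.apply, Instr.exec, Proc.setWord] using this
  exec_store W a d s := by
    refine Exec.store (fun _ => rfl) fun pc u => ?_
    simp [SIMD.config, Instr.exec, Instr.wordWrite, Instr.realWrite, resolve_none]
  load_isLocal d a := by simp [Instr.IsLocal]
  apply_load W d a s sel _ := by
    ext p r
    · by_cases h : sel p <;> simp [SIMD.apply, h, Instr.exec, Proc.setWord]
    · simp [SIMD.apply, Instr.exec, Proc.setWord]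
    · rfl
    · rfl
  get_set := by simp
  agree_set s b B d f h :=
    ⟨fun p r hr => ⟨Function.update_of_ne (by omega) _ _, rfl⟩, fun _ _ => ⟨rfl, rfl⟩⟩
  mem_setMem _ _ := rfl
  word_setMem _ _ := rfl
  agree_setMem s b B m h := ⟨fun _ _ _ => ⟨rfl, rfl⟩, fun a ha => ⟨h a ha, rfl⟩⟩
  get_congr h hd p := (h.1 p _ hd).1
  mem_congr h ha := (h.2 _ ha).1
  get_congr_reg h _ p := h p

noncomputable instance : Cell ℝ where
  get s p d := s.real p d
  set s d f := { s with real := fun p => Function.update (s.real p) d (f p) }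
  mem s := s.rmem
  setMem s m := { s with rmem := m }
  load := .rload
  store := .rstore
  exec_load W d a s := by
    have := exec_local (W := W) (i := .rload d a) (by simp [Instr.IsLocal]) s
    simpa [SIMD.apply, Instr.exec, Proc.setReal] using this
  exec_store W a d s := by
    refine Exec.store (fun _ => rfl) fun pc u => ?_
    simp [SIMD.config, Instr.exec, Instr.wordWrite, Instr.realWrite, resolve_none]
  load_isLocal d a := by simp [Instr.IsLocal]
  apply_load W d a s sel _ := by
    ext p r
    · simp [SIMD.apply, Instr.exec, Proc.setReal]
    · by_cases h : sel p <;> simp [SIMD.apply, h, Instr.exec, Proc.setReal]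
    · rfl
    · rfl
  get_set := by simp
  agree_set s b B d f h :=
    ⟨fun p r hr => ⟨rfl, Function.update_of_ne (by omega) _ _⟩, fun _ _ => ⟨rfl, rfl⟩⟩
  mem_setMem _ _ := rfl
  word_setMem _ _ := rfl
  agree_setMem s b B m h := ⟨fun _ _ _ => ⟨rfl, rfl⟩, fun a ha => ⟨rfl, h a ha⟩⟩
  get_congr h hd p := (h.1 p _ hd).2
  mem_congr h ha := (h.2 _ ha).2
  get_congr_reg _ h p := h p

end PRAM

/-! ### Functions of the processor number computed in lock-step -/

namespace PRAM

/-- Parameters of a machine: number of processors, word bound, base of the digit representation of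
processor numbers, bound for the addresses of the input, the input, and one random number for
every processor. -/
structure Machine where
  P : ℕ
  W : ℕ
  D : ℕ
  B : ℕ
  win : ℕ → ℕ
  rin : ℕ → ℝ
  u : ℕ → ℝ
  -- Processor `p` owns the scratch cell `B + p` beyond the input; its address has to be a word.
  B_add_P_le : B + P ≤ W
  two_le_D : 2 ≤ D
  D_pow_le : D ^ 6 ≤ P

namespace Machine

/-- The scale for the running times. -/
def lg (M : Machine) : ℕ := Nat.clog 2 M.D

theorem one_le_lg (M : Machine) : 1 ≤ M.lg :=
  Nat.clog_pos (by norm_num) M.two_le_D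

theorem two_pow_lt_iff (M : Machine) (j : ℕ) : 2 ^ j < M.D ↔ j < M.lg :=
  (Nat.lt_clog_iff_pow_lt (by norm_num)).symm

theorem P_le (M : Machine) : M.P ≤ M.W := le_trans (Nat.le_add_left _ _) M.B_add_P_le

theorem pow_le_P (M : Machine) {a : ℕ} (ha : a ≤ 6) : M.D ^ a ≤ M.P :=
  (Nat.pow_le_pow_right (by have := M.two_le_D; omega) ha).trans M.D_pow_le

theorem pow_le_W (M : Machine) {a : ℕ} (ha : a ≤ 6) : M.D ^ a ≤ M.W :=
  (M.pow_le_P ha).trans M.P_le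

theorem sixty_four_le (M : Machine) : 64 ≤ M.W :=
  le_trans (le_trans (by norm_num) (Nat.pow_le_pow_left M.two_le_D 6)) (M.pow_le_W le_rfl)

/-- The reserved registers and the input cells have their values. -/
def Base (M : Machine) (s : SIMD M.P) : Prop :=
  (∀ p, s.word p 0 = p ∧ s.word p 1 = M.B ∧ s.word p 2 = M.B + p ∧ s.word p 3 = M.D ∧
    s.real p 0 = M.u p) ∧ ∀ a < M.B, s.wmem a = M.win a ∧ s.rmem a = M.rin a

end Machine

/-- A family of machines together with an assertion about their registers below `b0`. -/
structure Ctx (X : Type) where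
  mach : X → Machine
  Inv : ∀ x, SIMD (mach x).P → Prop
  b0 : ℕ
  four_le : 4 ≤ b0
  stable : ∀ x s s', Inv x s → Agree b0 (mach x).B s s' → Inv x s'
  base : ∀ x s, Inv x s → (mach x).Base s

/-- The fragment `F` turns states with `pre` into states with `post` in polylogarithmic time. -/
def Runs {X : Type} (C : Ctx X) (b : ℕ) (F : List Instr) (pre post : ∀ x, SIMD (C.mach x).P → Prop) :
    Prop :=
  ∃ κ : ℕ, ∀ x s, C.Inv x s → pre x s → ∃ t s', t ≤ κ * (C.mach x).lg ^ κ ∧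
    Exec (C.mach x).W F t s s' ∧ Agree b (C.mach x).B s s' ∧ post x s'

/-- Register `b` of every processor holds its value of `f`. -/
def Holds {X α : Type} [Cell α] (C : Ctx X) (b : ℕ) (f : X → ℕ → α) (x : X)
    (s : SIMD (C.mach x).P) : Prop :=
  ∀ p, Cell.get s p b = f x p

/-- There is code that lets every processor compute its value of `f` in polylogarithmic time,
using only registers from any given number on. -/
def Comp {X α : Type} [Cell α] (C : Ctx X) (f : X → ℕ → α) : Prop :=
  ∀ b, C.b0 ≤ b → ∃ F, Runs C b F (fun _ _ => True) (Holds C b f)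

variable {X α β γ : Type} [Cell α] [Cell β] [Cell γ] {C : Ctx X}

theorem polylog_add {l : ℕ} (hl : 1 ≤ l) (a b : ℕ) :
    a * l ^ a + b * l ^ b ≤ (a + b) * l ^ (a + b) := by
  rw [add_mul]
  gcongr <;> omega

theorem Runs.seq {b b₁ b₂ : ℕ} {F G : List Instr} {pre mid post : ∀ x, SIMD (C.mach x).P → Prop}
    (h₁ : Runs C b₁ F pre mid) (h₂ : Runs C b₂ G mid post) (hb₀ : C.b0 ≤ b₁) (hb₁ : b ≤ b₁)
    (hb₂ : b ≤ b₂) : Runs C b (seq F G) pre post := by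
  obtain ⟨κ₁, h₁⟩ := h₁
  obtain ⟨κ₂, h₂⟩ := h₂
  refine ⟨κ₁ + κ₂, fun x s hs hpre => ?_⟩
  obtain ⟨t₁, s₁, ht₁, e₁, a₁, hmid⟩ := h₁ x s hs hpre
  obtain ⟨t₂, s₂, ht₂, e₂, a₂, hpost⟩ := h₂ x s₁ (C.stable x s s₁ hs (a₁.mono hb₀)) hmid
  exact ⟨t₁ + t₂, s₂, (Nat.add_le_add ht₁ ht₂).trans (polylog_add (C.mach x).one_le_lg _ _),
    e₁.seq e₂, (a₁.mono hb₁).trans (a₂.mono hb₂), hpost⟩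

theorem Runs.of_exec {b t : ℕ} {F : List Instr} {pre post : ∀ x, SIMD (C.mach x).P → Prop}
    (h : ∀ x s, C.Inv x s → pre x s → ∃ s', Exec (C.mach x).W F t s s' ∧
      Agree b (C.mach x).B s s' ∧ post x s') : Runs C b F pre post := by
  refine ⟨t, fun x s hs hpre => ?_⟩
  obtain ⟨s', h'⟩ := h x s hs hpre
  exact ⟨t, s', Nat.le_mul_of_pos_right _ (Nat.pow_pos (C.mach x).one_le_lg), h'⟩

/-- The code for `f` leaves everything below register `b'` untouched, so earlier results recorded in
`R` survive. Operands can thus be evaluated one after another into successive registers. -/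
theorem Comp.push {f : X → ℕ → α} (hf : Comp C f) {b b' : ℕ} (hb : C.b0 ≤ b') (hbb : b ≤ b')
    {R post : ∀ x, SIMD (C.mach x).P → Prop}
    (hR : ∀ x s s', Agree b' (C.mach x).B s s' → R x s → R x s')
    (h : ∃ G, Runs C b G (fun x s => R x s ∧ Holds C b' f x s) post) : ∃ G, Runs C b G R post := by
  obtain ⟨F, κ, hF⟩ := hf b' hb
  obtain ⟨G, hG⟩ := h
  refine ⟨seq F G, Runs.seq (b₁ := b') ⟨κ, fun x s hs hr => ?_⟩ hG hb hbb le_rfl⟩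
  obtain ⟨t, s', ht, e, a, hh⟩ := hF x s hs trivial
  exact ⟨t, s', ht, e, a, hR x s s' a hr, hh⟩

theorem Holds.of_agree {f : X → ℕ → α} {b b' : ℕ} (hb : b < b') (x : X)
    (s s' : SIMD (C.mach x).P) (h : Agree b' (C.mach x).B s s') (hf : Holds C b f x s) :
    Holds C b f x s' := fun p => by rw [Cell.get_congr h hb, hf p]

theorem Comp.bind {f : X → ℕ → α} {h : X → ℕ → β} (hf : Comp C f)
    (hG : ∀ b, C.b0 ≤ b → ∃ G, Runs C b G (Holds C b f) (Holds C b h)) : Comp C h := by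
  intro b hb
  refine hf.push hb le_rfl (fun _ _ _ _ _ => trivial) ?_
  obtain ⟨G, κ, hG⟩ := hG b hb
  exact ⟨G, κ, fun x s hs hp => hG x s hs hp.2⟩

theorem Comp.bind₂ {f : X → ℕ → α} {g : X → ℕ → β} {h : X → ℕ → γ} (hf : Comp C f)
    (hg : Comp C g) (hG : ∀ b, C.b0 ≤ b → ∃ G, Runs C b G
      (fun x s => Holds C b f x s ∧ Holds C (b + 1) g x s) (Holds C b h)) : Comp C h :=
  hf.bind fun b hb => hg.push (b' := b + 1) (by omega) (by omega)
    (fun x s s' => Holds.of_agree (by omega) x s s') (hG b hb)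

theorem Comp.congr {f g : X → ℕ → α} (hf : Comp C f) (h : ∀ x, ∀ p < (C.mach x).P, f x p = g x p) :
    Comp C g := by
  intro b hb
  obtain ⟨F, κ, hF⟩ := hf b hb
  refine ⟨F, κ, fun x s hs hp => ?_⟩
  obtain ⟨t, s', ht, e, a, hh⟩ := hF x s hs hp
  exact ⟨t, s', ht, e, a, fun p => (hh p).trans (h x p p.2)⟩

/-- Store every processor's value from register `d` to its own scratch cell. -/
theorem exec_store_own {M : Machine} {s : SIMD M.P} (hs : ∀ p, s.word p 2 = M.B + p) (d : ℕ) :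
    ∃ m : ℕ → α, Exec M.W [Cell.store α 2 d] 1 s (Cell.setMem s m) ∧
      (∀ p : Fin M.P, m (M.B + p) = Cell.get s p d) ∧ ∀ a < M.B, m a = Cell.mem s a := by
  refine ⟨_, Cell.exec_store M.W 2 d s, fun p => ?_, fun a ha => ?_⟩
  · have := resolve_of_injective (fun p => s.word p 2) (fun p => (Cell.get s p d : α))
      (Cell.mem s) (fun p q hpq => by simpa [hs, Fin.ext_iff] using hpq) p
    simpa [hs] using this
  · refine resolve_of_ne _ _ _ fun p r hr => ?_
    have : (s.word p 2, Cell.get s p d) = r := by simpa using hr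
    rw [← this]
    simp only [hs]
    omega

/-- Copy a register. -/
theorem runs_copy (f : X → ℕ → α) {b d e : ℕ} (hbd : b ≤ e) :
    Runs C b (seq [Cell.store α 2 d] [Cell.load α e 2]) (Holds C d f) (Holds C e f) := by
  -- The copy goes through the scratch cell of the processor, which works alike for words and for
  -- reals.
  refine Runs.of_exec (t := 2) fun x s hs hf => ?_
  have hw : ∀ p, s.word p 2 = (C.mach x).B + p := fun p => ((C.base x s hs).1 p).2.2.1
  obtain ⟨m, e₁, hm, hm'⟩ := exec_store_own (α := α) hw d
  refine ⟨_, e₁.seq (Cell.exec_load _ e 2 _), ?_, fun p => ?_⟩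
  · exact (Cell.agree_setMem s b _ m hm').trans (Cell.agree_set _ _ _ _ _ hbd)
  · rw [Cell.get_set, Cell.mem_setMem, Cell.word_setMem, hw, hm, hf]

theorem Comp.of_get {f : X → ℕ → α} (d : ℕ) (h : ∀ x s, C.Inv x s → Holds C d f x s) :
    Comp C f := fun b _ => by
  obtain ⟨κ, hF⟩ := runs_copy (C := C) f (b := b) (d := d) le_rfl
  exact ⟨_, κ, fun x s hs _ => hF x s hs (h x s hs)⟩

theorem Comp.pid : Comp C (fun _ p => p) :=
  Comp.of_get 0 fun x s hs p => ((C.base x s hs).1 p).1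

theorem Comp.D : Comp C (fun x _ => (C.mach x).D) :=
  Comp.of_get 3 fun x s hs p => ((C.base x s hs).1 p).2.2.2.1

theorem Comp.u : Comp C (fun x p => (C.mach x).u p) :=
  Comp.of_get 0 fun x s hs p => ((C.base x s hs).1 p).2.2.2.2

/-- The bound `64` comes from `2 ^ 6 ≤ D ^ 6 ≤ W`: such constants are not changed by the reduction
modulo `W`. -/
theorem Comp.const (c : ℕ) (hc : c < 64) : Comp C (fun _ _ => c) := fun b _ => by
  refine ⟨[.wconst b c], Runs.of_exec (t := 1) fun x s _ _ => ?_⟩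
  refine ⟨_, exec_local (by simp [Instr.IsLocal]) s, ?_, fun p => ?_⟩
  · exact ⟨fun p r hr => by simp [SIMD.apply, Instr.exec, Proc.setWord, show r ≠ b by omega],
      fun a _ => by simp [SIMD.apply]⟩
  · have := (C.mach x).sixty_four_le
    simpa [Cell.get, SIMD.apply, Instr.exec, Proc.setWord] using Nat.mod_eq_of_lt (by omega)

theorem Comp.wop {f g : X → ℕ → ℕ} (o : WordOp) (hf : Comp C f) (hg : Comp C g) :
    Comp C (fun x p => o.eval (f x p) (g x p) % (C.mach x).W) :=
  hf.bind₂ hg fun b _ => by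
    refine ⟨[.wop o b b (b + 1)], Runs.of_exec (t := 1) fun x s _ h => ?_⟩
    refine ⟨_, exec_local (by simp [Instr.IsLocal]) s, ?_, fun p => ?_⟩
    · exact ⟨fun p r hr => by simp [SIMD.apply, Instr.exec, Proc.setWord, show r ≠ b by omega],
        fun a _ => by simp [SIMD.apply]⟩
    · have h1 := h.1 p
      have h2 := h.2 p
      simp only [Cell.get] at h1 h2
      simp [Cell.get, SIMD.apply, Instr.exec, Proc.setWord, h1, h2]

theorem Comp.rop {f g : X → ℕ → ℝ} (o : RealOp) (hf : Comp C f) (hg : Comp C g) :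
    Comp C (fun x p => o.eval (f x p) (g x p)) :=
  hf.bind₂ hg fun b _ => by
    refine ⟨[.rop o b b (b + 1)], Runs.of_exec (t := 1) fun x s _ h => ?_⟩
    refine ⟨_, exec_local (by simp [Instr.IsLocal]) s, ?_, fun p => ?_⟩
    · exact ⟨fun p r hr => by simp [SIMD.apply, Instr.exec, Proc.setReal, show r ≠ b by omega],
        fun a _ => by simp [SIMD.apply]⟩
    · have h1 := h.1 p
      have h2 := h.2 p
      simp only [Cell.get] at h1 h2
      simp [Cell.get, SIMD.apply, Instr.exec, Proc.setReal, h1, h2]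

theorem Comp.cast {f : X → ℕ → ℕ} (hf : Comp C f) : Comp C (fun x p => (f x p : ℝ)) :=
  hf.bind fun b _ => by
    refine ⟨[.cast b b], Runs.of_exec (t := 1) fun x s _ h => ?_⟩
    refine ⟨_, exec_local (by simp [Instr.IsLocal]) s, ?_, fun p => ?_⟩
    · exact ⟨fun p r hr => by simp [SIMD.apply, Instr.exec, Proc.setReal, show r ≠ b by omega],
        fun a _ => by simp [SIMD.apply]⟩
    · have h1 := h p
      simp only [Cell.get] at h1
      simp [Cell.get, SIMD.apply, Instr.exec, Proc.setReal, h1]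

/-- Read from the input. -/
theorem Comp.input {f : X → ℕ → ℕ} (hf : Comp C f) (hB : ∀ x, ∀ p < (C.mach x).P, f x p < (C.mach x).B)
    (val : X → ℕ → α) (hval : ∀ x s, C.Inv x s → ∀ a < (C.mach x).B, Cell.mem s a = val x a) :
    Comp C (fun x p => val x (f x p)) :=
  hf.bind fun b _ => by
    refine ⟨[Cell.load α b b], Runs.of_exec (t := 1) fun x s hs h => ?_⟩
    refine ⟨_, Cell.exec_load _ b b s, Cell.agree_set _ _ _ _ _ le_rfl, fun p => ?_⟩
    have h1 : s.word p b = f x p := h p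
    rw [Cell.get_set, h1, hval x s hs _ (hB x p p.2)]

theorem Comp.win {f : X → ℕ → ℕ} (hf : Comp C f)
    (hB : ∀ x, ∀ p < (C.mach x).P, f x p < (C.mach x).B) :
    Comp C (fun x p => (C.mach x).win (f x p)) :=
  hf.input hB _ fun x s hs a ha => ((C.base x s hs).2 a ha).1

theorem Comp.rin {f : X → ℕ → ℕ} (hf : Comp C f)
    (hB : ∀ x, ∀ p < (C.mach x).P, f x p < (C.mach x).B) :
    Comp C (fun x p => (C.mach x).rin (f x p)) :=
  hf.input hB _ fun x s hs a ha => ((C.base x s hs).2 a ha).2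

/-- Every processor reads the value of another one. -/
theorem Comp.gather {f : X → ℕ → α} {i : X → ℕ → ℕ} (hf : Comp C f) (hi : Comp C i)
    (hP : ∀ x, ∀ p < (C.mach x).P, i x p < (C.mach x).P) : Comp C (fun x p => f x (i x p)) :=
  hf.bind₂ hi fun b hb => by
    have hb4 := C.four_le
    -- Every processor publishes its value in its scratch cell. Then it adds `B`, held by register
    -- `1`, to the wanted processor number and loads from that address.
    refine ⟨seq [Cell.store α 2 b] (seq [.wop .add (b + 1) 1 (b + 1)] [Cell.load α b (b + 1)]),
      Runs.of_exec (t := 1 + (1 + 1)) fun x s hs h => ?_⟩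
    have hw := (C.base x s hs).1
    obtain ⟨m, e₁, hm, hm'⟩ := exec_store_own (α := α) (fun p => (hw p).2.2.1) b
    have e₂ := exec_local (W := (C.mach x).W) (i := .wop .add (b + 1) 1 (b + 1))
      (by simp [Instr.IsLocal]) (Cell.setMem s m)
    refine ⟨_, e₁.seq (e₂.seq (Cell.exec_load _ b (b + 1) _)), ?_, fun p => ?_⟩
    · refine (Cell.agree_setMem s b _ m hm').trans (Agree.trans ?_ (Cell.agree_set _ _ _ _ _ le_rfl))
      exact ⟨fun p r hr => by
          simp [SIMD.apply, Instr.exec, Proc.setWord, show r ≠ b + 1 by omega],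
        fun a _ => by simp [SIMD.apply]⟩
    · have hmem : ∀ s' : SIMD (C.mach x).P,
          (Cell.mem (s'.apply (C.mach x).W (.wop .add (b + 1) 1 (b + 1)) fun _ => True) : ℕ → α) =
            Cell.mem s' := fun s' => by
        funext a
        exact Cell.mem_congr (b := 0) (B := a + 1) ⟨by simp, by simp [SIMD.apply]⟩ (by omega)
      rw [Cell.get_set, hmem, Cell.mem_setMem]
      have h2 : s.word p (b + 1) = i x p := h.2 p
      have hip := hP x p p.2
      have hlt : (C.mach x).B + i x p < (C.mach x).W := by
        have := (C.mach x).B_add_P_le; omega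
      have ha : ((Cell.setMem s m).apply (C.mach x).W (.wop .add (b + 1) 1 (b + 1))
          fun _ => True).word p (b + 1) = (C.mach x).B + i x p := by
        simp [SIMD.apply, Instr.exec, Proc.setWord, Cell.word_setMem, WordOp.eval, h2,
          (hw p).2.1, Nat.mod_eq_of_lt hlt]
      rw [ha, show (C.mach x).B + i x p = (C.mach x).B + ((⟨i x p, hip⟩ : Fin _) : ℕ) from rfl, hm,
        h.1 ⟨i x p, hip⟩]

end PRAM

namespace PRAM

variable {X α β : Type} [Cell α] [Cell β] {C : Ctx X}

/-! ### Selection and loops -/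

theorem Agree.apply_local {P W b B d : ℕ} {s : SIMD P} (h : b ≤ d) (sel : Fin P → Prop)
    [DecidablePred sel] (a : ℕ) : Agree b B s (s.apply W (Cell.load α d a) sel) := by
  rw [Cell.apply_load]
  exact Cell.agree_set _ _ _ _ _ h

/-- Selection by a comparison of two values through a conditional jump. -/
theorem Comp.select {a b : X → ℕ → β} {f g : X → ℕ → α} (ha : Comp C a) (hb : Comp C b)
    (hf : Comp C f) (hg : Comp C g) (sel : β → β → Prop) [DecidableRel sel]
    (cj : ℕ → ℕ → Instr)
    (hcj : ∀ {P : ℕ} (s : SIMD P) (d e o W : ℕ) (u : ℝ) (p : Fin P),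
      ((cj d e).shift o).exec W u s.wmem s.rmem ⟨o, s.word p, s.real p⟩ =
      ⟨if sel (Cell.get s p d) (Cell.get s p e) then o + 2 else o + 1, s.word p, s.real p⟩)
    (hw : ∀ d e o q, ((cj d e).shift o).wordWrite q = none)
    (hr : ∀ d e o q, ((cj d e).shift o).realWrite q = none) :
    Comp C (fun x p => if sel (a x p) (b x p) then f x p else g x p) :=
  ha.bind₂ hb fun c hc => by
    refine hg.push (b' := c + 2) (by omega) (by omega) (fun x s s' h h' =>
      ⟨h'.1.of_agree (by omega) x s s' h, h'.2.of_agree (by omega) x s s' h⟩) ?_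
    refine hf.push (b' := c + 3) (by omega) (by omega) (fun x s s' h h' =>
      ⟨⟨h'.1.1.of_agree (by omega) x s s' h, h'.1.2.of_agree (by omega) x s s' h⟩,
        h'.2.of_agree (by omega) x s s' h⟩) ?_
    -- The value of `g` is already in register `c + 2`. The value of `f` is parked in the scratch
    -- cell, so that a single conditional load overwrites `g` by `f` where the comparison holds.
    refine ⟨_, Runs.seq (b₁ := c + 2) (mid := Holds C (c + 2) _)
      (F := seq [Cell.store α 2 (c + 3)] [cj c (c + 1), .jump 3, Cell.load α (c + 2) 2])
      (Runs.of_exec (t := 1 + 2) fun x s hs h => ?_) (runs_copy _ (b := c) le_rfl)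
      (by omega) (by omega) le_rfl⟩
    obtain ⟨⟨⟨h₁, h₂⟩, h₃⟩, h₄⟩ := h
    have hwd : ∀ p, s.word p 2 = (C.mach x).B + p := fun p => ((C.base x s hs).1 p).2.2.1
    obtain ⟨m, e₁, hm, hm'⟩ := exec_store_own (α := α) hwd (c + 3)
    set s₁ : SIMD (C.mach x).P := Cell.setMem s m with hs₁
    have e₂ := exec_cond (W := (C.mach x).W) (Cell.load_isLocal (α := α) (c + 2) 2) s₁
      (fun p => sel (Cell.get s₁ p c) (Cell.get s₁ p (c + 1)))
      (fun o u p => hcj s₁ c (c + 1) o _ u p) (hw c (c + 1)) (hr c (c + 1))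
    have hA : Agree (c + 4) (C.mach x).B s s₁ := Cell.agree_setMem s _ _ m hm'
    refine ⟨_, e₁.seq e₂, (hA.mono (by omega)).trans (Agree.apply_local le_rfl _ _), fun p => ?_⟩
    rw [Cell.apply_load, Cell.get_set, Cell.get_congr hA (by omega), Cell.get_congr hA (by omega),
      Cell.get_congr hA (by omega), h₁, h₂, h₃, (hA.1 p 2 (by omega)).1, hwd, hs₁, Cell.mem_setMem,
      hm, h₄]

theorem Comp.ite_lt {a b : X → ℕ → ℕ} {f g : X → ℕ → α} (ha : Comp C a) (hb : Comp C b)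
    (hf : Comp C f) (hg : Comp C g) :
    Comp C (fun x p => if a x p < b x p then f x p else g x p) :=
  ha.select hb hf hg (· < ·) (fun d e => .wjump d e 2)
    (fun s d e o W u p => by simp [Instr.shift, Instr.exec, Cell.get]) (fun _ _ _ _ => rfl)
    (fun _ _ _ _ => rfl)

open Classical in
theorem Comp.ite_lt_real {a b : X → ℕ → ℝ} {f g : X → ℕ → α} (ha : Comp C a) (hb : Comp C b)
    (hf : Comp C f) (hg : Comp C g) :
    Comp C (fun x p => if a x p < b x p then f x p else g x p) :=
  ha.select hb hf hg (· < ·) (fun d e => .rjump d e 2)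
    (fun s d e o W u p => by simp [Instr.shift, Instr.exec, Cell.get]) (fun _ _ _ _ => rfl)
    (fun _ _ _ _ => rfl)

/-- The context inside a doubling loop: the stride and the current value of the loop variable are
in registers `b` and `b + 1`. -/
def Ctx.ext (C : Ctx X) (α : Type) [Cell α] (b : ℕ) (hb : C.b0 ≤ b) : Ctx (X × ℕ × (ℕ → α)) where
  mach y := C.mach y.1
  Inv y s := C.Inv y.1 s ∧ (∀ p, s.word p b = y.2.1) ∧ y.2.1 < (C.mach y.1).D ∧
    ∀ p, Cell.get s p (b + 1) = y.2.2 p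
  b0 := b + 2
  four_le := by have := C.four_le; omega
  stable y s s' h a := ⟨C.stable y.1 s s' h.1 (a.mono (by omega)),
    fun p => by rw [(a.1 p b (by omega)).1, h.2.1], h.2.2.1,
    fun p => by rw [Cell.get_congr a (by omega), h.2.2.2]⟩
  base y s h := C.base y.1 s h.1

theorem Comp.lift {f : X → ℕ → β} (hf : Comp C f) {b : ℕ} (hb : C.b0 ≤ b) :
    Comp (C.ext α b hb) (fun y p => f y.1 p) := fun b' hb' => by
  obtain ⟨F, κ, hF⟩ := hf b' (by have : b + 2 ≤ b' := hb'; omega)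
  exact ⟨F, κ, fun y s hs hp => hF y.1 s hs.1 hp⟩

theorem Comp.ext_stride {b : ℕ} (hb : C.b0 ≤ b) : Comp (C.ext α b hb) (fun y _ => y.2.1) :=
  Comp.of_get b fun _ _ hs => hs.2.1

theorem Comp.ext_var {b : ℕ} (hb : C.b0 ≤ b) : Comp (C.ext α b hb) (fun y p => y.2.2 p) :=
  Comp.of_get (b + 1) fun _ _ hs => hs.2.2.2

/-- Value of the loop variable after a number of rounds; the strides are `1, 2, 4, …`. -/
def loopVal (body : X × ℕ × (ℕ → α) → ℕ → α) (x : X) (A : ℕ → α) : ℕ → ℕ → α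
  | 0 => A
  | j + 1 => body (x, 2 ^ j, loopVal body x A j)

/-- Copy the value computed by `F` into the loop variable, double the stride, and repeat. -/
def loopCode (α : Type) [Cell α] (b : ℕ) (F : List Instr) : List Instr :=
  seq F (seq (seq [Cell.store α 2 (b + 2)] [Cell.load α (b + 1) 2]) [.wop .add b b b]) ++
    -- Register `3` holds `D`, so the body runs with the strides `1, 2, 4, …` below `D`, that is,
    -- `lg` times.
    [.wjump b 3 0]

theorem Exec.loop_round {b : ℕ} (hb : C.b0 ≤ b) {F : List Instr}
    {body : X × ℕ × (ℕ → α) → ℕ → α} {κ : ℕ}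
    (hF : ∀ y s, (C.ext α b hb).Inv y s → True → ∃ t s', t ≤ κ * (C.mach y.1).lg ^ κ ∧
      Exec (C.mach y.1).W F t s s' ∧ Agree (b + 2) (C.mach y.1).B s s' ∧
      Holds (C.ext α b hb) (b + 2) body y s')
    (x : X) (j : ℕ) (A : ℕ → α) (s : SIMD (C.mach x).P) (hs : C.Inv x s)
    (hstr : ∀ p, s.word p b = 2 ^ j) (hj : j < (C.mach x).lg)
    (hvar : ∀ p, Cell.get s p (b + 1) = A p) :
    ∃ t s', t ≤ κ * (C.mach x).lg ^ κ + 3 ∧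
      Exec (C.mach x).W (PRAM.seq F (PRAM.seq (PRAM.seq [Cell.store α 2 (b + 2)]
        [Cell.load α (b + 1) 2]) [.wop .add b b b])) t s s' ∧
      Agree b (C.mach x).B s s' ∧ (∀ p, s'.word p b = 2 ^ (j + 1)) ∧
      ∀ p, Cell.get s' p (b + 1) = body (x, 2 ^ j, A) p := by
  have hD := ((C.mach x).two_pow_lt_iff j).mpr hj
  obtain ⟨t, s₁, ht, e₁, a₁, h₁⟩ : ∃ t, ∃ s₁ : SIMD (C.mach x).P, t ≤ κ * (C.mach x).lg ^ κ ∧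
      Exec (C.mach x).W F t s s₁ ∧ Agree (b + 2) (C.mach x).B s s₁ ∧
      ∀ p, Cell.get s₁ p (b + 2) = body (x, 2 ^ j, A) p :=
    hF (x, 2 ^ j, A) s ⟨hs, hstr, hD, hvar⟩ trivial
  have hw₁ : ∀ p, s₁.word p 2 = (C.mach x).B + p := fun p => by
    have := C.four_le
    rw [(a₁.1 p 2 (by omega)).1]
    exact ((C.base x s hs).1 p).2.2.1
  obtain ⟨m, e₂, hm, hm'⟩ := exec_store_own (α := α) hw₁ (b + 2)
  set s₂ : SIMD (C.mach x).P := Cell.setMem s₁ m with hs₂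
  have a₂ : Agree (b + 3) (C.mach x).B s₁ s₂ := Cell.agree_setMem s₁ _ _ m hm'
  have e₃ := Cell.exec_load (α := α) (C.mach x).W (b + 1) 2 s₂
  set s₃ : SIMD (C.mach x).P := Cell.set s₂ (b + 1) fun p => (Cell.mem s₂ (s₂.word p 2) : α) with hs₃
  have a₃ : Agree (b + 1) (C.mach x).B s₂ s₃ := Cell.agree_set _ _ _ _ _ le_rfl
  have e₄ := exec_local (W := (C.mach x).W) (i := .wop .add b b b) (by simp [Instr.IsLocal]) s₃
  have hget : ∀ p, Cell.get s₃ p (b + 1) = body (x, 2 ^ j, A) p := fun p => by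
    rw [hs₃, Cell.get_set, (a₂.1 p 2 (by have := C.four_le; omega)).1, hw₁, hs₂, Cell.mem_setMem,
      hm, h₁]
  have hstr₃ : ∀ p, s₃.word p b = 2 ^ j := fun p => by
    rw [(a₃.1 p b (by omega)).1, (a₂.1 p b (by omega)).1, (a₁.1 p b (by omega)).1, hstr]
  -- Doubling does not overflow: the stride is below `D`, and `2 * D ≤ D ^ 6 ≤ W`.
  have hlt : 2 ^ j + 2 ^ j < (C.mach x).W := by
    have h2 := (C.mach x).pow_le_W (a := 6) le_rfl
    have h3 := (C.mach x).two_le_D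
    have : (C.mach x).D * 2 ≤ (C.mach x).D ^ 6 := by
      calc (C.mach x).D * 2 ≤ (C.mach x).D * (C.mach x).D := by gcongr
        _ = (C.mach x).D ^ 2 := by ring
        _ ≤ _ := Nat.pow_le_pow_right (by omega) (by norm_num)
    omega
  have hword : ∀ p r, (s₃.apply (C.mach x).W (.wop .add b b b) fun _ => True).word p r =
      if r = b then 2 ^ (j + 1) else s₃.word p r := fun p r => by
    by_cases hr : r = b
    · subst hr
      simp [SIMD.apply, Instr.exec, Proc.setWord, WordOp.eval, hstr₃, Nat.mod_eq_of_lt hlt, pow_succ,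
        mul_two]
    · simp [SIMD.apply, Instr.exec, Proc.setWord, hr]
  refine ⟨t + (1 + 1 + 1), _, by omega, e₁.seq ((e₂.seq e₃).seq e₄), ?_, fun p => ?_, fun p => ?_⟩
  · refine (a₁.mono (by omega)).trans ((a₂.mono (by omega)).trans ((a₃.mono (by omega)).trans ?_))
    exact ⟨fun p r hr => ⟨by rw [hword, if_neg (by omega)], by
      simp [SIMD.apply, Instr.exec, Proc.setWord]⟩, fun a _ => by simp [SIMD.apply]⟩
  · rw [hword, if_pos rfl]
  · rw [← hget p]
    set s₄ := s₃.apply (C.mach x).W (.wop .add b b b) fun _ => True with hs₄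
    refine Cell.get_congr_reg (fun q => ?_) (fun q => ?_) p
    · rw [hword, if_neg (by omega)]
    · simp [hs₄, SIMD.apply, Instr.exec, Proc.setWord]

/-- The induction runs over the number `i` of rounds that follow the current round `j`; the loop
ends after round `lg - 1`, whose stride is the last one below `D`. -/
theorem Exec.loop {b : ℕ} (hb : C.b0 ≤ b) {F : List Instr} {body : X × ℕ × (ℕ → α) → ℕ → α} {κ : ℕ}
    (hF : ∀ y s, (C.ext α b hb).Inv y s → True → ∃ t s', t ≤ κ * (C.mach y.1).lg ^ κ ∧
      Exec (C.mach y.1).W F t s s' ∧ Agree (b + 2) (C.mach y.1).B s s' ∧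
      Holds (C.ext α b hb) (b + 2) body y s')
    (x : X) (A : ℕ → α) (i : ℕ) : ∀ (j : ℕ) (s : SIMD (C.mach x).P), C.Inv x s →
    (∀ p, s.word p b = 2 ^ j) → j + (i + 1) = (C.mach x).lg →
    (∀ p, Cell.get s p (b + 1) = loopVal body x A j p) →
    ∃ t s', t ≤ (i + 1) * (κ * (C.mach x).lg ^ κ + 4) ∧
      Exec (C.mach x).W (loopCode α b F) t s s' ∧ Agree b (C.mach x).B s s' ∧
      ∀ p, Cell.get s' p (b + 1) = loopVal body x A (C.mach x).lg p := by
  induction i with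
  | zero =>
    intro j s hs hstr hj hvar
    obtain ⟨t, s₁, ht, e₁, a₁, hstr₁, hvar₁⟩ :=
      Exec.loop_round hb hF x j _ s hs hstr (by omega) hvar
    refine ⟨t + 1, s₁, by omega, fun prog o ho => ?_, a₁, fun p => ?_⟩
    · refine (e₁ prog o (HasAt.prefix ho)).trans (StepsTo.of_step fun u => ?_)
      rw [step_wjump (HasAt.last ho) s₁ (2 ^ (j + 1)) (C.mach x).D hstr₁ fun p => ?_,
        if_neg (by rw [(C.mach x).two_pow_lt_iff]; omega)]
      · simp [loopCode]; ring_nf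
      · have := C.four_le
        rw [(a₁.1 p 3 (by omega)).1]
        exact ((C.base x s hs).1 p).2.2.2.1
    · rw [hvar₁, ← hj]; rfl
  | succ i ih =>
    intro j s hs hstr hj hvar
    obtain ⟨t, s₁, ht, e₁, a₁, hstr₁, hvar₁⟩ :=
      Exec.loop_round hb hF x j _ s hs hstr (by omega) hvar
    obtain ⟨t₂, s₂, ht₂, e₂, a₂, h₂⟩ := ih (j + 1) s₁ (C.stable x s s₁ hs (a₁.mono hb)) hstr₁
      (by omega) hvar₁
    refine ⟨t + 1 + t₂, s₂, ?_, fun prog o ho => ?_, a₁.trans a₂, h₂⟩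
    · rw [add_mul (i + 1)]; omega
    · refine ((e₁ prog o (HasAt.prefix ho)).trans
        (StepsTo.of_step (c' := s₁.config o) fun u => ?_)).trans (e₂ prog o ho)
      rw [step_wjump (HasAt.last ho) s₁ (2 ^ (j + 1)) (C.mach x).D hstr₁ fun p => ?_,
        if_pos (by rw [(C.mach x).two_pow_lt_iff]; omega)]
      have := C.four_le
      rw [(a₁.1 p 3 (by omega)).1]
      exact ((C.base x s hs).1 p).2.2.2.1

/-- A doubling loop. -/
theorem Comp.loop {A : X → ℕ → α} {body : X × ℕ × (ℕ → α) → ℕ → α} (hA : Comp C A)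
    (hbody : ∀ b (hb : C.b0 ≤ b), Comp (C.ext α b hb) body) :
    Comp C (fun x p => loopVal body x (A x) (C.mach x).lg p) := by
  intro b hb
  refine hA.push (b' := b + 1) (by omega) (by omega) (fun _ _ _ _ h => h) ?_
  obtain ⟨F, κ, hF⟩ := hbody b hb (b + 2) le_rfl
  refine ⟨_, Runs.seq (b₁ := b) (mid := Holds C (b + 1) _) (F := seq [.wconst b 1] (loopCode α b F))
    ⟨κ + 5, fun x s hs h => ?_⟩ (runs_copy _ (b := b) le_rfl) hb le_rfl le_rfl⟩
  have e₁ := exec_local (W := (C.mach x).W) (i := .wconst b 1) (by simp [Instr.IsLocal]) s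
  set s₁ := s.apply (C.mach x).W (.wconst b 1) fun _ => True with hs₁
  have h64 := (C.mach x).sixty_four_le
  have hword : ∀ p r, s₁.word p r = if r = b then 1 else s.word p r := fun p r => by
    by_cases hr : r = b
    · subst hr
      simpa [hs₁, SIMD.apply, Instr.exec, Proc.setWord] using Nat.mod_eq_of_lt (by omega)
    · simp [hs₁, SIMD.apply, Instr.exec, Proc.setWord, hr]
  have a₁ : Agree b (C.mach x).B s s₁ :=
    ⟨fun p r hr => ⟨by rw [hword, if_neg (by omega)], by
      simp [hs₁, SIMD.apply, Instr.exec, Proc.setWord]⟩, fun a _ => by simp [hs₁, SIMD.apply]⟩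
  have hl := (C.mach x).one_le_lg
  obtain ⟨t, s₂, ht, e₂, a₂, h₂⟩ := Exec.loop hb hF x (A x) ((C.mach x).lg - 1) 0 s₁
    (C.stable x s s₁ hs (a₁.mono hb)) (fun p => by rw [hword, if_pos rfl, pow_zero]) (by omega)
    (fun p => by
      rw [loopVal, ← h.2 p]
      refine Cell.get_congr_reg (fun q => ?_) (fun q => ?_) p
      · rw [hword, if_neg (by omega)]
      · simp [hs₁, SIMD.apply, Instr.exec, Proc.setWord])
  refine ⟨1 + t, s₂, ?_, e₁.seq e₂, a₁.trans a₂, h₂⟩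
  rw [Nat.sub_add_cancel hl] at ht
  set l := (C.mach x).lg
  have h1 : l ^ (κ + 1) ≤ l ^ (κ + 5) := Nat.pow_le_pow_right hl (by omega)
  have h2 : l ≤ l ^ (κ + 5) := Nat.le_self_pow (by omega) l
  calc 1 + t ≤ 1 + l * (κ * l ^ κ + 4) := by omega
    _ = 1 + κ * l ^ (κ + 1) + 4 * l := by ring
    _ ≤ l ^ (κ + 5) + κ * l ^ (κ + 5) + 4 * l ^ (κ + 5) := by gcongr; omega
    _ = (κ + 5) * l ^ (κ + 5) := by ring

end PRAM

namespace PRAM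

variable {X α β : Type} [Cell α] [Cell β] {C : Ctx X}

/-! ### Arithmetic and case distinctions -/

theorem Comp.add {f g : X → ℕ → ℕ} (hf : Comp C f) (hg : Comp C g)
    (h : ∀ x, ∀ p < (C.mach x).P, f x p + g x p < (C.mach x).W) :
    Comp C (fun x p => f x p + g x p) :=
  (hf.wop .add hg).congr fun x p hp => Nat.mod_eq_of_lt (h x p hp)

theorem Comp.mul {f g : X → ℕ → ℕ} (hf : Comp C f) (hg : Comp C g)
    (h : ∀ x, ∀ p < (C.mach x).P, f x p * g x p < (C.mach x).W) :
    Comp C (fun x p => f x p * g x p) :=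
  (hf.wop .mul hg).congr fun x p hp => Nat.mod_eq_of_lt (h x p hp)

theorem Comp.sub {f g : X → ℕ → ℕ} (hf : Comp C f) (hg : Comp C g)
    (h : ∀ x, ∀ p < (C.mach x).P, f x p < (C.mach x).W) : Comp C (fun x p => f x p - g x p) :=
  (hf.wop .sub hg).congr fun x p hp => Nat.mod_eq_of_lt ((Nat.sub_le _ _).trans_lt (h x p hp))

theorem Comp.div {f g : X → ℕ → ℕ} (hf : Comp C f) (hg : Comp C g)
    (h : ∀ x, ∀ p < (C.mach x).P, f x p < (C.mach x).W) : Comp C (fun x p => f x p / g x p) :=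
  (hf.wop .div hg).congr fun x p hp => Nat.mod_eq_of_lt ((Nat.div_le_self _ _).trans_lt (h x p hp))

theorem Comp.mod {f g : X → ℕ → ℕ} (hf : Comp C f) (hg : Comp C g)
    (h : ∀ x, ∀ p < (C.mach x).P, f x p < (C.mach x).W) : Comp C (fun x p => f x p % g x p) :=
  (hf.wop .mod hg).congr fun x p hp => Nat.mod_eq_of_lt ((Nat.mod_le _ _).trans_lt (h x p hp))

theorem Comp.addR {f g : X → ℕ → ℝ} (hf : Comp C f) (hg : Comp C g) :
    Comp C (fun x p => f x p + g x p) := hf.rop .add hg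

theorem Comp.subR {f g : X → ℕ → ℝ} (hf : Comp C f) (hg : Comp C g) :
    Comp C (fun x p => f x p - g x p) := hf.rop .sub hg

theorem Comp.mulR {f g : X → ℕ → ℝ} (hf : Comp C f) (hg : Comp C g) :
    Comp C (fun x p => f x p * g x p) := hf.rop .mul hg

theorem Comp.divR {f g : X → ℕ → ℝ} (hf : Comp C f) (hg : Comp C g) :
    Comp C (fun x p => f x p / g x p) := hf.rop .div hg

theorem Comp.zeroR : Comp C (fun _ _ => (0 : ℝ)) := by
  simpa using (Comp.const 0 (by norm_num)).cast (C := C)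

theorem Comp.oneR : Comp C (fun _ _ => (1 : ℝ)) := by
  simpa using (Comp.const 1 (by norm_num)).cast (C := C)

open Classical in
/-- The processors can branch on the condition `q`. -/
def Test (C : Ctx X) (q : X → ℕ → Prop) : Prop :=
  ∀ (α : Type) [Cell α] (f g : X → ℕ → α), Comp C f → Comp C g →
    Comp C (fun x p => if q x p then f x p else g x p)

theorem Test.lt {a b : X → ℕ → ℕ} (ha : Comp C a) (hb : Comp C b) :
    Test C (fun x p => a x p < b x p) := fun _ _ _ _ hf hg =>
  (ha.ite_lt hb hf hg).congr fun x p _ => by congr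

theorem Test.lt_real {a b : X → ℕ → ℝ} (ha : Comp C a) (hb : Comp C b) :
    Test C (fun x p => a x p < b x p) := fun _ _ _ _ hf hg => ha.ite_lt_real hb hf hg

theorem Test.not {q : X → ℕ → Prop} (hq : Test C q) : Test C (fun x p => ¬ q x p) :=
  fun α _ f g hf hg => (hq α g f hg hf).congr fun x p _ => by by_cases h : q x p <;> simp [h]

theorem Test.and {q r : X → ℕ → Prop} (hq : Test C q) (hr : Test C r) :
    Test C (fun x p => q x p ∧ r x p) := fun α _ f g hf hg =>
  (hq α _ g (hr α f g hf hg) hg).congr fun x p _ => by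
    by_cases h : q x p <;> by_cases h' : r x p <;> simp [h, h']

open Classical in
theorem Test.congr {q r : X → ℕ → Prop} (hq : Test C q)
    (h : ∀ x, ∀ p < (C.mach x).P, q x p ↔ r x p) : Test C r := fun _ _ _ _ hf hg =>
  (hq _ _ _ hf hg).congr fun x p hp => if_congr (h x p hp) rfl rfl

theorem Test.or {q r : X → ℕ → Prop} (hq : Test C q) (hr : Test C r) :
    Test C (fun x p => q x p ∨ r x p) :=
  (hq.not.and hr.not).not.congr fun x p _ => by tauto

theorem Test.eq {a b : X → ℕ → ℕ} (ha : Comp C a) (hb : Comp C b) :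
    Test C (fun x p => a x p = b x p) :=
  ((Test.lt ha hb).or (Test.lt hb ha)).not.congr fun x p _ => by omega

theorem Test.ite {q : X → ℕ → Prop} [∀ x p, Decidable (q x p)] (hq : Test C q) {f g : X → ℕ → α}
    (hf : Comp C f) (hg : Comp C g) : Comp C (fun x p => if q x p then f x p else g x p) :=
  (hq α f g hf hg).congr fun x p _ => by congr

/-! ### Arrays -/

theorem lt_W {M : Machine} {p : ℕ} (hp : p < M.P) : p < M.W := hp.trans_le M.P_le

theorem D_pos (M : Machine) : 0 < M.D := by have := M.two_le_D; omega

theorem Comp.pid_div (i : ℕ) : Comp C (fun x p => p / (C.mach x).D ^ i) := by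
  induction i with
  | zero => simpa using Comp.pid (C := C)
  | succ i ih =>
    refine (ih.div Comp.D fun x p hp => (Nat.div_le_self _ _).trans_lt (lt_W hp)).congr
      fun x p _ => ?_
    rw [Nat.div_div_eq_div_mul, pow_succ]

theorem Comp.digit (i : ℕ) : Comp C (fun x p => p / (C.mach x).D ^ i % (C.mach x).D) :=
  (Comp.pid_div i).mod Comp.D fun _ _ hp => (Nat.div_le_self _ _).trans_lt (lt_W hp)

/-- The array `f` with `a` indices below `D` can be computed, every processor taking the digits of
its number as indices. -/
def Arr {α : Type} [Cell α] (C : Ctx X) (a : ℕ) (f : X → (Fin a → ℕ) → α) : Prop :=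
  Comp C (fun x p => f x fun i => p / (C.mach x).D ^ (i : ℕ) % (C.mach x).D)

/-- The number with given digits. -/
def encode (D : ℕ) {a : ℕ} (w : Fin a → ℕ) : ℕ := ∑ i, w i * D ^ (i : ℕ)

theorem encode_succ (D : ℕ) {a : ℕ} (w : Fin (a + 1) → ℕ) :
    encode D w = w 0 + D * encode D (fun i => w i.succ) := by
  simp only [encode, Fin.sum_univ_succ, Fin.val_zero, pow_zero, mul_one, Fin.val_succ, pow_succ,
    Finset.mul_sum]
  congr 1
  refine Finset.sum_congr rfl fun i _ => by ring

theorem encode_lt {D : ℕ} {a : ℕ} (w : Fin a → ℕ) (hw : ∀ i, w i < D) : encode D w < D ^ a := by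
  induction a with
  | zero => simp [encode]
  | succ a ih =>
    rw [encode_succ, pow_succ]
    have := ih (fun i => w i.succ) fun i => hw _
    have h0 := hw 0
    nlinarith

theorem encode_digit {D : ℕ} {a : ℕ} (w : Fin a → ℕ) (hw : ∀ i, w i < D) (i : Fin a) :
    encode D w / D ^ (i : ℕ) % D = w i := by
  induction a with
  | zero => exact i.elim0
  | succ a ih =>
    have hD : 0 < D := (Nat.zero_le _).trans_lt (hw 0)
    rw [encode_succ]
    refine Fin.cases ?_ (fun i => ?_) i
    · simp [Nat.mod_eq_of_lt (hw 0)]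
    · rw [Fin.val_succ, pow_succ', ← Nat.div_div_eq_div_mul, Nat.add_mul_div_left _ _ hD,
        Nat.div_eq_of_lt (hw 0), zero_add, ih (fun i => w i.succ) fun i => hw _]

theorem Comp.encodeDigits {a : ℕ} (ha : a ≤ 6) (w : Fin a → X → ℕ → ℕ) (hw : ∀ i, Comp C (w i))
    (hlt : ∀ i x p, w i x p < (C.mach x).D) :
    Comp C (fun x p => encode (C.mach x).D fun i => w i x p) := by
  induction a with
  | zero => simpa [encode] using Comp.const (C := C) 0 (by norm_num)
  | succ a ih =>
    simp only [encode_succ]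
    have h := ih (by omega) (fun i => w i.succ) (fun i => hw _) fun i => hlt _
    have hl : ∀ x p, w 0 x p + (C.mach x).D * encode (C.mach x).D (fun i => w i.succ x p) <
        (C.mach x).W := fun x p => by
      rw [← encode_succ (w := fun i => w i x p)]
      exact (encode_lt _ fun i => hlt i x p).trans_le ((C.mach x).pow_le_W ha)
    exact (hw 0).add (Comp.D.mul h fun x p _ => by have := hl x p; omega) fun x p _ => hl x p

/-- The entry with indices `w` is held by processor number `encode D w`, so random access to an
array is a `gather` from there. -/
theorem Arr.get {a : ℕ} (ha : a ≤ 6) {f : X → (Fin a → ℕ) → α} (hf : Arr C a f)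
    (w : Fin a → X → ℕ → ℕ) (hw : ∀ i, Comp C (w i)) (hlt : ∀ i x p, w i x p < (C.mach x).D) :
    Comp C (fun x p => f x fun i => w i x p) := by
  refine (Comp.gather hf (Comp.encodeDigits ha w hw hlt) fun x p _ =>
    (encode_lt _ fun i => hlt i x p).trans_le ((C.mach x).pow_le_P ha)).congr fun x p _ => ?_
  congr 1
  funext i
  exact encode_digit _ (fun i => hlt i x p) i

/-! ### Parallel prefix computation -/

/-- After `j` rounds position `t` holds the product of the last `2 ^ j` factors before `t`, and a
round joins two adjacent windows. The array starts shifted by one, with the unit at position `0`;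
this makes truncated subtraction harmless, since an index that would be negative reads the empty
product. -/
theorem loopVal_scan {V : Type} {G : X → Type} [∀ x, Monoid (G x)] (enc : ∀ x, G x → ℕ → V)
    (g : ∀ x, ℕ → G x) (body : X × ℕ × (ℕ → V) → ℕ → V)
    (hstep : ∀ x s (a : ℕ → G x) p,
      body (x, s, fun p => enc x (a (p % (C.mach x).D)) (p / (C.mach x).D)) p =
        enc x (a (p % (C.mach x).D - s) * a (p % (C.mach x).D)) (p / (C.mach x).D))
    (x : X) (j : ℕ) :
    loopVal body x (fun p => enc x (if p % (C.mach x).D = 0 then 1 else g x (p % (C.mach x).D - 1))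
      (p / (C.mach x).D)) j =
    fun p => enc x (((List.range' (p % (C.mach x).D - 2 ^ j) (min (p % (C.mach x).D) (2 ^ j))).map
      (g x)).prod) (p / (C.mach x).D) := by
  set D := (C.mach x).D
  induction j with
  | zero =>
    funext p
    simp only [loopVal, pow_zero]
    split_ifs with h
    · simp [h]
    · rw [min_eq_right (by omega)]
      simp
  | succ j ih =>
    rw [loopVal, ih]
    funext p
    rw [hstep x (2 ^ j) (fun t => ((List.range' (t - 2 ^ j) (min t (2 ^ j))).map (g x)).prod)]
    congr 1
    rw [← List.prod_append, ← List.map_append]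
    congr 2
    set t := p % D
    have h1 : min t (2 ^ (j + 1)) = min (t - 2 ^ j) (2 ^ j) + min t (2 ^ j) := by
      rw [pow_succ]; omega
    have h2 : t - 2 ^ (j + 1) = t - 2 ^ j - 2 ^ j := by rw [pow_succ]; omega
    have h3 : t - 2 ^ j = t - 2 ^ j - 2 ^ j + min (t - 2 ^ j) (2 ^ j) := by omega
    rw [h1, h2, ← List.range'_append_1, ← h3]

/-- Prefix products in a monoid whose elements are represented by arrays. -/
theorem Comp.scan {G : X → Type} [∀ x, Monoid (G x)] (enc : ∀ x, G x → ℕ → α)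
    (g : ∀ x, ℕ → G x) (body : X × ℕ × (ℕ → α) → ℕ → α)
    (h0 : Comp C (fun x p => enc x (if p % (C.mach x).D = 0 then 1 else g x (p % (C.mach x).D - 1))
      (p / (C.mach x).D)))
    (hbody : ∀ b (hb : C.b0 ≤ b), Comp (C.ext α b hb) body)
    (hstep : ∀ x s (a : ℕ → G x) p,
      body (x, s, fun p => enc x (a (p % (C.mach x).D)) (p / (C.mach x).D)) p =
        enc x (a (p % (C.mach x).D - s) * a (p % (C.mach x).D)) (p / (C.mach x).D)) :
    Comp C (fun x p => enc x ((List.range (p % (C.mach x).D)).map (g x)).prod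
      (p / (C.mach x).D)) := by
  refine (h0.loop hbody).congr fun x p _ => ?_
  rw [loopVal_scan (C := C) enc g body hstep]
  -- After `lg` rounds the windows have length at least `D`, so all of them reach back to position
  -- `0`.
  have h1 : (C.mach x).D ≤ 2 ^ (C.mach x).lg := by
    have := ((C.mach x).two_pow_lt_iff (C.mach x).lg).not.mpr (lt_irrefl _)
    omega
  have h2 : p % (C.mach x).D < (C.mach x).D := Nat.mod_lt _ (D_pos _)
  dsimp only
  rw [min_eq_left (by omega), Nat.sub_eq_zero_of_le (by omega), List.range_eq_range']

theorem Comp.pid_mod : Comp C (fun x p => p % (C.mach x).D) := by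
  simpa using Comp.digit (C := C) 0

/-- The number of the processor that differs from `p` in the last digit only, which is lowered by
the stride. -/
theorem Comp.stride_index {b : ℕ} (hb : C.b0 ≤ b) : Comp (C.ext α b hb)
    (fun y p => p - (p % (C.mach y.1).D - (p % (C.mach y.1).D - y.2.1))) := by
  have hm : Comp (C.ext α b hb) (fun y p => p % (C.mach y.1).D) := Comp.pid_mod
  have hlt : ∀ (y : X × ℕ × (ℕ → α)), ∀ p < ((C.ext α b hb).mach y).P,
      p % (C.mach y.1).D < ((C.ext α b hb).mach y).W :=
    fun y p hp => (Nat.mod_le _ _).trans_lt (lt_W hp)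
  exact Comp.pid.sub (hm.sub (hm.sub (Comp.ext_stride hb) hlt) hlt) fun y p hp => lt_W hp

theorem stride_index_eq (D p s : ℕ) (hD : 0 < D) :
    (p - (p % D - (p % D - s))) % D = p % D - s ∧ (p - (p % D - (p % D - s))) / D = p / D := by
  have h := Nat.div_add_mod p D
  have hm := Nat.mod_lt p hD
  have he : p - (p % D - (p % D - s)) = (p % D - s) + D * (p / D) := by omega
  rw [he]
  have hlt : p % D - s < D := by omega
  exact ⟨by rw [Nat.add_mul_mod_self_left, Nat.mod_eq_of_lt hlt],
    by rw [Nat.add_mul_div_left _ _ hD, Nat.div_eq_of_lt hlt, zero_add]⟩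

theorem list_range_sum {A : Type*} [AddCommMonoid A] (f : ℕ → A) (t : ℕ) :
    ((List.range t).map f).sum = ∑ l ∈ Finset.range t, f l := by
  induction t with
  | zero => simp
  | succ t ih => rw [List.range_succ, List.map_append, List.sum_append, ih, Finset.sum_range_succ]; simp

theorem pred_index (D p : ℕ) (h : p % D ≠ 0) : p / D * D + (p % D - 1) = p - 1 := by
  have := Nat.div_add_mod p D
  have h2 : D * (p / D) = p / D * D := mul_comm _ _
  omega

/-- The scan is carried out in the additive group of functions of the higher digits `q = p / D`, so
the sums for all values of `q` are formed simultaneously. -/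
theorem Comp.prefixSum {f : X → ℕ → ℝ} (hf : Comp C f) :
    Comp C (fun x p => ∑ l ∈ Finset.range (p % (C.mach x).D),
      f x (p / (C.mach x).D * (C.mach x).D + l)) := by
  have key := Comp.scan (C := C) (G := fun _ => Multiplicative (ℕ → ℝ))
    (fun _ a q => a.toAdd q)
    (fun x l => Multiplicative.ofAdd fun q => f x (q * (C.mach x).D + l))
    (fun y p => y.2.2 (p - (p % (C.mach y.1).D - (p % (C.mach y.1).D - y.2.1))) + y.2.2 p)
    ?_ ?_ ?_
  · refine key.congr fun x p _ => ?_
    rw [toAdd_list_sum, List.map_map, list_range_sum, Finset.sum_apply]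
    rfl
  · refine ((Test.eq Comp.pid_mod (Comp.const 0 (by norm_num))).ite Comp.zeroR
      (hf.gather (Comp.pid.sub (Comp.const 1 (by norm_num)) fun x p hp => lt_W hp)
        fun x p hp => by omega)).congr fun x p _ => ?_
    by_cases h : p % (C.mach x).D = 0
    · simp [h]
    · simp [h, pred_index _ _ h]
  · exact fun b hb => ((Comp.ext_var hb).gather (Comp.stride_index hb)
      fun y p hp => by omega).addR (Comp.ext_var hb)
  · intro x s a p
    have := stride_index_eq (C.mach x).D p s (D_pos _)
    simp [this.1, this.2]

instance (M : Machine) : NeZero M.W := ⟨by have := M.sixty_four_le; omega⟩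
instance (M : Machine) : NeZero M.D := ⟨by have := M.two_le_D; omega⟩

open Classical in
-- Machine words add modulo `W`, so the monoid of the scan is `Fin W`. A count of at most `D < W`
-- items never wraps around, which recovers the true sum.
theorem Comp.prefixCount {q : X → ℕ → Prop} (hq : Test C q) :
    Comp C (fun x p => ∑ l ∈ Finset.range (p % (C.mach x).D),
      if q x (p / (C.mach x).D * (C.mach x).D + l) then 1 else 0) := by
  have hf : Comp C (fun x p => if q x p then 1 else 0) :=
    hq.ite (Comp.const 1 (by norm_num)) (Comp.const 0 (by norm_num))
  have key := Comp.scan (C := C) (G := fun x => Multiplicative (ℕ → Fin (C.mach x).W))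
    (fun _ a q => (a.toAdd q : ℕ))
    (fun x l => Multiplicative.ofAdd fun r => Fin.ofNat (C.mach x).W
      (if q x (r * (C.mach x).D + l) then 1 else 0))
    (fun y p => (y.2.2 (p - (p % (C.mach y.1).D - (p % (C.mach y.1).D - y.2.1))) + y.2.2 p) %
      (C.mach y.1).W)
    ?_ ?_ ?_
  · refine key.congr fun x p _ => ?_
    rw [toAdd_list_sum, List.map_map, list_range_sum, Finset.sum_apply]
    have hb : ∀ t, t ≤ (C.mach x).D → (∑ l ∈ Finset.range t,
        if q x (p / (C.mach x).D * (C.mach x).D + l) then 1 else 0) ≤ t := fun t _ => by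
      refine (Finset.sum_le_card_nsmul _ _ 1 fun l _ => by split_ifs <;> simp).trans (by simp)
    have hDW : (C.mach x).D < (C.mach x).W := by
      have h2 := (C.mach x).pow_le_W (a := 2) (by norm_num)
      have := (C.mach x).two_le_D
      nlinarith
    have hgen : ∀ t, t ≤ (C.mach x).D → ((∑ l ∈ Finset.range t, Fin.ofNat (C.mach x).W
        (if q x (p / (C.mach x).D * (C.mach x).D + l) then 1 else 0) : Fin (C.mach x).W) : ℕ) =
        ∑ l ∈ Finset.range t, if q x (p / (C.mach x).D * (C.mach x).D + l) then 1 else 0 := by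
      intro t ht
      induction t with
      | zero => simp
      | succ t ih =>
        have h1 := hb (t + 1) ht
        rw [Finset.sum_range_succ] at h1 ⊢
        rw [Finset.sum_range_succ, Fin.val_add, ih (by omega)]
        simp only [Fin.val_ofNat, Nat.add_mod_mod]
        exact Nat.mod_eq_of_lt (by omega)
    exact hgen _ (Nat.mod_lt _ (D_pos _)).le
  · refine ((Test.eq Comp.pid_mod (Comp.const 0 (by norm_num))).ite (Comp.const 0 (by norm_num))
      (hf.gather (Comp.pid.sub (Comp.const 1 (by norm_num)) fun x p hp => lt_W hp)
        fun x p hp => by omega)).congr fun x p _ => ?_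
    have := (C.mach x).sixty_four_le
    by_cases h : p % (C.mach x).D = 0
    · simp [h]
    · by_cases h' : q x (p - 1)
      · simp [h, pred_index _ _ h, h', Nat.mod_eq_of_lt (show 1 < (C.mach x).W by omega)]
      · simp [h, pred_index _ _ h, h']
  · exact fun b hb => ((Comp.ext_var hb).gather (Comp.stride_index hb)
      fun y p hp => by omega).wop .add (Comp.ext_var hb)
  · intro x s a p
    have := stride_index_eq (C.mach x).D p s (D_pos _)
    simp [this.1, this.2, Fin.val_add]

theorem digits_of_mul_add {D a l r : ℕ} (hl : l < D) :
    (fun i : Fin (a + 1) => (r * D + l) / D ^ (i : ℕ) % D) =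
      Fin.cons l fun i : Fin a => r / D ^ (i : ℕ) % D := by
  have hD : 0 < D := by omega
  funext i
  refine Fin.cases ?_ (fun i => ?_) i
  · simp [add_comm, Nat.add_mul_mod_self_right, Nat.mod_eq_of_lt hl]
  · rw [Fin.cons_succ, Fin.val_succ, pow_succ', ← Nat.div_div_eq_div_mul, add_comm,
      Nat.add_mul_div_right _ _ hD, Nat.div_eq_of_lt hl, zero_add]

theorem digits_succ {D a p : ℕ} :
    (fun i : Fin (a + 1) => p / D ^ (i : ℕ) % D) =
      Fin.cons (p % D) fun i : Fin a => p / D / D ^ (i : ℕ) % D := by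
  funext i
  refine Fin.cases (by simp) (fun i => ?_) i
  rw [Fin.cons_succ, Fin.val_succ, pow_succ', ← Nat.div_div_eq_div_mul]

theorem Arr.prefixSum {a : ℕ} {f : X → (Fin (a + 1) → ℕ) → ℝ} (hf : Arr C (a + 1) f) :
    Arr C (a + 1) (fun x v => ∑ l ∈ Finset.range (v 0), f x (Fin.cons l (Fin.tail v))) := by
  refine (Comp.prefixSum hf).congr fun x p _ => ?_
  simp only [digits_succ (p := p), Fin.tail_cons]
  refine Finset.sum_congr (by simp) fun l hl => ?_
  rw [digits_of_mul_add]
  exact (Finset.mem_range.mp hl).trans (Nat.mod_lt _ (D_pos _))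

/-- Sums of computable length. -/
theorem Arr.sum {a : ℕ} (ha : a + 1 ≤ 6) {f : X → (Fin (a + 1) → ℕ) → ℝ} (hf : Arr C (a + 1) f)
    {K : X → ℕ → ℕ} (hK : Comp C K) (hKD : ∀ x p, K x p < (C.mach x).D) (w : Fin a → X → ℕ → ℕ)
    (hw : ∀ i, Comp C (w i)) (hlt : ∀ i x p, w i x p < (C.mach x).D) :
    Comp C (fun x p => ∑ l ∈ Finset.range (K x p), f x (Fin.cons l fun i => w i x p)) := by
  refine (hf.prefixSum.get ha (Fin.cons K w) (fun i => ?_) fun i x p => ?_).congr fun x p _ => ?_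
  · exact Fin.cases hK hw i
  · exact Fin.cases (hKD x p) (fun i => hlt i x p) i
  · rfl

open Classical in
theorem Arr.count {a : ℕ} (ha : a + 1 ≤ 6) {q : X → (Fin (a + 1) → ℕ) → Prop}
    (hq : Test C (fun x p => q x fun i => p / (C.mach x).D ^ (i : ℕ) % (C.mach x).D))
    {K : X → ℕ → ℕ} (hK : Comp C K) (hKD : ∀ x p, K x p < (C.mach x).D) (w : Fin a → X → ℕ → ℕ)
    (hw : ∀ i, Comp C (w i)) (hlt : ∀ i x p, w i x p < (C.mach x).D) :
    Comp C (fun x p => ∑ l ∈ Finset.range (K x p),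
      if q x (Fin.cons l fun i => w i x p) then 1 else 0) := by
  have h1 : Arr C (a + 1) (fun x v => ∑ l ∈ Finset.range (v 0),
      if q x (Fin.cons l (Fin.tail v)) then 1 else 0) := by
    refine (Comp.prefixCount hq).congr fun x p _ => ?_
    simp only [digits_succ (p := p), Fin.tail_cons]
    refine Finset.sum_congr (by simp) fun l hl => ?_
    rw [digits_of_mul_add]
    exact (Finset.mem_range.mp hl).trans (Nat.mod_lt _ (D_pos _))
  refine (h1.get ha (Fin.cons K w) (fun i => ?_) fun i x p => ?_).congr fun x p _ => ?_
  · exact Fin.cases hK hw i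
  · exact Fin.cases (hKD x p) (fun i => hlt i x p) i
  · rfl

end PRAM

/-! ### Matrices as arrays -/

/-- Entries of a matrix, with `0` outside of the index range. -/
def Matrix.pad {K : ℕ} (M : Matrix (Fin K) (Fin K) ℝ) (i j : ℕ) : ℝ :=
  if h : i < K ∧ j < K then M ⟨i, h.1⟩ ⟨j, h.2⟩ else 0

namespace Matrix

variable {K : ℕ}

@[simp] theorem pad_fin (M : Matrix (Fin K) (Fin K) ℝ) (i j : Fin K) : M.pad i j = M i j := by
  simp [pad]

theorem pad_one (i j : ℕ) :
    (1 : Matrix (Fin K) (Fin K) ℝ).pad i j = if i = j ∧ i < K then 1 else 0 := by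
  unfold pad
  by_cases h : i = j
  · subst h
    by_cases hi : i < K <;> simp [hi]
  · by_cases hij : i < K ∧ j < K
    · simp [hij, h]
    · simp [hij, h]

theorem pad_of_le_left (M : Matrix (Fin K) (Fin K) ℝ) {i j : ℕ} (h : K ≤ i) : M.pad i j = 0 :=
  dif_neg fun h' => by omega

theorem pad_of_le_right (M : Matrix (Fin K) (Fin K) ℝ) {i j : ℕ} (h : K ≤ j) : M.pad i j = 0 :=
  dif_neg fun h' => by omega

theorem pad_mul (A B : Matrix (Fin K) (Fin K) ℝ) (i j : ℕ) :
    ∑ l ∈ Finset.range K, A.pad i l * B.pad l j = (A * B).pad i j := by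
  by_cases hi : i < K
  · by_cases hj : j < K
    · rw [← Fin.sum_univ_eq_sum_range (fun l => A.pad i l * B.pad l j)]
      have := pad_fin (A * B) ⟨i, hi⟩ ⟨j, hj⟩
      rw [this, Matrix.mul_apply]
      refine Finset.sum_congr rfl fun l _ => ?_
      rw [← pad_fin A, ← pad_fin B]
    · simp [pad_of_le_right _ (not_lt.mp hj)]
  · simp [pad_of_le_left _ (not_lt.mp hi)]

end Matrix

/-! ### Matrix powers and iterated maps by parallel prefix -/

namespace PRAM

variable {X α β : Type} [Cell α] [Cell β] {C : Ctx X}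

theorem read_three {V : Type} {D a b c : ℕ} (ha : a < D) (hb : b < D) (hc : c < D)
    (f : ℕ → ℕ → ℕ → V) :
    f (encode D ![a, b, c] % D) (encode D ![a, b, c] / D % D) (encode D ![a, b, c] / D / D % D) =
      f a b c := by
  have h := encode_digit ![a, b, c] (D := D) (by simp [Fin.forall_fin_succ, ha, hb, hc])
  have h0 := h 0
  have h1 := h 1
  have h2 := h 2
  simp only [Fin.val_zero, pow_zero, Nat.div_one, Fin.val_one, pow_one, Fin.val_two, pow_two,
    ← Nat.div_div_eq_div_mul, Matrix.cons_val_zero, Matrix.cons_val_one, Matrix.cons_val] at h0 h1 h2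
  rw [h0, h1, h2]

theorem read_two {V : Type} {D a b : ℕ} (ha : a < D) (hb : b < D) (f : ℕ → ℕ → V) :
    f (encode D ![a, b] % D) (encode D ![a, b] / D % D) = f a b := by
  have h := encode_digit ![a, b] (D := D) (by simp [Fin.forall_fin_succ, ha, hb])
  have h0 := h 0
  have h1 := h 1
  simp only [Fin.val_zero, pow_zero, Nat.div_one, Fin.val_one, pow_one, Matrix.cons_val_zero,
    Matrix.cons_val_one] at h0 h1
  rw [h0, h1]

theorem mod_lt_D (M : Machine) (p : ℕ) : p % M.D < M.D := Nat.mod_lt _ (D_pos M)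

theorem D_lt_W (M : Machine) : M.D < M.W := by
  have h2 := M.pow_le_W (a := 2) (by norm_num)
  have := M.two_le_D
  nlinarith

theorem ofNat_mod_D (M : Machine) (q : ℕ) : Fin.ofNat M.D (q % M.D) = Fin.ofNat M.D q := by
  ext; simp

theorem Comp.get₂ {f : X → (Fin 2 → ℕ) → α} (hf : Arr C 2 f) {i j : X → ℕ → ℕ} (hi : Comp C i)
    (hj : Comp C j) (hiD : ∀ x p, i x p < (C.mach x).D) (hjD : ∀ x p, j x p < (C.mach x).D) :
    Comp C (fun x p => f x ![i x p, j x p]) := by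
  refine (hf.get (by norm_num) ![i, j] ?_ ?_).congr fun x p _ => ?_
  · simp [Fin.forall_fin_succ, hi, hj]
  · simp [Fin.forall_fin_succ, hiD, hjD]
  · congr 1
    ext k
    fin_cases k <;> rfl

theorem Comp.get₁ {f : X → (Fin 1 → ℕ) → α} (hf : Arr C 1 f) {i : X → ℕ → ℕ} (hi : Comp C i)
    (hiD : ∀ x p, i x p < (C.mach x).D) : Comp C (fun x p => f x ![i x p]) := by
  refine (hf.get (by norm_num) ![i] ?_ ?_).congr fun x p _ => ?_
  · simp [hi]
  · simp [hiD]
  · congr 1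
    ext k
    fin_cases k; rfl

theorem Comp.get₃ {f : X → (Fin 3 → ℕ) → α} (hf : Arr C 3 f) {i j k : X → ℕ → ℕ} (hi : Comp C i)
    (hj : Comp C j) (hk : Comp C k) (hiD : ∀ x p, i x p < (C.mach x).D)
    (hjD : ∀ x p, j x p < (C.mach x).D) (hkD : ∀ x p, k x p < (C.mach x).D) :
    Comp C (fun x p => f x ![i x p, j x p, k x p]) := by
  refine (hf.get (by norm_num) ![i, j, k] ?_ ?_).congr fun x p _ => ?_
  · simp [Fin.forall_fin_succ, hi, hj, hk]
  · simp [Fin.forall_fin_succ, hiD, hjD, hkD]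
  · congr 1
    ext k
    fin_cases k <;> rfl

theorem Comp.read₂ {f : X → ℕ → α} (hf : Comp C f) {i j : X → ℕ → ℕ} (hi : Comp C i)
    (hj : Comp C j) (hiD : ∀ x p, i x p < (C.mach x).D) (hjD : ∀ x p, j x p < (C.mach x).D) :
    Comp C (fun x p => f x (encode (C.mach x).D ![i x p, j x p])) := by
  refine (hf.gather (Comp.encodeDigits (a := 2) (by norm_num) ![i, j] ?_ ?_) fun x p _ =>
    (encode_lt _ ?_).trans_le ((C.mach x).pow_le_P (by norm_num))).congr fun x p _ => ?_
  · simp [Fin.forall_fin_succ, hi, hj]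
  · simp [Fin.forall_fin_succ, hiD, hjD]
  · simp [Fin.forall_fin_succ, hiD, hjD]
  · congr 2
    funext k
    fin_cases k <;> rfl

theorem Comp.read₃ {f : X → ℕ → α} (hf : Comp C f) {i j k : X → ℕ → ℕ} (hi : Comp C i)
    (hj : Comp C j) (hk : Comp C k) (hiD : ∀ x p, i x p < (C.mach x).D)
    (hjD : ∀ x p, j x p < (C.mach x).D) (hkD : ∀ x p, k x p < (C.mach x).D) :
    Comp C (fun x p => f x (encode (C.mach x).D ![i x p, j x p, k x p])) := by
  refine (hf.gather (Comp.encodeDigits (a := 3) (by norm_num) ![i, j, k] ?_ ?_) fun x p _ =>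
    (encode_lt _ ?_).trans_le ((C.mach x).pow_le_P (by norm_num))).congr fun x p _ => ?_
  · simp [Fin.forall_fin_succ, hi, hj, hk]
  · simp [Fin.forall_fin_succ, hiD, hjD, hkD]
  · simp [Fin.forall_fin_succ, hiD, hjD, hkD]
  · congr 2
    funext k
    fin_cases k <;> rfl

theorem Arr.sum₁ {f : X → (Fin 2 → ℕ) → ℝ} (hf : Arr C 2 f) {K : X → ℕ → ℕ} (hK : Comp C K)
    (hKD : ∀ x p, K x p < (C.mach x).D) {i : X → ℕ → ℕ} (hi : Comp C i)
    (hiD : ∀ x p, i x p < (C.mach x).D) :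
    Comp C (fun x p => ∑ l ∈ Finset.range (K x p), f x ![l, i x p]) := by
  refine (hf.sum (by norm_num) hK hKD ![i] (by simp [hi]) (by simp [hiD])).congr fun x p _ => ?_
  refine Finset.sum_congr rfl fun l _ => ?_
  congr 1
  funext k
  fin_cases k <;> rfl

theorem Arr.sum₂ {f : X → (Fin 3 → ℕ) → ℝ} (hf : Arr C 3 f) {K : X → ℕ → ℕ} (hK : Comp C K)
    (hKD : ∀ x p, K x p < (C.mach x).D) {i j : X → ℕ → ℕ} (hi : Comp C i) (hj : Comp C j)
    (hiD : ∀ x p, i x p < (C.mach x).D) (hjD : ∀ x p, j x p < (C.mach x).D) :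
    Comp C (fun x p => ∑ l ∈ Finset.range (K x p), f x ![l, i x p, j x p]) := by
  refine (hf.sum (by norm_num) hK hKD ![i, j] (by simp [Fin.forall_fin_succ, hi, hj])
    (by simp [Fin.forall_fin_succ, hiD, hjD])).congr fun x p _ => ?_
  refine Finset.sum_congr rfl fun l _ => ?_
  congr 1
  funext k
  fin_cases k <;> rfl

theorem Arr.sum₃ {f : X → (Fin 4 → ℕ) → ℝ} (hf : Arr C 4 f) {K : X → ℕ → ℕ} (hK : Comp C K)
    (hKD : ∀ x p, K x p < (C.mach x).D) {i j k : X → ℕ → ℕ} (hi : Comp C i) (hj : Comp C j)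
    (hk : Comp C k) (hiD : ∀ x p, i x p < (C.mach x).D) (hjD : ∀ x p, j x p < (C.mach x).D)
    (hkD : ∀ x p, k x p < (C.mach x).D) :
    Comp C (fun x p => ∑ l ∈ Finset.range (K x p), f x ![l, i x p, j x p, k x p]) := by
  refine (hf.sum (by norm_num) hK hKD ![i, j, k] (by simp [Fin.forall_fin_succ, hi, hj, hk])
    (by simp [Fin.forall_fin_succ, hiD, hjD, hkD])).congr fun x p _ => ?_
  refine Finset.sum_congr rfl fun l _ => ?_
  congr 1
  funext k
  fin_cases k <;> rfl

/-- The matrix can be computed. -/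
def MComp (C : Ctx X) {K : X → ℕ} (M : ∀ x, Matrix (Fin (K x)) (Fin (K x)) ℝ) : Prop :=
  Arr C 2 (fun x v => (M x).pad (v 0) (v 1))

theorem MComp.get {K : X → ℕ} {M : ∀ x, Matrix (Fin (K x)) (Fin (K x)) ℝ} (hM : MComp C M)
    {i j : X → ℕ → ℕ} (hi : Comp C i) (hj : Comp C j) (hiD : ∀ x p, i x p < (C.mach x).D)
    (hjD : ∀ x p, j x p < (C.mach x).D) : Comp C (fun x p => (M x).pad (i x p) (j x p)) :=
  Comp.get₂ hM hi hj hiD hjD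

/-- The powers are the prefix products of the constant sequence `M`. One round of the scan
multiplies the matrices at positions `t - s` and `t`; the inner products are sums over the first
index of an array with the four indices `l, t, i, j`. -/
theorem MComp.pow {K : X → ℕ} {M : ∀ x, Matrix (Fin (K x)) (Fin (K x)) ℝ} (hM : MComp C M)
    (hK : Comp C fun x _ => K x) (hKD : ∀ x, K x < (C.mach x).D) :
    Arr C 3 (fun x v => (M x ^ v 0).pad (v 1) (v 2)) := by
  have key := Comp.scan (C := C) (G := fun x => Matrix (Fin (K x)) (Fin (K x)) ℝ)
    (fun x a q => a.pad (q % (C.mach x).D) (q / (C.mach x).D % (C.mach x).D))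
    (fun x _ => M x)
    (fun y p => ∑ l ∈ Finset.range (K y.1),
      y.2.2 (encode (C.mach y.1).D ![p % (C.mach y.1).D - y.2.1,
        p / (C.mach y.1).D % (C.mach y.1).D, l]) *
      y.2.2 (encode (C.mach y.1).D ![p % (C.mach y.1).D, l,
        p / (C.mach y.1).D / (C.mach y.1).D % (C.mach y.1).D]))
    ?_ ?_ ?_
  · refine key.congr fun x p _ => ?_
    simp [Nat.div_div_eq_div_mul, pow_two]
  · have hd1 := Comp.digit (C := C) 1
    have hd2 := Comp.digit (C := C) 2
    refine ((Test.eq Comp.pid_mod (Comp.const 0 (by norm_num))).ite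
      (((Test.eq hd1 hd2).and (Test.lt hd1 hK)).ite Comp.oneR Comp.zeroR)
      (hM.get hd1 hd2 (fun x p => mod_lt_D _ _) fun x p => mod_lt_D _ _)).congr fun x p _ => ?_
    by_cases h : p % (C.mach x).D = 0
    · simp [h, Matrix.pad_one, Nat.div_div_eq_div_mul, pow_two]
    · simp [h, Nat.div_div_eq_div_mul, pow_two]
  · intro b hb
    have hA := Comp.ext_var (α := ℝ) hb
    have hs := Comp.ext_stride (α := ℝ) hb
    have hd0 := Comp.digit (C := C.ext ℝ b hb) 0
    have hd1 := Comp.digit (C := C.ext ℝ b hb) 1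
    have hd2 := Comp.digit (C := C.ext ℝ b hb) 2
    have hd3 := Comp.digit (C := C.ext ℝ b hb) 3
    have hlt : ∀ (i : ℕ) (y : X × ℕ × (ℕ → ℝ)) p, p / (C.mach y.1).D ^ i % (C.mach y.1).D <
      (C.mach y.1).D := fun i y p => mod_lt_D _ _
    have hf : Arr (C.ext ℝ b hb) 4 (fun y v =>
        y.2.2 (encode (C.mach y.1).D ![v 1 - y.2.1, v 2, v 0]) *
        y.2.2 (encode (C.mach y.1).D ![v 1, v 0, v 3])) :=
      (hA.read₃ (hd1.sub hs fun y p _ => (mod_lt_D _ _).trans (D_lt_W _)) hd2 hd0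
        (fun y p => (Nat.sub_le _ _).trans_lt (hlt 1 y p)) (hlt 2) (hlt 0)).mulR
      (hA.read₃ hd1 hd0 hd3 (hlt 1) (hlt 0) (hlt 3))
    refine (hf.sum₃ (hK.lift hb) (fun y _ => hKD y.1) hd0 hd1 hd2 (hlt 0) (hlt 1) (hlt 2)).congr
      fun y p _ => ?_
    simp [Nat.div_div_eq_div_mul, pow_two, Ctx.ext]
  · intro x s a p
    dsimp only
    rw [← Matrix.pad_mul]
    refine Finset.sum_congr rfl fun l hl => ?_
    have hl' : l < (C.mach x).D := (Finset.mem_range.mp hl).trans (hKD x)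
    rw [read_three ((Nat.sub_le _ _).trans_lt (mod_lt_D _ p)) (mod_lt_D _ _) hl'
      (fun t i j => (a t).pad i j), read_three (mod_lt_D _ _) hl' (mod_lt_D _ _)
      (fun t i j => (a t).pad i j)]

/-- States visited when `F t i` follows the state `i` at time `t`. -/
def trajectory (F : ℕ → ℕ → ℕ) (i₀ : ℕ) : ℕ → ℕ
  | 0 => i₀
  | t + 1 => F t (trajectory F i₀ t)

/-- Composition of self-maps of `Fin D` is associative, so the scan composes all of them in
logarithmically many rounds although each state depends on the previous one. The opposite monoid is
used because in a product the earlier map, on the left, acts first. -/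
theorem Comp.traj {F : X → ℕ → ℕ → ℕ} (hF : Arr C 2 (fun x v => F x (v 0) (v 1)))
    (hFD : ∀ x t i, F x t i < (C.mach x).D) {i₀ : X → ℕ} (hi : Comp C fun x _ => i₀ x)
    (hiD : ∀ x, i₀ x < (C.mach x).D) {T : X → ℕ → ℕ} (hT : Comp C T)
    (hTD : ∀ x p, T x p < (C.mach x).D) :
    Comp C (fun x p => trajectory (F x) (i₀ x) (T x p)) := by
  let g : ∀ x, ℕ → (Function.End (Fin (C.mach x).D))ᵐᵒᵖ := fun x t =>
    MulOpposite.op fun i => ⟨F x t i, hFD x t i⟩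
  have hg : ∀ x t q, ((g x t).unop (Fin.ofNat (C.mach x).D q) : ℕ) = F x t (q % (C.mach x).D) :=
    fun x t q => rfl
  have key := Comp.scan (C := C) (G := fun x => (Function.End (Fin (C.mach x).D))ᵐᵒᵖ)
    (fun x a q => (a.unop (Fin.ofNat (C.mach x).D q) : ℕ))
    g
    (fun y p => y.2.2 (encode (C.mach y.1).D ![p % (C.mach y.1).D,
      y.2.2 (encode (C.mach y.1).D ![p % (C.mach y.1).D - y.2.1,
        p / (C.mach y.1).D % (C.mach y.1).D]) % (C.mach y.1).D]))
    ?_ ?_ ?_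
  · have h2 : Arr C 2 (fun x v => (((List.range (v 0)).map (g x)).prod.unop
        (Fin.ofNat (C.mach x).D (v 1)) : ℕ)) := by
      refine key.congr fun x p _ => ?_
      change _ = (((List.range (p / (C.mach x).D ^ 0 % (C.mach x).D)).map (g x)).prod.unop
        (Fin.ofNat (C.mach x).D (p / (C.mach x).D ^ 1 % (C.mach x).D)) : ℕ)
      rw [pow_zero, Nat.div_one, pow_one, ofNat_mod_D]
    refine (Comp.get₂ h2 hT hi hTD fun x _ => hiD x).congr fun x p _ => ?_
    simp only [Matrix.cons_val_zero, Matrix.cons_val_one]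
    generalize T x p = t
    induction t with
    | zero => simp [trajectory, Function.End.one_def, Nat.mod_eq_of_lt (hiD x)]
    | succ t ih =>
      rw [List.range_succ, List.map_append, List.prod_append, trajectory, ← ih]
      simp only [List.map_cons, List.map_nil, List.prod_singleton, MulOpposite.unop_mul,
        Function.End.mul_def]
      rfl
  · have h1 := Comp.get₂ hF (Comp.pid_mod.sub (Comp.const 1 (by norm_num)) fun x p _ =>
      (mod_lt_D _ p).trans (D_lt_W _)) (Comp.digit 1)
      (fun x p => (Nat.sub_le _ _).trans_lt (mod_lt_D _ p)) fun x p => mod_lt_D _ _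
    refine ((Test.eq Comp.pid_mod (Comp.const 0 (by norm_num))).ite (Comp.digit 1) h1).congr
      fun x p _ => ?_
    by_cases h : p % (C.mach x).D = 0
    · simp [h, Function.End.one_def]
    · simp only [h, if_false, hg]
      simp
  · intro b hb
    have hA := Comp.ext_var (α := ℕ) hb
    have hs := Comp.ext_stride (α := ℕ) hb
    have hd0 := Comp.pid_mod (C := C.ext ℕ b hb)
    have hd1 := Comp.digit (C := C.ext ℕ b hb) 1
    have h3 := hA.read₂ (hd0.sub hs fun y p _ => (mod_lt_D _ p).trans (D_lt_W _)) hd1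
      (fun y p => (Nat.sub_le _ _).trans_lt (mod_lt_D _ p)) (fun y p => mod_lt_D _ _)
    have h4 := hA.read₂ hd0 (h3.wop .mod Comp.D) (fun y p => mod_lt_D _ p) (fun y p =>
      (Nat.mod_le _ _).trans_lt (mod_lt_D _ _))
    refine h4.congr fun y p _ => ?_
    have h5 : ∀ a, a % (C.mach y.1).D % (C.mach y.1).W = a % (C.mach y.1).D := fun a =>
      Nat.mod_eq_of_lt ((mod_lt_D _ a).trans (D_lt_W _))
    simp only [WordOp.eval, Ctx.ext, h5, pow_one]
  · intro x s a p
    let V : ℕ → ℕ → ℕ := fun t q => ((a t).unop (Fin.ofNat (C.mach x).D q) : ℕ)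
    have hV : ∀ t q, V t q = V t (q % (C.mach x).D) := fun t q => by simp only [V, ofNat_mod_D]
    have hof : ∀ i : Fin (C.mach x).D, Fin.ofNat (C.mach x).D (i : ℕ) = i := fun i => by ext; simp
    have hr : ∀ i j, i < (C.mach x).D → j < (C.mach x).D →
        V (encode (C.mach x).D ![i, j] % (C.mach x).D)
          (encode (C.mach x).D ![i, j] / (C.mach x).D) = V i j := fun i j hi hj => by
      rw [hV, read_two hi hj V]
    change V (encode (C.mach x).D ![p % (C.mach x).D, V _ _ % (C.mach x).D] % (C.mach x).D)
      (encode (C.mach x).D ![p % (C.mach x).D, V _ _ % (C.mach x).D] / (C.mach x).D) = _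
    rw [hr _ _ (mod_lt_D _ _) (mod_lt_D _ _), ← hV, hr _ _
      ((Nat.sub_le _ _).trans_lt (mod_lt_D _ p)) (mod_lt_D _ _), ← hV]
    simp only [V, hof, MulOpposite.unop_mul, Function.End.mul_def]
    rfl

end PRAM

/-! ### Matrix inversion -/

namespace Matrix

open Polynomial

/-- This is the product rule in every term of the permutation expansion: factor `i` of a term lies
in column `i`, so collecting by `i` differentiates one column at a time. -/
theorem derivative_det {n R : Type*} [Fintype n] [DecidableEq n] [CommRing R]
    (N : Matrix n n R[X]) :
    derivative N.det = ∑ i, (N.updateCol i fun j => derivative (N j i)).det := by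
  simp only [det_apply]
  rw [derivative_sum, Finset.sum_comm]
  refine Finset.sum_congr rfl fun σ _ => ?_
  rw [← Finset.smul_sum, derivative_smul, derivative_prod_finset]
  congr 1
  refine Finset.sum_congr rfl fun i _ => ?_
  rw [← Finset.prod_erase_mul _ _ (Finset.mem_univ i)]
  congr 1
  · refine Finset.prod_congr rfl fun j hj => ?_
    rw [updateCol_ne (Finset.ne_of_mem_erase hj)]
  · simp

variable {K : ℕ} (M : Matrix (Fin K) (Fin K) ℝ)

/-- Coefficients of `det (1 - X M)`. -/
noncomputable def revCoeff (k : ℕ) : ℝ := M.charpolyRev.coeff k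

/-- Coefficient matrices of the adjugate of `1 - X M`. -/
noncomputable def adjCoeff (k : ℕ) : Matrix (Fin K) (Fin K) ℝ :=
  (1 - (X : ℝ[X]) • M.map C).adjugate.map fun p => p.coeff k

/-- This is `adj N * N = det N` for `N = 1 - X M`, solved for the adjugate. Comparing coefficients
of `X` turns it into a recursion for `adjCoeff`. -/
theorem adjugate_eq : (1 - (X : ℝ[X]) • M.map C).adjugate =
    M.charpolyRev • (1 : Matrix (Fin K) (Fin K) ℝ[X]) +
      (X : ℝ[X]) • ((1 - (X : ℝ[X]) • M.map C).adjugate * M.map C) := by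
  have h := adjugate_mul (1 - (X : ℝ[X]) • M.map C)
  rw [mul_sub, mul_one, Matrix.mul_smul, sub_eq_iff_eq_add] at h
  exact h

theorem adjCoeff_zero : adjCoeff M 0 = revCoeff M 0 • 1 := by
  ext i j
  have h := congrArg (fun N : Matrix (Fin K) (Fin K) ℝ[X] => (N i j).coeff 0) (adjugate_eq M)
  simp only [add_apply, smul_apply, smul_eq_mul, coeff_add, mul_coeff_zero, coeff_X_zero, zero_mul,
    add_zero] at h
  rw [adjCoeff, map_apply, h]
  by_cases hij : i = j <;> simp [one_apply, hij, revCoeff]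

theorem adjCoeff_succ (k : ℕ) :
    adjCoeff M (k + 1) = revCoeff M (k + 1) • 1 + adjCoeff M k * M := by
  ext i j
  have h := congrArg (fun N : Matrix (Fin K) (Fin K) ℝ[X] => (N i j).coeff (k + 1)) (adjugate_eq M)
  simp only [add_apply, smul_apply, smul_eq_mul, coeff_add, coeff_X_mul] at h
  rw [adjCoeff, map_apply, h, add_apply]
  congr 1
  · by_cases hij : i = j <;> simp [one_apply, hij, revCoeff]
  · simp [mul_apply, adjCoeff]

theorem adjCoeff_eq (k : ℕ) :
    adjCoeff M k = ∑ i ∈ Finset.range (k + 1), revCoeff M i • M ^ (k - i) := by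
  induction k with
  | zero => simp [adjCoeff_zero]
  | succ k ih =>
    rw [adjCoeff_succ, ih, Finset.sum_range_succ _ (k + 1), add_comm, Finset.sum_mul]
    congr 1
    · refine Finset.sum_congr rfl fun i hi => ?_
      rw [smul_mul_assoc, ← pow_succ, Nat.succ_sub (by simpa [Nat.lt_succ_iff] using hi)]
    · simp

theorem revCoeff_zero : revCoeff M 0 = 1 := by
  rw [revCoeff, coeff_zero_eq_eval_zero]
  exact eval_charpolyRev

/-- Newton's identities for the traces of the powers of a matrix. -/
theorem revCoeff_succ (k : ℕ) : (k + 1 : ℝ) * revCoeff M (k + 1) =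
    -∑ i ∈ Finset.range (k + 1), revCoeff M i * (M ^ (k + 1 - i)).trace := by
  -- Jacobi's formula: the derivative of column `i` of `1 - X M` is minus column `i` of `M`, and by
  -- Cramer's rule a determinant with a replaced column is an entry of the adjugate applied to that
  -- column.
  have h1 : derivative M.charpolyRev =
      -((1 - (X : ℝ[X]) • M.map C).adjugate * M.map C).trace := by
    rw [charpolyRev, derivative_det, trace, ← Finset.sum_neg_distrib]
    refine Finset.sum_congr rfl fun i _ => ?_
    rw [← cramer_apply, cramer_eq_adjugate_mulVec, diag_apply, mul_apply, mulVec, dotProduct,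
      ← Finset.sum_neg_distrib]
    refine Finset.sum_congr rfl fun j _ => ?_
    have : derivative ((1 : Matrix (Fin K) (Fin K) ℝ[X]) j i) = 0 := by
      by_cases hij : j = i <;> simp [one_apply, hij]
    simp [this]
  have h2 := congrArg (fun p : ℝ[X] => p.coeff k) h1
  simp only [coeff_derivative, coeff_neg] at h2
  have h3 : (((1 - (X : ℝ[X]) • M.map C).adjugate * M.map C).trace).coeff k =
      (adjCoeff M k * M).trace := by
    simp [trace, mul_apply, adjCoeff]
  rw [revCoeff, mul_comm, h2, h3, adjCoeff_eq, Finset.sum_mul, trace_sum]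
  congr 1
  refine Finset.sum_congr rfl fun i hi => ?_
  rw [smul_mul_assoc, trace_smul, ← pow_succ, smul_eq_mul,
    Nat.succ_sub (by simpa [Nat.lt_succ_iff] using hi)]

theorem revCoeff_eq_coeff_charpoly {k : ℕ} (hk : k ≤ K) : revCoeff M k = M.charpoly.coeff (K - k) := by
  rw [revCoeff, ← reverse_charpoly, coeff_reverse, charpoly_natDegree_eq_dim, Fintype.card_fin,
    revAt_le hk]

/-- Cayley–Hamilton, with the coefficients of the characteristic polynomial in reverse order and the
constant term moved to the other side. For singular `M` both sides are zero, as `revCoeff M K` is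
the determinant up to sign and division by zero gives zero. -/
theorem inv_eq_sum_revCoeff : M⁻¹ =
    (-1 / revCoeff M K) • ∑ l ∈ Finset.range K, revCoeff M l • M ^ (K - 1 - l) := by
  have hdet : revCoeff M K = (-1) ^ K * M.det := by
    rw [revCoeff_eq_coeff_charpoly M le_rfl, Nat.sub_self, det_eq_sign_charpoly_coeff,
      Fintype.card_fin, ← mul_assoc, ← mul_pow]
    simp
  by_cases h : M.det = 0
  · rw [hdet, h]
    simp [nonsing_inv_eq_ringInverse, Ring.inverse_non_unit, isUnit_iff_isUnit_det, h]
  · refine inv_eq_right_inv ?_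
    have hq : revCoeff M K ≠ 0 := by rw [hdet]; simp [h]
    have hcay : ∑ l ∈ Finset.range (K + 1), revCoeff M l • M ^ (K - l) = 0 := by
      have := aeval_self_charpoly M
      rw [aeval_eq_sum_range, charpoly_natDegree_eq_dim, Fintype.card_fin,
        ← Finset.sum_range_reflect] at this
      rw [← this]
      refine Finset.sum_congr rfl fun l hl => ?_
      rw [revCoeff_eq_coeff_charpoly M (by simpa [Nat.lt_succ_iff] using hl)]
      congr 2
    rw [Finset.sum_range_succ, Nat.sub_self, pow_zero] at hcay
    rw [Matrix.mul_smul, Finset.mul_sum]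
    have : ∑ l ∈ Finset.range K, M * revCoeff M l • M ^ (K - 1 - l) =
        ∑ l ∈ Finset.range K, revCoeff M l • M ^ (K - l) := by
      refine Finset.sum_congr rfl fun l hl => ?_
      rw [Matrix.mul_smul, ← pow_succ', show K - 1 - l + 1 = K - l by
        have := Finset.mem_range.mp hl; omega]
    rw [this, eq_neg_of_add_eq_zero_left hcay, ← smul_neg, smul_smul, smul_neg, ← neg_smul]
    field_simp
    simp

/-- The strictly lower triangular matrix of the linear recursion for `revCoeff`. -/
noncomputable def newton : Matrix (Fin (K + 1)) (Fin (K + 1)) ℝ := fun i j =>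
  if j < i then -(M ^ ((i : ℕ) - j)).trace / (i : ℕ) else 0

theorem newton_apply (i j : Fin (K + 1)) :
    newton M i j = if j < i then -(M ^ ((i : ℕ) - j)).trace / (i : ℕ) else 0 := rfl

/-- A nonzero entry leads from a row index to a smaller column index, so `t` factors lower the index
by at least `t`. -/
theorem newton_pow_eq_zero (t : ℕ) (i j : Fin (K + 1)) (h : (i : ℕ) < j + t) :
    (newton M ^ t) i j = 0 := by
  induction t generalizing j with
  | zero =>
    rw [pow_zero, one_apply_ne]
    intro hij
    simp [hij] at h
  | succ t ih =>
    rw [pow_succ, mul_apply]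
    refine Finset.sum_eq_zero fun l _ => ?_
    by_cases hl : (i : ℕ) < l + t
    · rw [ih l hl, zero_mul]
    · rw [newton_apply, if_neg (by rw [Fin.lt_def]; omega), mul_zero]

theorem revCoeff_eq_newton_mulVec :
    (fun i : Fin (K + 1) => revCoeff M i) =
      Pi.single 0 1 + newton M *ᵥ fun i : Fin (K + 1) => revCoeff M i := by
  funext i
  rw [Pi.add_apply, mulVec, dotProduct]
  refine Fin.cases ?_ (fun k => ?_) i
  · simp [revCoeff_zero, newton]
  · rw [Pi.single_eq_of_ne (Fin.succ_ne_zero k), zero_add]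
    have hk : ((k : ℕ) + 1 : ℝ) ≠ 0 := by positivity
    have h := revCoeff_succ M k
    rw [Fin.val_succ, eq_div_of_mul_eq hk ((mul_comm _ _).trans h)]
    have h2 : ∀ i : Fin (K + 1), newton M k.succ i * revCoeff M i =
        (fun i : ℕ => if i < (k : ℕ) + 1 then
          -(revCoeff M i * (M ^ ((k : ℕ) + 1 - i)).trace) / ((k : ℕ) + 1) else 0) i := by
      intro i
      simp only [newton, Fin.lt_def, Fin.val_succ, Nat.cast_add, Nat.cast_one]
      split_ifs <;> ring
    rw [Finset.sum_congr rfl fun i _ => h2 i, Fin.sum_univ_eq_sum_range (fun i : ℕ =>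
      if i < (k : ℕ) + 1 then -(revCoeff M i * (M ^ ((k : ℕ) + 1 - i)).trace) / ((k : ℕ) + 1) else 0),
      ← Finset.sum_filter, show (Finset.range (K + 1)).filter (· < (k : ℕ) + 1) =
        Finset.range (k + 1) by ext l; simp; omega, ← Finset.sum_div, Finset.sum_neg_distrib]

/-- Iterating the affine recursion `K + 1` times leaves a remainder that vanishes by nilpotency. A
recursion that looks sequential becomes a sum of powers of one matrix, which is fit for parallel
computation. -/
theorem revCoeff_eq_sum_newton (k : Fin (K + 1)) :
    revCoeff M k = ∑ t ∈ Finset.range (K + 1), (newton M ^ t) k 0 := by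
  have h : ∀ T : ℕ, (fun i : Fin (K + 1) => revCoeff M i) =
      (∑ t ∈ Finset.range T, newton M ^ t) *ᵥ Pi.single 0 1 +
        newton M ^ T *ᵥ fun i : Fin (K + 1) => revCoeff M i := by
    intro T
    induction T with
    | zero => simp only [Finset.range_zero, Finset.sum_empty, zero_mulVec, zero_add, pow_zero,
        one_mulVec]
    | succ T ih =>
      rw [Finset.sum_range_succ, add_mulVec, pow_succ, ← mulVec_mulVec, add_assoc, ← mulVec_add,
        ← revCoeff_eq_newton_mulVec]
      exact ih
  have h1 := congrFun (h (K + 1)) k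
  have h2 : newton M ^ (K + 1) = 0 := by
    ext i j
    exact newton_pow_eq_zero M _ i j (by omega)
  rw [h2, zero_mulVec, add_zero, mulVec_single_one] at h1
  rw [h1, col_apply, sum_apply]

end Matrix

/-! ### Parallel matrix inversion -/

namespace PRAM

variable {X α β : Type} [Cell α] [Cell β] {C : Ctx X}

theorem Comp.negR {f : X → ℕ → ℝ} (hf : Comp C f) : Comp C (fun x p => -f x p) :=
  (Comp.zeroR.subR hf).congr fun x p _ => by simp

theorem digit_lt (C : Ctx X) (i : ℕ) (x : X) (p : ℕ) :
    p / (C.mach x).D ^ i % (C.mach x).D < (C.mach x).D := mod_lt_D _ _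

variable {K : X → ℕ} {M N : ∀ x, Matrix (Fin (K x)) (Fin (K x)) ℝ}

theorem MComp.trace_pow (hM : MComp C M) (hK : Comp C fun x _ => K x)
    (hKD : ∀ x, K x < (C.mach x).D) : Arr C 1 (fun x v => (M x ^ v 0).trace) := by
  have h : Arr C 2 (fun x v => (M x ^ v 1).pad (v 0) (v 0)) :=
    Comp.get₃ (hM.pow hK hKD) (Comp.digit 1) (Comp.digit 0) (Comp.digit 0) (digit_lt C 1)
      (digit_lt C 0) (digit_lt C 0)
  refine (h.sum₁ hK (fun x _ => hKD x) (Comp.digit 0) (digit_lt C 0)).congr fun x p _ => ?_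
  simp only [Matrix.cons_val_zero, Matrix.cons_val_one, Matrix.trace, Matrix.diag]
  rw [← Fin.sum_univ_eq_sum_range (fun l => (M x ^ (p / (C.mach x).D ^ 0 % (C.mach x).D)).pad l l)]
  simp

theorem MComp.newton (hM : MComp C M) (hK : Comp C fun x _ => K x)
    (hKD : ∀ x, K x + 1 < (C.mach x).D) : MComp C (fun x => (M x).newton) := by
  have hK1 : Comp C fun x _ => K x + 1 := hK.add (Comp.const 1 (by norm_num)) fun x p _ =>
    (hKD x).trans (D_lt_W _)
  have h0 := Comp.digit (C := C) 0
  have h1 := Comp.digit (C := C) 1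
  have ht := Comp.get₁ (hM.trace_pow hK fun x => by have := hKD x; omega)
    (h0.sub h1 fun x p _ => (digit_lt C 0 x p).trans (D_lt_W _))
    fun x p => (Nat.sub_le _ _).trans_lt (digit_lt C 0 x p)
  refine (((Test.lt h0 hK1).and (Test.lt h1 h0)).ite (ht.negR.divR h0.cast) Comp.zeroR).congr
    fun x p _ => ?_
  change _ = Matrix.pad (M x).newton (p / (C.mach x).D ^ 0 % (C.mach x).D) (p / (C.mach x).D ^ 1 % (C.mach x).D)
  generalize p / (C.mach x).D ^ 0 % (C.mach x).D = i
  generalize p / (C.mach x).D ^ 1 % (C.mach x).D = j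
  unfold Matrix.pad
  by_cases hi : i < K x + 1
  · by_cases hj : j < i
    · rw [if_pos ⟨hi, hj⟩, dif_pos ⟨hi, hj.trans hi⟩, Matrix.newton_apply, if_pos (by simpa using hj)]
      rfl
    · rw [if_neg (by tauto)]
      by_cases hj' : j < K x + 1
      · rw [dif_pos ⟨hi, hj'⟩, Matrix.newton_apply, if_neg (by simpa using hj)]
      · rw [dif_neg (by tauto)]
  · rw [if_neg (by tauto), dif_neg (by tauto)]

/-- The powers of `newton` give all the coefficients `revCoeff`, and these combine with the powers
of `M` to the inverse. The slack in `K + 1 < D` accommodates `newton`, which is larger by one row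
and column. -/
theorem MComp.inv (hM : MComp C M) (hK : Comp C fun x _ => K x)
    (hKD : ∀ x, K x + 1 < (C.mach x).D) : MComp C (fun x => (M x)⁻¹) := by
  have hK1 : Comp C fun x _ => K x + 1 := hK.add (Comp.const 1 (by norm_num)) fun x p _ =>
    (hKD x).trans (D_lt_W _)
  have hKD' : ∀ x, K x < (C.mach x).D := fun x => by have := hKD x; omega
  have hD0 : ∀ x : X, ∀ p : ℕ, 0 < (C.mach x).D := fun x _ => D_pos _
  have hpn := (hM.newton hK hKD).pow hK1 hKD
  have hS : Arr C 1 (fun x v => ∑ t ∈ Finset.range (K x + 1), ((M x).newton ^ t).pad (v 0) 0) := by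
    have h : Arr C 2 (fun x v => ((M x).newton ^ v 0).pad (v 1) 0) :=
      Comp.get₃ hpn (Comp.digit 0) (Comp.digit 1) (Comp.const 0 (by norm_num)) (digit_lt C 0)
        (digit_lt C 1) hD0
    exact h.sum₁ hK1 (fun x _ => hKD x) (Comp.digit 0) (digit_lt C 0)
  have hterm : Arr C 3 (fun x v => (∑ t ∈ Finset.range (K x + 1), ((M x).newton ^ t).pad (v 0) 0) *
      (M x ^ (K x - 1 - v 0)).pad (v 1) (v 2)) := by
    have he : Comp C fun x p => K x - 1 - p / (C.mach x).D ^ 0 % (C.mach x).D :=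
      (hK.sub (Comp.const 1 (by norm_num)) fun x p _ => (hKD' x).trans (D_lt_W _)).sub
        (Comp.digit 0) fun x p _ => (Nat.sub_le _ _).trans_lt ((hKD' x).trans (D_lt_W _))
    exact (Comp.get₁ hS (Comp.digit 0) (digit_lt C 0)).mulR
      (Comp.get₃ (hM.pow hK hKD') he (Comp.digit 1) (Comp.digit 2) (fun x p => by
        have := hKD' x; omega) (digit_lt C 1) (digit_lt C 2))
  have hsum := hterm.sum₂ hK (fun x _ => hKD' x) (Comp.digit 0) (Comp.digit 1) (digit_lt C 0)
    (digit_lt C 1)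
  have hc := Comp.oneR.negR.divR (Comp.get₁ hS hK fun x _ => hKD' x)
  refine (hc.mulR hsum).congr fun x p _ => ?_
  change _ = Matrix.pad _ (p / (C.mach x).D ^ 0 % (C.mach x).D) (p / (C.mach x).D ^ 1 % (C.mach x).D)
  simp only [Matrix.cons_val_zero, Matrix.cons_val_one, Matrix.cons_val]
  generalize p / (C.mach x).D ^ 0 % (C.mach x).D = i
  generalize p / (C.mach x).D ^ 1 % (C.mach x).D = j
  have hcoef : ∀ l, l ≤ K x →
      ∑ t ∈ Finset.range (K x + 1), ((M x).newton ^ t).pad l 0 = (M x).revCoeff l := by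
    intro l hl
    rw [show l = ((⟨l, by omega⟩ : Fin (K x + 1)) : ℕ) from rfl, Matrix.revCoeff_eq_sum_newton]
    exact Finset.sum_congr rfl fun t _ => Matrix.pad_fin _ _ 0
  rw [hcoef _ le_rfl, Matrix.inv_eq_sum_revCoeff]
  by_cases hij : i < K x ∧ j < K x
  · have hp : ∀ A : Matrix (Fin (K x)) (Fin (K x)) ℝ, A.pad i j = A ⟨i, hij.1⟩ ⟨j, hij.2⟩ :=
      fun A => dif_pos hij
    rw [hp, Matrix.smul_apply, Matrix.sum_apply, smul_eq_mul]
    congr 1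
    refine Finset.sum_congr rfl fun l hl => ?_
    rw [hcoef l (Finset.mem_range.mp hl).le, hp, Matrix.smul_apply, smul_eq_mul]
  · have hp : ∀ A : Matrix (Fin (K x)) (Fin (K x)) ℝ, A.pad i j = 0 := fun A => dif_neg hij
    simp [hp]

theorem MComp.one_add (hM : MComp C M) (hK : Comp C fun x _ => K x) :
    MComp C (fun x => 1 + M x) := by
  have h0 := Comp.digit (C := C) 0
  have h1 := Comp.digit (C := C) 1
  refine ((((Test.eq h0 h1).and (Test.lt h0 hK)).ite Comp.oneR Comp.zeroR).addR hM).congr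
    fun x p _ => ?_
  change _ = Matrix.pad _ (p / (C.mach x).D ^ 0 % (C.mach x).D) (p / (C.mach x).D ^ 1 % (C.mach x).D)
  rw [← Matrix.pad_one]
  unfold Matrix.pad
  simp only [Fin.val_zero, Fin.val_one]
  split_ifs
  · rfl
  · norm_num

theorem MComp.one_sub (hM : MComp C M) (hK : Comp C fun x _ => K x) :
    MComp C (fun x => 1 - M x) := by
  have h0 := Comp.digit (C := C) 0
  have h1 := Comp.digit (C := C) 1
  refine ((((Test.eq h0 h1).and (Test.lt h0 hK)).ite Comp.oneR Comp.zeroR).subR hM).congr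
    fun x p _ => ?_
  change _ = Matrix.pad _ (p / (C.mach x).D ^ 0 % (C.mach x).D) (p / (C.mach x).D ^ 1 % (C.mach x).D)
  rw [← Matrix.pad_one]
  unfold Matrix.pad
  simp only [Fin.val_zero, Fin.val_one]
  split_ifs
  · rfl
  · norm_num

theorem MComp.mul (hM : MComp C M) (hN : MComp C N) (hK : Comp C fun x _ => K x)
    (hKD : ∀ x, K x < (C.mach x).D) : MComp C (fun x => M x * N x) := by
  have h : Arr C 3 (fun x v => (M x).pad (v 1) (v 0) * (N x).pad (v 0) (v 2)) :=
    (hM.get (Comp.digit 1) (Comp.digit 0) (digit_lt C 1) (digit_lt C 0)).mulR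
      (hN.get (Comp.digit 0) (Comp.digit 2) (digit_lt C 0) (digit_lt C 2))
  exact (h.sum₂ hK (fun x _ => hKD x) (Comp.digit 0) (Comp.digit 1) (digit_lt C 0)
    (digit_lt C 1)).congr fun x p _ => Matrix.pad_mul ..

end PRAM

/-! ### Markov chains with an exit -/

set_option linter.unusedSectionVars false

/-- A Markov chain on the edges of a graph: `T i j` is the probability to use `j` after `i`. The
edges `j` with `inS j` lead into `S`, those with `jmp j` leave their cluster, and `e` leaves `S`. -/
structure ExitChain (ι : Type) [Fintype ι] where
  T : Matrix ι ι ℝ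
  inS : ι → Prop
  jmp : ι → Prop
  e : ι
  T_nonneg : ∀ i j, 0 ≤ T i j
  row_le : ∀ i, ∑ j, T i j ≤ 1
  not_inS_e : ¬ inS e
  jmp_e : jmp e

namespace ExitChain

variable {ι : Type} [Fintype ι] [DecidableEq ι] (c : ExitChain ι)

/-- From `i` the edge `e` can be reached with positive probability inside `S`. -/
inductive Reach : ι → Prop
  | base {i} : 0 < c.T i c.e → Reach i
  | step {i j} : 0 < c.T i j → c.inS j → Reach j → Reach i

open Classical in
/-- Transition matrix with the columns outside of `ok` set to zero. -/
noncomputable def mask (ok : ι → Prop) : Matrix ι ι ℝ := fun i j => if ok j then c.T i j else 0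

/-- Steps inside `S` to states from which `e` can be reached. -/
noncomputable def inner : Matrix ι ι ℝ := c.mask fun j => c.inS j ∧ c.Reach j

/-- Steps inside the current cluster to states from which `e` can be reached. -/
noncomputable def stay : Matrix ι ι ℝ := c.mask fun j => c.inS j ∧ c.Reach j ∧ ¬ c.jmp j

/-- Probability to leave `S` through `e`. -/
noncomputable def h : ι → ℝ := (1 - c.inner)⁻¹.mulVec fun i => c.T i c.e

open Classical in
/-- Probability to leave `S` through `e` after the use of the edge `j`. -/
noncomputable def g (j : ι) : ℝ := if j = c.e then 1 else if c.inS j then c.h j else 0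

/-- Distribution of the next jumping edge, conditioned on the exit through `e`. -/
noncomputable def q (i j : ι) : ℝ := ((1 - c.stay)⁻¹ * c.mask c.jmp) i j * c.g j / c.h i

theorem mask_nonneg (ok : ι → Prop) (i j : ι) : 0 ≤ c.mask ok i j := by
  unfold mask
  split_ifs
  · exact c.T_nonneg i j
  · exact le_rfl

theorem mask_le (ok : ι → Prop) (i j : ι) : c.mask ok i j ≤ c.T i j := by
  unfold mask
  split_ifs
  · exact le_rfl
  · exact c.T_nonneg i j

theorem mask_of_not {ok : ι → Prop} {j : ι} (h : ¬ ok j) (i : ι) : c.mask ok i j = 0 := if_neg h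

theorem mask_of {ok : ι → Prop} {j : ι} (h : ok j) (i : ι) : c.mask ok i j = c.T i j := if_pos h

theorem mask_row_le (ok : ι → Prop) {j : ι} (hj : ¬ ok j) (i : ι) :
    ∑ l, c.mask ok i l ≤ 1 - c.T i j := by
  have h1 := c.row_le i
  rw [← Finset.add_sum_erase _ _ (Finset.mem_univ j)] at h1
  rw [← Finset.add_sum_erase _ _ (Finset.mem_univ j), c.mask_of_not hj, zero_add]
  have : ∑ l ∈ Finset.univ.erase j, c.mask ok i l ≤ ∑ l ∈ Finset.univ.erase j, c.T i l :=
    Finset.sum_le_sum fun l _ => c.mask_le ok i l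
  linarith

theorem not_reach_row {ok : ι → Prop} (hok : ∀ j, ok j → c.inS j ∧ c.Reach j) {i : ι}
    (hi : ¬ c.Reach i) (j : ι) : c.mask ok i j = 0 := by
  by_cases hj : ok j
  · rw [c.mask_of hj]
    refine le_antisymm (not_lt.mp fun hlt => hi ?_) (c.T_nonneg i j)
    exact Reach.step hlt (hok j hj).1 (hok j hj).2
  · exact c.mask_of_not hj i

/-- The minimum principle. -/
theorem nonneg_of_mulVec_le {ok : ι → Prop} (hok : ∀ j, ok j → c.inS j ∧ c.Reach j) {x : ι → ℝ}
    (hx : ∀ i, ∑ j, c.mask ok i j * x j ≤ x i) (i : ι) : 0 ≤ x i := by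
  have : Nonempty ι := ⟨i⟩
  obtain ⟨k, hk⟩ := Finite.exists_min x
  by_contra hi
  have hneg : x k < 0 := (hk i).trans_lt (not_le.mp hi)
  -- Outside of `Reach` the masked row is zero, so `x` is nonnegative there; a negative minimum can
  -- only sit inside `Reach`.
  have hreach : c.Reach k := by
    by_contra hnr
    have := hx k
    rw [Finset.sum_eq_zero fun j _ => by rw [c.not_reach_row hok hnr, zero_mul]] at this
    linarith
  have hlow : ∀ i, (∑ j, c.mask ok i j) * x k ≤ ∑ j, c.mask ok i j * x j := fun i => by
    rw [Finset.sum_mul]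
    exact Finset.sum_le_sum fun j _ => mul_le_mul_of_nonneg_left (hk j) (c.mask_nonneg ok i j)
  -- A row that loses mass to a removed column sums to less than one, which keeps its value strictly
  -- above the negative minimum.
  have hstrict : ∀ i j, 0 < c.T i j → ¬ ok j → x k < x i := fun i j hT hj => by
    have h1 := c.mask_row_le ok hj i
    have h2 := hlow i
    have h3 := hx i
    nlinarith
  -- Strictness spreads backwards along a path to `e`, and at `k` itself it is absurd.
  suffices ∀ i, c.Reach i → x k < x i from lt_irrefl _ (this k hreach)
  intro i hi
  induction hi with
  | base hT => exact hstrict _ _ hT fun he => c.not_inS_e (hok _ he).1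
  | @step i j hT hS hR ih =>
    by_cases hj : ok j
    · have h3 := hx i
      have hrow : ∑ l, c.mask ok i l ≤ 1 :=
        (Finset.sum_le_sum fun l _ => c.mask_le ok i l).trans (c.row_le i)
      have h4 : c.T i j * (x j - x k) ≤ ∑ l, c.mask ok i l * (x l - x k) := by
        rw [← c.mask_of hj]
        exact Finset.single_le_sum (f := fun l => c.mask ok i l * (x l - x k)) (fun l _ =>
          mul_nonneg (c.mask_nonneg ok i l) (sub_nonneg.mpr (hk l))) (Finset.mem_univ j)
      simp only [mul_sub, Finset.sum_sub_distrib, ← Finset.sum_mul] at h4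
      nlinarith
    · exact hstrict _ _ hT hj

/-- Injectivity follows from the minimum principle for `x - y` and for `y - x`. -/
theorem isUnit_det {ok : ι → Prop} (hok : ∀ j, ok j → c.inS j ∧ c.Reach j) :
    IsUnit (1 - c.mask ok).det := by
  rw [← Matrix.isUnit_iff_isUnit_det, ← Matrix.mulVec_injective_iff_isUnit]
  have key : ∀ x : ι → ℝ, (1 - c.mask ok).mulVec x = 0 → ∀ i, 0 ≤ x i := fun x hx => by
    refine c.nonneg_of_mulVec_le hok fun i => ?_
    have := congrFun hx i
    rw [Matrix.sub_mulVec, Matrix.one_mulVec, Pi.sub_apply, Pi.zero_apply] at this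
    exact (sub_eq_zero.mp this).ge
  intro x y hxy
  have h1 : (1 - c.mask ok).mulVec (x - y) = 0 := by rw [Matrix.mulVec_sub, hxy, sub_self]
  have h2 : (1 - c.mask ok).mulVec (y - x) = 0 := by rw [Matrix.mulVec_sub, hxy, sub_self]
  funext i
  have h3 := key _ h1 i
  have h4 := key _ h2 i
  simp only [Pi.sub_apply] at h3 h4
  linarith

/-- A column of the inverse solves the system with a unit vector on the right-hand side, which is
nonnegative, so the minimum principle applies to it. -/
theorem inv_nonneg {ok : ι → Prop} (hok : ∀ j, ok j → c.inS j ∧ c.Reach j) (i j : ι) :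
    0 ≤ (1 - c.mask ok)⁻¹ i j := by
  refine c.nonneg_of_mulVec_le hok (x := fun l => (1 - c.mask ok)⁻¹ l j) (fun l => ?_) i
  have h := congrFun (congrFun (Matrix.mul_nonsing_inv _ (c.isUnit_det hok)) l) j
  rw [sub_mul, one_mul, Matrix.sub_apply, Matrix.mul_apply] at h
  have h1 : (0 : ℝ) ≤ (1 : Matrix ι ι ℝ) l j := by
    rw [Matrix.one_apply]; split_ifs <;> norm_num
  linarith

/-- The linear system for `x` has a unique solution. -/
theorem eq_inv_mulVec {ok : ι → Prop} (hok : ∀ j, ok j → c.inS j ∧ c.Reach j) {x y : ι → ℝ}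
    (hx : ∀ i, x i = ∑ j, c.mask ok i j * x j + y i) : x = (1 - c.mask ok)⁻¹.mulVec y := by
  have : (1 - c.mask ok).mulVec x = y := by
    funext i
    rw [Matrix.sub_mulVec, Matrix.one_mulVec, Pi.sub_apply, Matrix.mulVec, dotProduct, sub_eq_iff_eq_add,
      add_comm]
    exact hx i
  rw [← this, Matrix.mulVec_mulVec, Matrix.nonsing_inv_mul _ (c.isUnit_det hok), Matrix.one_mulVec]

theorem h_eq (i : ι) : c.h i = ∑ j, c.inner i j * c.h j + c.T i c.e := by
  have h := congrFun (congrArg (fun A : Matrix ι ι ℝ => A.mulVec fun i => c.T i c.e)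
    (Matrix.mul_nonsing_inv _ (c.isUnit_det (ok := fun j => c.inS j ∧ c.Reach j) fun _ h => h))) i
  simp only [← Matrix.mulVec_mulVec, Matrix.one_mulVec, Matrix.sub_mulVec, Pi.sub_apply] at h
  have := sub_eq_iff_eq_add.mp h
  rw [add_comm]
  exact this

theorem h_nonneg (i : ι) : 0 ≤ c.h i :=
  c.nonneg_of_mulVec_le (ok := fun j => c.inS j ∧ c.Reach j) (fun _ h => h) (fun i => by
    conv_rhs => rw [c.h_eq i]
    exact le_add_of_nonneg_right (c.T_nonneg _ _)) i

theorem h_pos {i : ι} (hi : c.Reach i) : 0 < c.h i := by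
  have hin : ∀ i, 0 ≤ ∑ j, c.inner i j * c.h j := fun i =>
    Finset.sum_nonneg fun j _ => mul_nonneg (c.mask_nonneg _ i j) (c.h_nonneg j)
  induction hi with
  | @base i hT => rw [h_eq]; linarith [hin i]
  | @step i j hT hS hR ih =>
    rw [h_eq]
    have : c.T i j * c.h j ≤ ∑ l, c.inner i l * c.h l := by
      rw [← c.mask_of (ok := fun j => c.inS j ∧ c.Reach j) ⟨hS, hR⟩]
      exact Finset.single_le_sum (f := fun l => c.inner i l * c.h l) (fun l _ =>
          mul_nonneg (c.mask_nonneg _ i l) (c.h_nonneg l)) (Finset.mem_univ j)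
    have h2 := c.T_nonneg i c.e
    have := mul_pos hT ih
    linarith

theorem h_eq_zero {i : ι} (hi : ¬ c.Reach i) : c.h i = 0 := by
  rw [h_eq, Finset.sum_eq_zero fun j _ => by
    rw [inner, c.not_reach_row (fun _ h => h) hi, zero_mul], zero_add]
  exact le_antisymm (not_lt.mp fun h => hi (Reach.base h)) (c.T_nonneg _ _)

theorem g_nonneg (j : ι) : 0 ≤ c.g j := by
  unfold g
  split_ifs
  · norm_num
  · exact c.h_nonneg j
  · exact le_rfl

theorem stay_ok : ∀ j, (c.inS j ∧ c.Reach j ∧ ¬ c.jmp j) → c.inS j ∧ c.Reach j :=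
  fun _ h => ⟨h.1, h.2.1⟩

theorem q_nonneg (i j : ι) : 0 ≤ c.q i j := by
  refine div_nonneg (mul_nonneg ?_ (c.g_nonneg j)) (c.h_nonneg i)
  rw [Matrix.mul_apply]
  exact Finset.sum_nonneg fun l _ => mul_nonneg (c.inv_nonneg c.stay_ok i l) (c.mask_nonneg _ l j)

/-- A function that satisfies the one-step equations is given by the jump distribution. -/
theorem eq_h_mul_sum {x p : ι → ℝ} (hx : ∀ i, x i = ∑ j, c.stay i j * x j +
    ∑ j, c.mask c.jmp i j * (c.g j * p j)) {i : ι} (hi : c.Reach i) :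
    x i = c.h i * ∑ j, c.q i j * p j := by
  have h1 := congrFun (c.eq_inv_mulVec c.stay_ok (y := (c.mask c.jmp).mulVec fun j => c.g j * p j) hx) i
  rw [h1, Matrix.mulVec_mulVec, Matrix.mulVec, dotProduct, Finset.mul_sum]
  refine Finset.sum_congr rfl fun j _ => ?_
  have := (c.h_pos hi).ne'
  rw [q, stay]
  field_simp

/-- The function `h` solves the one-step equations for the constant function `p = 1`: an inner step
stays in the cluster or jumps, and the exit through `e` is a jump with `g = 1`. Columns left out for
lack of reachability carry `h = 0`. -/
theorem sum_q {i : ι} (hi : c.Reach i) : ∑ j, c.q i j = 1 := by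
  have h1 := c.eq_h_mul_sum (x := c.h) (p := fun _ => 1) (fun i => ?_) hi
  · have := (c.h_pos hi).ne'
    simp only [mul_one] at h1
    exact mul_left_cancel₀ this (by rw [mul_one]; exact h1.symm)
  · rw [h_eq, ← Finset.sum_add_distrib]
    have h2 : c.T i c.e = ∑ j, if j = c.e then c.T i j else 0 := by simp
    rw [h2, ← Finset.sum_add_distrib]
    refine Finset.sum_congr rfl fun j _ => ?_
    simp only [inner, stay, mask, g, mul_one]
    by_cases hj : j = c.e
    · subst hj
      simp [c.not_inS_e, c.jmp_e]
    · by_cases hS : c.inS j <;> by_cases hR : c.Reach j <;> by_cases hJ : c.jmp j <;>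
        simp [hj, hS, hR, hJ, c.h_eq_zero]

/-- All entries are nonnegative, so nothing cancels: with exponent `N` the vector is supported on
the states from which at most `N` steps inside `S` can precede the use of `e`. These supports
increase and stay constant once two consecutive ones agree, so they are stationary from the number
of states on. -/
theorem reach_iff_pos (i : ι) :
    0 < ((1 + c.mask c.inS) ^ Fintype.card ι).mulVec (fun i => c.T i c.e) i ↔ c.Reach i := by
  classical
  set y : ℕ → ι → ℝ := fun N => ((1 + c.mask c.inS) ^ N).mulVec (fun i => c.T i c.e) with hy
  have hsucc : ∀ N i, y (N + 1) i = y N i + ∑ j, c.mask c.inS i j * y N j := fun N i => by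
    simp only [hy, pow_succ', ← Matrix.mulVec_mulVec, Matrix.add_mulVec, Matrix.one_mulVec]
    rfl
  have hnn : ∀ N i, 0 ≤ y N i := fun N => by
    induction N with
    | zero => intro i; simpa [hy] using c.T_nonneg i c.e
    | succ N ih =>
      intro i
      rw [hsucc]
      exact add_nonneg (ih i) (Finset.sum_nonneg fun j _ => mul_nonneg (c.mask_nonneg _ i j) (ih j))
  have hpos : ∀ N i, 0 < y (N + 1) i ↔ 0 < y N i ∨ ∃ j, c.inS j ∧ 0 < c.T i j ∧ 0 < y N j := by
    intro N i
    rw [hsucc]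
    have hs : ∀ j ∈ Finset.univ, 0 ≤ c.mask c.inS i j * y N j := fun j _ =>
      mul_nonneg (c.mask_nonneg _ i j) (hnn N j)
    constructor
    · intro h
      by_contra hcon
      push Not at hcon
      have h0 : ∑ j, c.mask c.inS i j * y N j = 0 := Finset.sum_eq_zero fun j _ => by
        by_cases hj : c.inS j
        · rcases (c.T_nonneg i j).lt_or_eq with hT | hT
          · rw [le_antisymm (hcon.2 j hj hT) (hnn N j), mul_zero]
          · rw [c.mask_of hj, ← hT, zero_mul]
        · rw [c.mask_of_not hj, zero_mul]
      linarith [hcon.1]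
    · rintro (h | ⟨j, hj, hT, hN⟩)
      · linarith [Finset.sum_nonneg hs]
      · have := Finset.single_le_sum hs (Finset.mem_univ j)
        rw [c.mask_of hj] at this
        linarith [mul_pos hT hN, hnn N i]
  set R : ℕ → Finset ι := fun N => Finset.univ.filter fun i => 0 < y N i with hR
  have hmem : ∀ N i, i ∈ R N ↔ 0 < y N i := fun N i => by simp [hR]
  have hmono : Monotone R := monotone_nat_of_le_succ fun N i hi => by
    rw [hmem] at hi ⊢
    exact (hpos N i).mpr (Or.inl hi)
  have hstab : ∀ N, R N = R (N + 1) → R (N + 1) = R (N + 2) := fun N h => by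
    ext i
    rw [hmem, hmem, hpos N i, hpos (N + 1) i]
    simp only [← hmem, h]
  have hcard : ∀ n, Fintype.card ι ≤ n → R n = R (Fintype.card ι) := fun n hn =>
    (Finset.eq_of_subset_of_card_le (hmono hn) (Nat.stabilises_of_monotone
      (fun a b hab => Finset.card_le_card (hmono hab)) (fun N => Finset.card_le_univ _)
      (fun N h => by rw [← hstab N (Finset.eq_of_subset_of_card_le (hmono (Nat.le_succ N)) h.ge)])
      hn).le).symm
  constructor
  · have : ∀ N i, 0 < y N i → c.Reach i := fun N => by
      induction N with
      | zero => intro i hi; exact Reach.base (by simpa [hy] using hi)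
      | succ N ih =>
        intro i hi
        rcases (hpos N i).mp hi with h | ⟨j, hj, hT, hN⟩
        · exact ih i h
        · exact Reach.step hT hj (ih j hN)
    exact this _ i
  · intro hi
    suffices ∃ N, i ∈ R N by
      obtain ⟨N, hN⟩ := this
      rw [← hmem, ← hcard _ (le_max_left _ N)]
      exact hmono (le_max_right _ N) hN
    induction hi with
    | base hT => exact ⟨0, by rw [hmem]; simpa [hy] using hT⟩
    | @step i j hT hS hR ih =>
      obtain ⟨N, hN⟩ := ih
      exact ⟨N + 1, (hmem _ _).mpr ((hpos N i).mpr (Or.inr ⟨j, hS, hT, (hmem _ _).mp hN⟩))⟩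

end ExitChain

/-! ### Sums over exit paths -/

namespace WDigraph

variable {n m k : ℕ} (G : WDigraph n m)

theorem sum_stepProb_le (v : Fin n) : ∑ f, G.stepProb v f ≤ 1 := by
  have : ∀ f, G.stepProb v f = (if G.src f = v then G.weight f else 0) / G.outWeight v := fun f => by
    unfold stepProb; split_ifs <;> simp
  rw [Finset.sum_congr rfl fun f _ => this f, ← Finset.sum_div]
  exact div_self_le_one _

theorem exitsVia_cons {S : Set (Fin n)} {e : Fin m} (he : G.dst e ∉ S) (f : Fin m)
    (p : List (Fin m)) :
    G.ExitsVia S e (f :: p) ↔ (f = e ∧ p = []) ∨ (G.dst f ∈ S ∧ G.ExitsVia S e p) := by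
  constructor
  · rintro ⟨q, hq, hS, _⟩
    cases q with
    | nil => left; simpa using hq
    | cons a q =>
      simp only [List.cons_append, List.cons.injEq] at hq
      obtain ⟨rfl, rfl⟩ := hq
      exact Or.inr ⟨hS f (by simp), q, rfl, fun g hg => hS g (by simp [hg]), he⟩
  · rintro (⟨rfl, rfl⟩ | ⟨hf, q, rfl, hS, _⟩)
    · exact ⟨[], rfl, by simp, he⟩
    · exact ⟨f :: q, rfl, by simpa using ⟨hf, hS⟩, he⟩

theorem not_exitsVia_nil {S : Set (Fin n)} {e : Fin m} : ¬ G.ExitsVia S e [] := by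
  rintro ⟨q, hq, _⟩
  simp at hq

open Classical in
/-- Sum of the probabilities of the exit paths from `v`, weighted with `ψ`. -/
noncomputable def pathSum (S : Set (Fin n)) (e : Fin m) (v : Fin n) (ψ : List (Fin m) → ℝ≥0∞) :
    ℝ≥0∞ :=
  ∑' p, if G.ExitsVia S e p then G.pathProb v p * ψ p else 0

open Classical in
-- An exit path is split after its first edge. Either this edge is `e` and the path ends, or it
-- leads into `S` and the remainder is an exit path again.
theorem pathSum_eq {S : Set (Fin n)} {e : Fin m} (he : G.dst e ∉ S) (v : Fin n)
    (ψ : List (Fin m) → ℝ≥0∞) :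
    G.pathSum S e v ψ = ∑ f, (G.stepProb v f : ℝ≥0∞) * ((if f = e then ψ [e] else 0) +
      if G.dst f ∈ S then G.pathSum S e (G.dst f) (fun p => ψ (f :: p)) else 0) := by
  have hinj : Function.Injective fun x : Fin m × List (Fin m) => x.1 :: x.2 := by
    rintro ⟨a, p⟩ ⟨b, q⟩ h
    simpa using h
  rw [pathSum, ← hinj.tsum_eq]
  rotate_left
  · intro p hp
    cases p with
    | nil => simp [G.not_exitsVia_nil] at hp
    | cons f p => exact ⟨(f, p), rfl⟩
  refine (ENNReal.tsum_prod (f := fun f p =>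
    if G.ExitsVia S e (f :: p) then G.pathProb v (f :: p) * ψ (f :: p) else 0)).trans ?_
  rw [tsum_fintype]
  refine Finset.sum_congr rfl fun f _ => ?_
  by_cases hf : G.dst f ∈ S
  · have hfe : f ≠ e := by rintro rfl; exact he hf
    rw [if_neg hfe, if_pos hf, zero_add, pathSum, ← ENNReal.tsum_mul_left]
    refine tsum_congr fun p => ?_
    simp only [G.exitsVia_cons he, hfe, hf, false_and, true_and, false_or, pathProb]
    split_ifs <;> ring
  · rw [if_neg hf, add_zero, tsum_eq_single []]
    · simp only [G.exitsVia_cons he, hf, false_and, or_false, and_true, pathProb, mul_one]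
      split_ifs with h
      · rw [h]
      · simp
    · intro p hp
      simp [G.exitsVia_cons he, hf, hp]

theorem exitProb_eq_pathSum (S : Set (Fin n)) (e : Fin m) (v : Fin n) :
    G.exitProb S v e = G.pathSum S e v fun _ => 1 := by
  classical
  rw [exitProb, pathSum]
  simp only [mul_one]
  exact tsum_subtype {p | G.ExitsVia S e p} (G.pathProb v)

open Classical in
theorem condExitProb_eq_pathSum (S : Set (Fin n)) (e : Fin m) (v : Fin n) (A : Set (List (Fin m))) :
    G.condExitProb S v e A =
      (G.pathSum S e v fun p => if p ∈ A then 1 else 0) / G.pathSum S e v fun _ => 1 := by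
  rw [condExitProb, exitProb_eq_pathSum, pathSum]
  congr 1
  refine (tsum_subtype {p | G.ExitsVia S e p ∧ p ∈ A} (G.pathProb v)).trans (tsum_congr fun p => ?_)
  by_cases h : G.ExitsVia S e p <;> by_cases h' : p ∈ A <;> simp [Set.indicator, h, h']

/-- For paths of length at most `N` the first-step equation allows an induction on `N`. Any finite
set of paths has bounded length, so the bound passes to the infinite sum. -/
theorem pathSum_le_one {S : Set (Fin n)} {e : Fin m} (he : G.dst e ∉ S) (v : Fin n)
    (ψ : List (Fin m) → ℝ≥0∞) (hψ : ∀ p, ψ p ≤ 1) : G.pathSum S e v ψ ≤ 1 := by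
  classical
  have hN : ∀ N v, G.pathSum S e v (fun p => if p.length ≤ N then 1 else 0) ≤ 1 := by
    have hstep : ∀ v (a : Fin m → ℝ≥0∞), (∀ f, a f ≤ 1) →
        ∑ f, (G.stepProb v f : ℝ≥0∞) * a f ≤ 1 := fun v a ha => by
      calc ∑ f, (G.stepProb v f : ℝ≥0∞) * a f ≤ ∑ f, (G.stepProb v f : ℝ≥0∞) :=
            Finset.sum_le_sum fun f _ => mul_le_of_le_one_right' (ha f)
        _ ≤ 1 := by
            rw [← ENNReal.ofNNReal_finsetSum]
            exact_mod_cast G.sum_stepProb_le v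
    intro N
    induction N with
    | zero =>
      intro v
      rw [G.pathSum_eq he]
      refine hstep v _ fun f => ?_
      simp [pathSum]
    | succ N ih =>
      intro v
      rw [G.pathSum_eq he]
      refine hstep v _ fun f => ?_
      by_cases hf : G.dst f ∈ S
      · have hfe : f ≠ e := by rintro rfl; exact he hf
        simpa [hf, hfe] using ih (G.dst f)
      · simp only [hf, if_false, add_zero]
        split_ifs <;> simp
  rw [pathSum]
  refine ENNReal.summable.tsum_le_of_sum_le fun s => ?_
  refine le_trans ?_ (hN (s.sup List.length) v)
  rw [pathSum]
  refine le_trans (Finset.sum_le_sum fun p hp => ?_) (ENNReal.sum_le_tsum s)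
  split_ifs with h h'
  · exact mul_le_mul_right (hψ p) _
  · exact absurd (Finset.le_sup (f := List.length) hp) h'
  · exact le_rfl

variable (part : Fin n → Option (Fin k)) (v₀ : Fin n) (e : Fin m)

/-- The vertex reached by the edge `i`; the additional index `m` stands for the start. -/
def head (i : Fin (m + 1)) : Fin n := if h : (i : ℕ) < m then G.dst ⟨i, h⟩ else v₀

/-- The Markov chain of the edges used by the random walk. -/
noncomputable def chain (hsrc : part (G.src e) ≠ none) (hdst : part (G.dst e) = none) :
    ExitChain (Fin (m + 1)) where
  T i j := if h : (j : ℕ) < m then (G.stepProb (G.head v₀ i) ⟨j, h⟩ : ℝ) else 0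
  inS j := ∃ h : (j : ℕ) < m, part (G.dst ⟨j, h⟩) ≠ none
  jmp j := ∃ h : (j : ℕ) < m, part (G.src ⟨j, h⟩) ≠ part (G.dst ⟨j, h⟩)
  e := e.castSucc
  T_nonneg i j := by split_ifs <;> simp
  row_le i := by
    rw [Fin.sum_univ_castSucc]
    simpa using NNReal.coe_le_coe.mpr (G.sum_stepProb_le (G.head v₀ i))
  not_inS_e := by simp [hdst]
  jmp_e := ⟨e.isLt, by simpa [hdst] using hsrc⟩

variable {part v₀ e} (hsrc : part (G.src e) ≠ none) (hdst : part (G.dst e) = none)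

theorem head_castSucc (f : Fin m) : G.head v₀ f.castSucc = G.dst f := by simp [head]

theorem head_last : G.head v₀ (Fin.last m) = v₀ := by simp [head]

theorem chain_T (i : Fin (m + 1)) (f : Fin m) :
    (G.chain part v₀ e hsrc hdst).T i f.castSucc = G.stepProb (G.head v₀ i) f := by simp [chain]

theorem chain_T_last (i : Fin (m + 1)) :
    (G.chain part v₀ e hsrc hdst).T i (Fin.last m) = 0 := by simp [chain]

theorem chain_inS (f : Fin m) :
    (G.chain part v₀ e hsrc hdst).inS f.castSucc ↔ part (G.dst f) ≠ none := by simp [chain]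

theorem chain_not_inS_last : ¬ (G.chain part v₀ e hsrc hdst).inS (Fin.last m) := by simp [chain]

theorem chain_jmp (f : Fin m) :
    (G.chain part v₀ e hsrc hdst).jmp f.castSucc ↔ part (G.src f) ≠ part (G.dst f) := by
  simp [chain]

theorem chain_e : (G.chain part v₀ e hsrc hdst).e = e.castSucc := rfl

theorem reach_of_pathProb {p : List (Fin m)} (hp : G.ExitsVia {v | part v ≠ none} e p)
    (i : Fin (m + 1)) (h : G.pathProb (G.head v₀ i) p ≠ 0) :
    (G.chain part v₀ e hsrc hdst).Reach i := by
  induction p generalizing i with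
  | nil => exact absurd hp G.not_exitsVia_nil
  | cons f p ih =>
    rw [pathProb, mul_ne_zero_iff] at h
    have hT : 0 < (G.chain part v₀ e hsrc hdst).T i f.castSucc := by
      rw [chain_T]
      exact NNReal.coe_pos.mpr (pos_iff_ne_zero.mpr (by simpa using h.1))
    rcases (G.exitsVia_cons (by simpa using hdst) f p).mp hp with ⟨rfl, -⟩ | ⟨hf, hp'⟩
    · exact ExitChain.Reach.base hT
    · refine ExitChain.Reach.step hT ((G.chain_inS hsrc hdst f).mpr hf) (ih hp' _ ?_)
      rw [head_castSucc]
      exact h.2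

theorem pathSum_of_not_reach {i : Fin (m + 1)} (hi : ¬ (G.chain part v₀ e hsrc hdst).Reach i)
    (ψ : List (Fin m) → ℝ≥0∞) : G.pathSum {v | part v ≠ none} e (G.head v₀ i) ψ = 0 := by
  rw [pathSum, ENNReal.tsum_eq_zero]
  intro p
  split_ifs with hp
  · by_contra h
    exact hi (G.reach_of_pathProb hsrc hdst hp i (left_ne_zero_of_mul h))
  · rfl

/-- One-step equations for the sums over exit paths. -/
theorem toReal_pathSum_eq (i : Fin (m + 1)) (ψ : List (Fin m) → ℝ≥0∞) (hψ : ∀ p, ψ p ≤ 1) :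
    (G.pathSum {v | part v ≠ none} e (G.head v₀ i) ψ).toReal =
      ∑ f : Fin m, (G.chain part v₀ e hsrc hdst).T i f.castSucc *
        (if f = e then (ψ [e]).toReal else if part (G.dst f) ≠ none then
          (G.pathSum {v | part v ≠ none} e (G.dst f) (fun p => ψ (f :: p))).toReal else 0) := by
  classical
  have hS : G.dst e ∉ {v | part v ≠ none} := by simpa using hdst
  have hfin : ∀ f, (if f = e then ψ [e] else 0) + (if G.dst f ∈ {v | part v ≠ none} then
      G.pathSum {v | part v ≠ none} e (G.dst f) (fun p => ψ (f :: p)) else 0) ≠ ⊤ := fun f => by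
    refine ENNReal.add_ne_top.mpr ⟨?_, ?_⟩
    · split_ifs
      · exact ((hψ _).trans_lt ENNReal.one_lt_top).ne
      · simp
    · split_ifs
      · exact ((G.pathSum_le_one hS _ _ fun p => hψ _).trans_lt ENNReal.one_lt_top).ne
      · simp
  rw [G.pathSum_eq hS]
  refine (ENNReal.toReal_sum fun f _ => ENNReal.mul_ne_top (by simp) (by convert hfin f)).trans ?_
  refine Finset.sum_congr rfl fun f _ => ?_
  rw [ENNReal.toReal_mul, chain_T]
  congr 1
  by_cases hfe : f = e
  · subst hfe
    simp [hdst]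
  · by_cases hf : part (G.dst f) = none <;> simp [hfe, hf]

/-- The exit probabilities solve the linear system that defines `h`, whose solution is unique. The
masked columns do no harm, because the exit probability is zero at states that do not reach `e`. -/
theorem toReal_pathSum_one (i : Fin (m + 1)) :
    (G.pathSum {v | part v ≠ none} e (G.head v₀ i) fun _ => 1).toReal =
      (G.chain part v₀ e hsrc hdst).h i := by
  have := (G.chain part v₀ e hsrc hdst).eq_inv_mulVec
    (ok := fun j => (G.chain part v₀ e hsrc hdst).inS j ∧ (G.chain part v₀ e hsrc hdst).Reach j)
    (fun _ h => h)
    (x := fun i => (G.pathSum {v | part v ≠ none} e (G.head v₀ i) fun _ => 1).toReal)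
    (y := fun i => (G.chain part v₀ e hsrc hdst).T i (G.chain part v₀ e hsrc hdst).e) fun i => ?_
  · exact congrFun this i
  · rw [G.toReal_pathSum_eq hsrc hdst i _ fun _ => le_rfl, Fin.sum_univ_castSucc,
      ExitChain.mask_of_not _ (fun h => G.chain_not_inS_last hsrc hdst h.1), zero_mul, add_zero]
    have h2 : (G.chain part v₀ e hsrc hdst).T i (G.chain part v₀ e hsrc hdst).e = ∑ f : Fin m,
      if f = e then (G.chain part v₀ e hsrc hdst).T i f.castSucc else 0 := by simp [chain_e]
    rw [h2, ← Finset.sum_add_distrib]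
    refine Finset.sum_congr rfl fun f _ => ?_
    unfold ExitChain.mask
    beta_reduce
    have hI := G.chain_inS (v₀ := v₀) hsrc hdst f
    rw [head_castSucc]
    by_cases hfe : f = e
    · subst hfe
      simp [hI, hdst]
    · by_cases hf : part (G.dst f) = none
      · simp [hI, hfe, hf]
      · by_cases hR : (G.chain part v₀ e hsrc hdst).Reach f.castSucc
        · simp [hI, hfe, hf, hR]
        · have := G.pathSum_of_not_reach hsrc hdst hR fun _ => 1
          rw [head_castSucc] at this
          simp [hI, hfe, hf, hR, this]

/-- The first-step equation in terms of jumping edges: a step inside the cluster leaves the list of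
crossings unchanged, a jump prepends its edge. The first sum may be restricted to states that reach
`e`, as the others contribute zero. -/
theorem toReal_pathSum_crossings (i : Fin (m + 1)) (φ : List (Fin m) → ℝ≥0∞) (hφ : ∀ p, φ p ≤ 1) :
    (G.pathSum {v | part v ≠ none} e (G.head v₀ i) fun p => φ (G.crossings part p)).toReal =
      ∑ j, (G.chain part v₀ e hsrc hdst).stay i j *
        (G.pathSum {v | part v ≠ none} e (G.head v₀ j) fun p => φ (G.crossings part p)).toReal +
      ∑ f : Fin m, (G.chain part v₀ e hsrc hdst).mask (G.chain part v₀ e hsrc hdst).jmp i f.castSucc *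
        (if f = e then (φ [e]).toReal else if part (G.dst f) ≠ none then
          (G.pathSum {v | part v ≠ none} e (G.dst f)
            (fun p => φ (f :: G.crossings part p))).toReal else 0) := by
  rw [G.toReal_pathSum_eq hsrc hdst i _ fun _ => hφ _, Fin.sum_univ_castSucc, ExitChain.stay,
    ExitChain.mask_of_not _ (fun h => G.chain_not_inS_last hsrc hdst h.1), zero_mul, add_zero,
    ← Finset.sum_add_distrib]
  refine Finset.sum_congr rfl fun f _ => ?_
  have hcr : ∀ p, G.crossings part (f :: p) =
      if part (G.src f) ≠ part (G.dst f) then f :: G.crossings part p else G.crossings part p := by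
    intro p
    unfold crossings
    rw [List.filter_cons]
    by_cases h : part (G.src f) = part (G.dst f) <;> simp [h]
  unfold ExitChain.mask
  beta_reduce
  have hI := G.chain_inS (v₀ := v₀) hsrc hdst f
  have hJ' := G.chain_jmp (v₀ := v₀) hsrc hdst f
  rw [head_castSucc]
  by_cases hfe : f = e
  · subst hfe
    have : part (G.src f) ≠ part (G.dst f) := by rw [hdst]; exact hsrc
    have h1 : G.crossings part [f] = [f] := by
      unfold crossings
      rw [List.filter_cons_of_pos (by simpa using this), List.filter_nil]
    simp only [hI, hJ', h1, hdst, ne_eq, not_true, false_and, if_true, if_false, zero_mul, zero_add]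
    rw [if_pos hsrc]
  · by_cases hf : part (G.dst f) = none
    · simp [hI, hJ', hfe, hf]
    · by_cases hJ : part (G.src f) = part (G.dst f)
      · by_cases hR : (G.chain part v₀ e hsrc hdst).Reach f.castSucc
        · simp [hI, hJ', hfe, hf, hR, hJ, hcr]
        · have := G.pathSum_of_not_reach hsrc hdst hR fun p => φ (G.crossings part p)
          rw [head_castSucc] at this
          simp [hI, hJ', hfe, hf, hR, hJ, hcr, this]
      · simp [hI, hJ', hfe, hf, hJ, hcr]

end WDigraph

/-! ### The law of the jumping edges -/

theorem clusterCode_injective {k : ℕ} : Function.Injective (clusterCode (k := k)) := by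
  intro a b h
  cases a <;> cases b <;> simp [clusterCode, Fin.ext_iff] at h ⊢
  exact h

namespace ExitChain

variable {ι : Type} [Fintype ι] [DecidableEq ι] (c : ExitChain ι)

/-- Transition probabilities of the chain of jumping edges, which is absorbed in the exit edge. -/
noncomputable def kernel (i j : ι) : ℝ := if i = c.e then (if j = c.e then 1 else 0) else c.q i j

theorem kernel_nonneg (i j : ι) : 0 ≤ c.kernel i j := by
  unfold kernel
  split_ifs
  exacts [zero_le_one, le_rfl, c.q_nonneg i j]

theorem prod_kernel_e {s : ℕ → ι} (hs : s 0 = c.e) (N : ℕ) :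
    ∏ t ∈ Finset.range N, c.kernel (s t) (s (t + 1)) =
      if ∀ t < N, s (t + 1) = c.e then 1 else 0 := by
  induction N with
  | zero => simp
  | succ N ih =>
    rw [Finset.prod_range_succ, ih]
    by_cases h : ∀ t < N, s (t + 1) = c.e
    · have hN : s N = c.e := by
        cases N with
        | zero => exact hs
        | succ N => exact h N (by omega)
      rw [if_pos h, one_mul, kernel, if_pos hN]
      refine if_congr ⟨fun h' t ht => ?_, fun h' => h' N (by omega)⟩ rfl rfl
      rcases Nat.lt_succ_iff_lt_or_eq.mp ht with ht | rfl
      exacts [h t ht, h']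
    · rw [if_neg h, zero_mul, if_neg fun h' => h fun t ht => h' t (by omega)]

end ExitChain

namespace WDigraph

variable {n m k : ℕ} (G : WDigraph n m)

/-- The list of edges `l`, continued by the exit edge forever. -/
def states (e : Fin m) (l : List (Fin m)) (t : ℕ) : Fin (m + 1) := (l[t]?.getD e).castSucc

theorem forall_states_cons {e f : Fin m} {l : List (Fin m)} {N : ℕ} {s : ℕ → Fin (m + 1)} :
    (∀ t < N + 1, s t = states e (f :: l) t) ↔
      s 0 = f.castSucc ∧ ∀ t < N, s (t + 1) = states e l t := by
  constructor
  · intro h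
    exact ⟨by simpa [states] using h 0 (by omega),
      fun t ht => by simpa [states] using h (t + 1) (by omega)⟩
  · rintro ⟨h0, h⟩ t ht
    cases t with
    | zero => simpa [states] using h0
    | succ t => simpa [states] using h t (by omega)

variable {part : Fin n → Option (Fin k)} {v₀ : Fin n} {e : Fin m}
  (hsrc : part (G.src e) ≠ none) (hdst : part (G.dst e) = none)

/-- The Markov property of the conditioned jumping edges. By induction on `N`, the first jump is
split off, and `eq_h_mul_sum` turns the one-step equations into the factor `h (s 0) * q (s 0) (s
1)`. The exit probability from `s 1` that the induction hypothesis produces is the weight `g (s 1)`,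
which `q` has absorbed. -/
theorem toReal_pathSum_states (N : ℕ) (s : ℕ → Fin (m + 1))
    (hs : (G.chain part v₀ e hsrc hdst).Reach (s 0)) (hse : s 0 ≠ e.castSucc) :
    (G.pathSum {v | part v ≠ none} e (G.head v₀ (s 0)) fun p =>
        if ∀ t < N, s (t + 1) = states e (G.crossings part p) t then 1 else 0).toReal =
      (G.chain part v₀ e hsrc hdst).h (s 0) *
        ∏ t ∈ Finset.range N, (G.chain part v₀ e hsrc hdst).kernel (s t) (s (t + 1)) := by
  induction N generalizing s with
  | zero => simpa using G.toReal_pathSum_one hsrc hdst (s 0)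
  | succ N ih =>
    set c := G.chain part v₀ e hsrc hdst with hc
    set φ : List (Fin m) → ℝ≥0∞ := fun l =>
      if ∀ t < N + 1, s (t + 1) = states e l t then 1 else 0 with hφ
    have hφ1 : ∀ l, φ l ≤ 1 := fun l => by
      simp only [hφ]
      split_ifs <;> simp
    have hφc : ∀ f l, φ (f :: l) = if s 1 = f.castSucc then
        (if ∀ t < N, s (t + 2) = states e l t then 1 else 0) else 0 := fun f l => by
      simp only [hφ]
      rw [← ite_and]
      exact if_congr (forall_states_cons (s := fun t => s (t + 1))) rfl rfl
    refine (c.eq_h_mul_sum (x := fun i =>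
      (G.pathSum {v | part v ≠ none} e (G.head v₀ i) fun p => φ (G.crossings part p)).toReal)
      (p := fun j => if s 1 = j then
        ∏ t ∈ Finset.range N, c.kernel (s (t + 1)) (s (t + 2)) else 0) (fun i => ?_) hs).trans ?_
    · rw [G.toReal_pathSum_crossings hsrc hdst i φ hφ1, ← hc]
      congr 1
      rw [Fin.sum_univ_castSucc]
      have hlast : c.mask c.jmp i (Fin.last m) = 0 := by
        unfold ExitChain.mask
        rw [hc, chain_T_last, ite_self]
      rw [hlast, zero_mul, add_zero]
      refine Finset.sum_congr rfl fun f _ => ?_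
      congr 1
      -- After the exit the list of crossings is empty and `states` goes on with `e`, which agrees
      -- with the absorption in `kernel`.
      by_cases hfe : f = e
      · subst hfe
        have hg : c.g f.castSucc = 1 := if_pos rfl
        rw [if_pos rfl, hφc, hg, one_mul]
        by_cases h1 : s 1 = f.castSucc
        · rw [if_pos h1, if_pos h1, c.prod_kernel_e (s := fun t => s (t + 1)) h1]
          have : ∀ t, states f [] t = c.e := fun t => by simp [states, hc, chain_e]
          simp only [this]
          split_ifs <;> simp
        · rw [if_neg h1, if_neg h1, ENNReal.toReal_zero]
      · have hfe' : f.castSucc ≠ c.e := by simpa [hc, chain_e] using hfe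
        rw [if_neg hfe, ExitChain.g, if_neg hfe']
        have hI := G.chain_inS (v₀ := v₀) hsrc hdst f
        rw [← hc] at hI
        by_cases hf : part (G.dst f) ≠ none
        · rw [if_pos hf, if_pos (hI.mpr hf)]
          by_cases hR : c.Reach f.castSucc
          · by_cases h1 : s 1 = f.castSucc
            · have := ih (fun t => s (t + 1)) (by simpa [h1] using hR) (by simpa [h1] using hfe)
              simp only [zero_add, h1, head_castSucc] at this
              simp only [hφc, h1, if_true]
              exact this
            · simp only [hφc, h1, if_false, mul_zero]
              simp [pathSum]
          · rw [c.h_eq_zero hR, zero_mul]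
            have := G.pathSum_of_not_reach hsrc hdst hR fun p => φ (f :: G.crossings part p)
            rw [head_castSucc] at this
            rw [this, ENNReal.toReal_zero]
        · rw [if_neg hf, if_neg (fun h => hf (hI.mp h)), zero_mul]
    · rw [Finset.prod_range_succ']
      have hk : c.kernel (s 0) (s 1) = c.q (s 0) (s 1) := if_neg hse
      simp only [mul_ite, mul_zero, Finset.sum_ite_eq, Finset.mem_univ, if_true, zero_add, hk]
      ring

/-! ### Transcripts from sequences of jumping edges -/

/-- Number of positions `t ≤ L` at which the walk has not yet exited. -/
def pairCount (e : Fin m) (L : ℕ) (s : ℕ → Fin (m + 1)) : ℕ :=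
  ∑ t ∈ Finset.range (L + 1), if s t = e.castSucc then 0 else 1

/-- The pair number `i` of a transcript. -/
def pairAt (part : Fin n → Option (Fin k)) (e : Fin m) (L : ℕ) (s : ℕ → Fin (m + 1)) (i : ℕ) :
    ℕ × ℕ :=
  if i < L then
    (if h : (s (i + 1) : ℕ) < m then clusterCode (part (G.src ⟨s (i + 1), h⟩)) else 0, s (i + 1))
  else (0, e)

theorem transcriptCode_injective : Function.Injective (transcriptCode (m := m) (k := k)) := by
  refine List.map_injective_iff.mpr ?_
  rintro ⟨a, f⟩ ⟨b, g⟩ h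
  simp only [Prod.mk.injEq] at h
  obtain ⟨h1, h2⟩ := h
  rw [clusterCode_injective h1, Fin.ext h2]

theorem transcriptCode_transcript (hsrc : part (G.src e) ≠ none) (hdst : part (G.dst e) = none)
    {p : List (Fin m)} (hp : G.ExitsVia {v | part v ≠ none} e p)
    {L : ℕ} {s : ℕ → Fin (m + 1)} (h0 : s 0 = Fin.last m)
    (hs : ∀ t < L, s (t + 1) = states e (G.crossings part p) t) :
    transcriptCode (G.transcript part e L p) =
      (List.range (pairCount e L s)).map (G.pairAt part e L s) := by
  obtain ⟨p', rfl, hp', -⟩ := hp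
  have hl : G.crossings part (p' ++ [e]) = G.crossings part p' ++ [e] := by
    unfold crossings
    rw [List.filter_append]
    congr 1
    rw [List.filter_cons_of_pos (by simpa [hdst] using hsrc), List.filter_nil]
  set l := G.crossings part p' with hldef
  have hel : ∀ f ∈ l, f ≠ e := by
    rintro f hf rfl
    exact hp' f (List.mem_of_mem_filter hf) hdst
  -- Position `0` is the start and always counts; the following positions count up to the jump
  -- before `e`. This makes the total the number of jumping edges, cut at `L + 1`, which is the
  -- length of the transcript in both of its cases.
  have hcount : pairCount e L s = min (L + 1) (l.length + 1) := by
    have : ∀ M ≤ L + 1, ∑ t ∈ Finset.range M, (if s t = e.castSucc then 0 else 1) =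
        min M (l.length + 1) := by
      intro M hM
      induction M with
      | zero => simp
      | succ M ih =>
        rw [Finset.sum_range_succ, ih (by omega)]
        cases M with
        | zero =>
          have : Fin.last m ≠ e.castSucc := (Fin.castSucc_lt_last e).ne'
          simp [h0, this]
        | succ M =>
          rw [hs M (by omega), states, hl]
          by_cases hM' : M < l.length
          · rw [List.getElem?_append_left hM', List.getElem?_eq_getElem hM', Option.getD_some,
              if_neg (by simpa using hel _ (List.getElem_mem hM'))]
            omega
          · have : ((l ++ [e])[M]?).getD e = e := by
              rw [List.getElem?_append_right (by omega)]
              cases M - l.length <;> simp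
            rw [this, if_pos rfl]
            omega
    exact this _ le_rfl
  rw [transcript, hl, hcount]
  have hlen : (l ++ [e]).length = l.length + 1 := by simp
  rw [← hlen] at hcount ⊢
  rw [hl] at hs
  generalize l ++ [e] = l' at hs hcount ⊢
  have hst : ∀ (i : ℕ) (hi : i < L) (hil : i < l'.length), s (i + 1) = l'[i].castSucc :=
    fun i hi hil => by
      rw [hs i hi, states, List.getElem?_eq_getElem hil, Option.getD_some]
  have hpair : ∀ (i : ℕ) (hi : i < L) (hil : i < l'.length),
      G.pairAt part e L s i = (clusterCode (part (G.src l'[i])), (l'[i] : ℕ)) :=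
    fun i hi hil => by
      simp [pairAt, if_pos hi, hst i hi hil]
  rw [transcriptCode, List.map_append, List.map_map]
  by_cases h : l'.length ≤ L
  · rw [if_pos h, List.map_nil, List.append_nil, List.take_of_length_le h, min_eq_right (by omega)]
    refine List.ext_getElem (by simp) fun i h1 h2 => ?_
    have hi : i < l'.length := by simpa using h1
    simp [hpair i (by omega) hi]
  · rw [if_neg h, min_eq_left (by omega), List.range_succ, List.map_append]
    congr 1
    · refine List.ext_getElem (by simp; omega) fun i h1 h2 => ?_
      have hi : i < L := by simpa using h2
      simp [hpair i hi (by omega)]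
    · simp [pairAt, clusterCode]

/-- The sequence of states given by the start and its next `L` elements. -/
def stateSeq {m L : ℕ} (a : Fin L → Fin (m + 1)) : ℕ → Fin (m + 1)
  | 0 => Fin.last m
  | t + 1 => if h : t < L then a ⟨t, h⟩ else Fin.last m

open Classical in
-- Every exit path agrees with exactly one sequence of `L` states, and this sequence determines the
-- transcript. So the event is partitioned by sequences, each of mass `h` at the start times a
-- product of `kernel`; the conditioning cancels `h`.
theorem condExitProb_transcript (hexit : G.exitProb {v | part v ≠ none} v₀ e ≠ 0) (L : ℕ)
    (τ : List (Option (Fin k) × Fin m)) :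
    G.condExitProb {v | part v ≠ none} v₀ e {p | G.transcript part e L p = τ} =
      ∑ a : Fin L → Fin (m + 1),
        if (List.range (pairCount e L (stateSeq a))).map (G.pairAt part e L (stateSeq a)) =
          transcriptCode τ then
        ENNReal.ofReal (∏ t ∈ Finset.range L,
          (G.chain part v₀ e hsrc hdst).kernel (stateSeq a t) (stateSeq a (t + 1))) else 0 := by
  set c := G.chain part v₀ e hsrc hdst with hc
  have hS : G.dst e ∉ {v | part v ≠ none} := by simpa using hdst
  rw [exitProb_eq_pathSum] at hexit
  have hhead : G.head v₀ (Fin.last m) = v₀ := G.head_last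
  have hreach : c.Reach (Fin.last m) := by
    by_contra h
    have := G.pathSum_of_not_reach hsrc hdst h fun _ => 1
    rw [hhead] at this
    exact hexit this
  have hne : Fin.last m ≠ e.castSucc := (Fin.castSucc_lt_last e).ne'
  have hfin : ∀ ψ : List (Fin m) → ℝ≥0∞, (∀ p, ψ p ≤ 1) →
      G.pathSum {v | part v ≠ none} e v₀ ψ ≠ ⊤ := fun ψ hψ =>
    ((G.pathSum_le_one hS v₀ ψ hψ).trans_lt ENNReal.one_lt_top).ne
  have hone : G.pathSum {v | part v ≠ none} e v₀ (fun _ => 1) =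
      ENNReal.ofReal (c.h (Fin.last m)) := by
    rw [← G.toReal_pathSum_one hsrc hdst, hhead, ENNReal.ofReal_toReal (hfin _ fun _ => le_rfl)]
  have hmatch : ∀ a : Fin L → Fin (m + 1), G.pathSum {v | part v ≠ none} e v₀ (fun p =>
      if ∀ t < L, stateSeq a (t + 1) = states e (G.crossings part p) t then 1 else 0) =
      ENNReal.ofReal (c.h (Fin.last m)) * ENNReal.ofReal (∏ t ∈ Finset.range L,
          c.kernel (stateSeq a t) (stateSeq a (t + 1))) := fun a => by
    have := G.toReal_pathSum_states (v₀ := v₀) hsrc hdst L (stateSeq a) hreach hne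
    rw [← ENNReal.ofReal_mul (c.h_nonneg _)]
    change (G.pathSum _ e (G.head v₀ (Fin.last m)) _).toReal = c.h (Fin.last m) * _ at this
    rw [← this, hhead, ENNReal.ofReal_toReal]
    refine hfin _ fun p => ?_
    split_ifs <;> simp
  have hsum : G.pathSum {v | part v ≠ none} e v₀
      (fun p => @ite _ (p ∈ {p | G.transcript part e L p = τ}) (Classical.propDecidable _) 1 0) =
      ∑ a : Fin L → Fin (m + 1),
        if (List.range (pairCount e L (stateSeq a))).map (G.pairAt part e L (stateSeq a)) =
          transcriptCode τ then
        ENNReal.ofReal (c.h (Fin.last m)) * ENNReal.ofReal (∏ t ∈ Finset.range L,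
          c.kernel (stateSeq a t) (stateSeq a (t + 1))) else 0 := by
    simp only [← hmatch]
    have : ∀ a : Fin L → Fin (m + 1),
        (if (List.range (pairCount e L (stateSeq a))).map (G.pairAt part e L (stateSeq a)) =
          transcriptCode τ then G.pathSum {v | part v ≠ none} e v₀ (fun p =>
          if ∀ t < L, stateSeq a (t + 1) = states e (G.crossings part p) t then 1 else 0) else 0) =
        ∑' p, if (List.range (pairCount e L (stateSeq a))).map (G.pairAt part e L (stateSeq a)) =
          transcriptCode τ ∧ G.ExitsVia {v | part v ≠ none} e p ∧
          ∀ t < L, stateSeq a (t + 1) = states e (G.crossings part p) t then G.pathProb v₀ p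
          else 0 := fun a => by
      split_ifs with h
      · refine tsum_congr fun p => ?_
        simp only [h, true_and]
        rw [ite_and]
        split_ifs <;> simp
      · simp [h]
    rw [Finset.sum_congr rfl fun a _ => this a,
      ← Summable.tsum_finsetSum fun a _ => ENNReal.summable]
    refine tsum_congr fun p => ?_
    by_cases hp : G.ExitsVia {v | part v ≠ none} e p
    -- Only the sequence formed by the crossings of `p` itself contributes to the sum.
    · rw [if_pos hp, Finset.sum_eq_single fun t : Fin L => states e (G.crossings part p) t]
      · have hst : ∀ t < L, stateSeq (fun t : Fin L => states e (G.crossings part p) t) (t + 1) =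
            states e (G.crossings part p) t := fun t ht => by simp [stateSeq, ht]
        rw [← G.transcriptCode_transcript hsrc hdst hp rfl hst]
        simp only [transcriptCode_injective.eq_iff]
        symm
        by_cases hτ : G.transcript part e L p = τ
        · refine (if_pos ⟨hτ, hp, hst⟩).trans ?_
          simp [hτ]
        · refine (if_neg fun h => hτ h.1).trans ?_
          simp [hτ]
      · intro a _ ha
        rw [if_neg]
        rintro ⟨-, -, h⟩
        refine ha (funext fun t => ?_)
        have := h t t.2
        simpa [stateSeq] using this
      · simp
    · simp [hp]
  rw [condExitProb_eq_pathSum, hsum, hone]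
  have hpos : ENNReal.ofReal (c.h (Fin.last m)) ≠ 0 := by
    simpa using c.h_pos hreach
  rw [div_eq_mul_inv, Finset.sum_mul]
  refine Finset.sum_congr rfl fun a _ => ?_
  split_ifs
  · rw [mul_right_comm, ENNReal.mul_inv_cancel hpos ENNReal.ofReal_ne_top, one_mul]
  · rw [zero_mul]

end WDigraph

/-! ### The quantities of the algorithm, computed in parallel -/

section inputs

variable {n m k : ℕ} (G : WDigraph n m) (part : Fin n → Option (Fin k)) (v₀ : Fin n)
  (e : Fin m) (L : ℕ)

theorem inputWords_src (f : Fin m) : inputWords G part v₀ e L (6 + f) = G.src f := by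
  rw [inputWords, List.getD_eq_getElem?_getD, List.getElem?_append_left (by simp; omega),
    List.getElem?_append_left (by simp; omega), List.getElem?_append_right (by simp)]
  simp

theorem inputWords_dst (f : Fin m) : inputWords G part v₀ e L (6 + m + f) = G.dst f := by
  rw [inputWords, List.getD_eq_getElem?_getD, List.getElem?_append_left (by simp; omega),
    List.getElem?_append_right (by simp; omega)]
  simp [show 6 + m + (f : ℕ) - (m + 6) = f by omega]

theorem inputWords_part (v : Fin n) :
    inputWords G part v₀ e L (6 + 2 * m + v) = clusterCode (part v) := by
  rw [inputWords, List.getD_eq_getElem?_getD, List.getElem?_append_right (by simp; omega)]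
  simp [show 6 + 2 * m + (v : ℕ) - (m + m + 1 + 1 + 1 + 1 + 1 + 1) = v by omega]

theorem inputWords_end : inputWords G part v₀ e L (6 + 2 * m + n) = 0 := by
  rw [inputWords, List.getD_eq_getElem?_getD, List.getElem?_eq_none (by simp; omega)]
  rfl

theorem inputReals_eq (j : ℕ) :
    inputReals G j = if h : j < m then (G.weight ⟨j, h⟩ : ℝ) else 0 := by
  rw [inputReals, List.getD_eq_getElem?_getD]
  by_cases h : j < m <;> simp [h]

end inputs

namespace PRAM

/-- An input of the algorithm, the exponent for the size of the machine, and one random number for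
every processor. -/
structure Input where
  {n m k : ℕ}
  L : ℕ
  G : WDigraph n m
  part : Fin n → Option (Fin k)
  v₀ : Fin n
  e : Fin m
  hsrc : part (G.src e) ≠ none
  hdst : part (G.dst e) = none
  c : ℕ
  le_c : 13 ≤ c
  u : ℕ → ℝ

namespace Input

/-- The base `D` exceeds all indices in use: the `m + 1` states, the size `m + 2` of `newton`, and
the times up to `L + 1`. As `D ≤ (m + L + 2) ^ 2`, an exponent of at least `12` leaves room for six
digits. The last cell below `B` lies just past the input and reads `0`. -/
noncomputable def mach (x : Input) : Machine where
  P := (x.m + x.L + 2) ^ x.c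
  W := (x.n + x.m + x.L + 2) ^ x.c
  D := x.m + x.L + 4
  B := 6 + 2 * x.m + x.n + 1
  win := inputWords x.G x.part x.v₀ x.e x.L
  rin := inputReals x.G
  u := x.u
  B_add_P_le := by
    have hm := x.e.pos
    have hn := x.v₀.pos
    obtain ⟨c, hc⟩ : ∃ c, x.c = c + 13 := ⟨x.c - 13, by have := x.le_c; omega⟩
    set y := x.m + x.L + 2 with hy
    have h1 : y ^ 3 ≤ y ^ (c + 12) := Nat.pow_le_pow_right (by omega) (by omega)
    have h2 : y ^ (c + 12) ≤ (x.n + y) ^ (c + 12) := Nat.pow_le_pow_left (by omega) _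
    rw [show x.n + x.m + x.L + 2 = x.n + y by omega, hc, pow_succ y, pow_succ (x.n + y)]
    -- Replacing `y` by `n + y` enlarges `y ^ (c + 13)` by at least `y ^ (c + 12) * n`, and this
    -- surplus has to cover the `B` input cells.
    have h4 : 6 + 2 * x.m + x.n + 1 ≤ y ^ 3 * x.n := by
      have h5 : 3 ≤ y := by omega
      have h6 : x.m + 2 ≤ y := by omega
      have h7 : 9 * (x.m + 2) ≤ y ^ 3 := by nlinarith [Nat.mul_le_mul h5 h5]
      nlinarith
    nlinarith
  two_le_D := by omega
  D_pow_le := by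
    have h1 : x.m + x.L + 4 ≤ (x.m + x.L + 2) ^ 2 := by nlinarith
    calc (x.m + x.L + 4) ^ 6 ≤ ((x.m + x.L + 2) ^ 2) ^ 6 := Nat.pow_le_pow_left h1 6
      _ = (x.m + x.L + 2) ^ 12 := by rw [← pow_mul]
      _ ≤ _ := Nat.pow_le_pow_right (by omega) (by have := x.le_c; omega)

/-- The Markov chain of the edges of the walk. -/
noncomputable def chain (x : Input) : ExitChain (Fin (x.m + 1)) :=
  x.G.chain x.part x.v₀ x.e x.hsrc x.hdst

/-- Source of an edge, as a word. -/
def srcN (x : Input) (j : ℕ) : ℕ := if h : j < x.m then x.G.src ⟨j, h⟩ else x.n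

/-- Vertex reached by an edge, as a word. -/
def headN (x : Input) (j : ℕ) : ℕ := if h : j < x.m then x.G.dst ⟨j, h⟩ else x.v₀

/-- Code of the cluster of a vertex. -/
def clusN (x : Input) (v : ℕ) : ℕ := if h : v < x.n then clusterCode (x.part ⟨v, h⟩) else 0

end Input

/-- The context of the algorithm. -/
noncomputable def inputCtx : Ctx Input where
  mach := Input.mach
  Inv x s := x.mach.Base s
  b0 := 4
  four_le := le_rfl
  stable x s s' hs h := by
    refine ⟨fun p => ?_, fun a ha => ?_⟩
    · have h1 := hs.1 p
      have hw := h.1 p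
      rw [(hw 0 (by norm_num)).1, (hw 1 (by norm_num)).1, (hw 2 (by norm_num)).1,
        (hw 3 (by norm_num)).1, (hw 0 (by norm_num)).2]
      exact h1
    · rw [(h.2 a ha).1, (h.2 a ha).2]
      exact hs.2 a ha
  base _ _ h := h

namespace Input

theorem comp_n : Comp inputCtx fun x _ => x.n :=
  (Comp.const 0 (by norm_num)).win fun x p _ => show 0 < 6 + 2 * x.m + x.n + 1 by omega

theorem comp_m : Comp inputCtx fun x _ => x.m :=
  (Comp.const 1 (by norm_num)).win fun x p _ => show 1 < 6 + 2 * x.m + x.n + 1 by omega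

theorem comp_L : Comp inputCtx fun x _ => x.L :=
  (Comp.const 3 (by norm_num)).win fun x p _ => show 3 < 6 + 2 * x.m + x.n + 1 by omega

theorem comp_e : Comp inputCtx fun x _ => (x.e : ℕ) :=
  (Comp.const 5 (by norm_num)).win fun x p _ => show 5 < 6 + 2 * x.m + x.n + 1 by omega

theorem B_le_W (x : Input) : 6 + 2 * x.m + x.n + 1 ≤ x.mach.W :=
  le_trans (Nat.le_add_right _ _) x.mach.B_add_P_le

theorem m_lt_D (x : Input) : x.m + 3 < (inputCtx.mach x).D := by
  change x.m + 3 < x.m + x.L + 4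
  omega

variable {i j v : Input → ℕ → ℕ}

theorem comp_srcN (hj : Comp inputCtx j) : Comp inputCtx fun x p => x.srcN (j x p) := by
  -- Indices out of range are directed to cell `0`, which holds `n`, the number of no vertex.
  have ha : Comp inputCtx fun x p => if j x p < x.m then 6 + j x p else 0 := by
    refine ((Test.lt hj comp_m).ite ((Comp.const 6 (by norm_num)).wop .add hj)
      (Comp.const 0 (by norm_num))).congr fun x p _ => ?_
    split_ifs with h
    · have := x.B_le_W
      exact Nat.mod_eq_of_lt (show 6 + j x p < x.mach.W by omega)
    · rfl
  refine (ha.win fun x p _ => ?_).congr fun x p _ => ?_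
  · change _ < 6 + 2 * x.m + x.n + 1
    split_ifs <;> omega
  · change inputWords _ _ _ _ _ _ = _
    unfold srcN
    split_ifs with h
    · exact inputWords_src x.G x.part x.v₀ x.e x.L ⟨_, h⟩
    · rfl

theorem comp_headN (hj : Comp inputCtx j) : Comp inputCtx fun x p => x.headN (j x p) := by
  -- Cell `4` holds `v₀`, where the additional index `m` is located.
  have ha : Comp inputCtx fun x p => if j x p < x.m then 6 + x.m + j x p else 4 := by
    refine ((Test.lt hj comp_m).ite
      ((((Comp.const 6 (by norm_num)).add comp_m fun x p _ => ?_)).wop .add hj)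
      (Comp.const 4 (by norm_num))).congr fun x p _ => ?_
    · have := x.B_le_W
      change _ < x.mach.W
      omega
    · split_ifs with h
      · have := x.B_le_W
        exact Nat.mod_eq_of_lt (show 6 + x.m + j x p < x.mach.W by omega)
      · rfl
  refine (ha.win fun x p _ => ?_).congr fun x p _ => ?_
  · change _ < 6 + 2 * x.m + x.n + 1
    split_ifs <;> omega
  · change inputWords _ _ _ _ _ _ = _
    unfold headN
    split_ifs with h
    · exact inputWords_dst x.G x.part x.v₀ x.e x.L ⟨_, h⟩
    · rfl

theorem comp_clusN (hv : Comp inputCtx v) : Comp inputCtx fun x p => x.clusN (v x p) := by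
  have hm : Comp inputCtx fun x _ => 6 + x.m + x.m :=
    ((Comp.const 6 (by norm_num)).add comp_m fun x p _ => by
      have := x.B_le_W
      change _ < x.mach.W
      omega).add comp_m fun x p _ => by
      have := x.B_le_W
      change _ < x.mach.W
      omega
  -- Vertices out of range are directed to the cell past the input, which reads `0`, the code for no
  -- cluster.
  have ha : Comp inputCtx fun x p => if v x p < x.n then 6 + x.m + x.m + v x p else
      6 + x.m + x.m + x.n := by
    refine ((Test.lt hv comp_n).ite (hm.wop .add hv) (hm.wop .add comp_n)).congr fun x p _ => ?_
    have := x.B_le_W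
    split_ifs with h
    · exact Nat.mod_eq_of_lt (show 6 + x.m + x.m + v x p < x.mach.W by omega)
    · exact Nat.mod_eq_of_lt (show 6 + x.m + x.m + x.n < x.mach.W by omega)
  refine (ha.win fun x p _ => ?_).congr fun x p _ => ?_
  · change _ < 6 + 2 * x.m + x.n + 1
    split_ifs <;> omega
  · change inputWords _ _ _ _ _ _ = _
    rw [show 6 + x.m + x.m = 6 + 2 * x.m by ring]
    unfold clusN
    split_ifs with h
    · exact inputWords_part x.G x.part x.v₀ x.e x.L ⟨_, h⟩
    · exact inputWords_end x.G x.part x.v₀ x.e x.L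

theorem comp_weight (hj : Comp inputCtx j) : Comp inputCtx fun x p => inputReals x.G (j x p) := by
  have ha : Comp inputCtx fun x p => if j x p < x.m then j x p else x.m :=
    (Test.lt hj comp_m).ite hj comp_m
  refine (ha.rin fun x p _ => ?_).congr fun x p _ => ?_
  · change _ < 6 + 2 * x.m + x.n + 1
    split_ifs <;> omega
  · change inputReals _ _ = _
    split_ifs with h
    · rfl
    · rw [inputReals_eq, inputReals_eq, dif_neg (lt_irrefl _), dif_neg h]

theorem srcN_fin (x : Input) (f : Fin x.m) : x.srcN f = x.G.src f := by simp [srcN]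

theorem headN_fin (x : Input) (i : Fin (x.m + 1)) : x.headN i = x.G.head x.v₀ i := by
  unfold headN WDigraph.head
  split_ifs <;> rfl

theorem clusN_fin (x : Input) (v : Fin x.n) : x.clusN v = clusterCode (x.part v) := by
  simp [clusN]

theorem outWeight_eq (x : Input) (i : Fin (x.m + 1)) :
    (x.G.outWeight (x.G.head x.v₀ i) : ℝ) = ∑ l ∈ Finset.range x.m,
      if x.srcN l = x.headN i then inputReals x.G l else 0 := by
  rw [← Fin.sum_univ_eq_sum_range (fun l => if x.srcN l = x.headN i then inputReals x.G l else 0)]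
  rw [WDigraph.outWeight, NNReal.coe_sum]
  refine Finset.sum_congr rfl fun f _ => ?_
  simp only [srcN_fin, headN_fin, Fin.val_inj]
  rw [inputReals_eq, dif_pos f.2]
  split_ifs <;> rfl

theorem comp_T : MComp inputCtx fun x => x.chain.T := by
  have h0 := Comp.digit (C := inputCtx) 0
  have h1 := Comp.digit (C := inputCtx) 1
  have hw : Arr inputCtx 2 (fun x v =>
      if x.srcN (v 0) = x.headN (v 1) then inputReals x.G (v 0) else 0) :=
    (Test.eq (comp_srcN h0) (comp_headN h1)).ite (comp_weight h0) Comp.zeroR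
  have hb := hw.sum₁ comp_m (fun x _ => by have := x.m_lt_D; omega) h0 (digit_lt inputCtx 0)
  have hm1 : Comp inputCtx fun x _ => x.m + 1 := comp_m.add (Comp.const 1 (by norm_num))
    fun x p _ => lt_trans (by have := x.m_lt_D; omega) (D_lt_W (inputCtx.mach x))
  refine ((((Test.lt h0 hm1).and (Test.lt h1 comp_m)).and
    (Test.eq (comp_srcN h1) (comp_headN h0))).ite ((comp_weight h1).divR hb) Comp.zeroR).congr
    fun x p _ => ?_
  change _ = Matrix.pad x.chain.T (p / (inputCtx.mach x).D ^ 0 % (inputCtx.mach x).D)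
    (p / (inputCtx.mach x).D ^ 1 % (inputCtx.mach x).D)
  simp only [Matrix.cons_val_zero, Matrix.cons_val_one]
  generalize p / (inputCtx.mach x).D ^ 0 % (inputCtx.mach x).D = i
  generalize p / (inputCtx.mach x).D ^ 1 % (inputCtx.mach x).D = j
  unfold Matrix.pad
  by_cases hi : i < x.m + 1
  · by_cases hj : j < x.m
    · rw [dif_pos ⟨hi, by omega⟩]
      have := x.G.chain_T (v₀ := x.v₀) x.hsrc x.hdst ⟨i, hi⟩ ⟨j, hj⟩
      change _ = x.chain.T ⟨i, hi⟩ (Fin.castSucc ⟨j, hj⟩)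
      rw [chain, this, WDigraph.stepProb]
      have h1 := x.outWeight_eq ⟨i, hi⟩
      have h2 := x.headN_fin ⟨i, hi⟩
      have h3 := x.srcN_fin ⟨j, hj⟩
      dsimp only at h1 h2 h3
      change (if (i < x.m + 1 ∧ j < x.m) ∧ x.srcN j = x.headN i then inputReals x.G j /
        ∑ l ∈ Finset.range x.m, (if x.srcN l = x.headN i then inputReals x.G l else 0) else 0) = _
      rw [← h1, inputReals_eq, dif_pos hj]
      by_cases hs : x.srcN j = x.headN i
      · rw [if_pos ⟨⟨hi, hj⟩, hs⟩, if_pos (Fin.ext (by rw [← h3, ← h2, hs])), NNReal.coe_div]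
      · rw [if_neg fun h => hs h.2, if_neg fun h => hs (by rw [h3, h2, h]), NNReal.coe_zero]
    · rw [if_neg (by tauto)]
      split_ifs with h
      · have hj' : j = x.m := by omega
        subst hj'
        exact (x.G.chain_T_last x.hsrc x.hdst ⟨i, hi⟩).symm
      · rfl
  · rw [if_neg (by tauto), dif_neg (by tauto)]

theorem comp_mask {ok : ∀ x : Input, Fin (x.m + 1) → Prop} {okN : Input → ℕ → Prop}
    (hN : Test inputCtx fun x p => okN x (p / (inputCtx.mach x).D ^ 1 % (inputCtx.mach x).D))
    (hok : ∀ x i, okN x (i : Fin (x.m + 1)) ↔ ok x i) :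
    MComp inputCtx fun x => x.chain.mask (ok x) := by
  classical
  refine (hN.ite comp_T Comp.zeroR).congr fun x p _ => ?_
  change (if _ then Matrix.pad x.chain.T (p / (inputCtx.mach x).D ^ 0 % (inputCtx.mach x).D)
    (p / (inputCtx.mach x).D ^ 1 % (inputCtx.mach x).D) else 0) =
    Matrix.pad _ (p / (inputCtx.mach x).D ^ 0 % (inputCtx.mach x).D)
    (p / (inputCtx.mach x).D ^ 1 % (inputCtx.mach x).D)
  generalize p / (inputCtx.mach x).D ^ 0 % (inputCtx.mach x).D = i
  generalize p / (inputCtx.mach x).D ^ 1 % (inputCtx.mach x).D = j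
  unfold Matrix.pad
  by_cases h : i < x.m + 1 ∧ j < x.m + 1
  · rw [dif_pos h, dif_pos h]
    unfold ExitChain.mask
    exact if_congr (hok x ⟨j, h.2⟩) rfl rfl
  · rw [dif_neg h, dif_neg h, ite_self]

theorem test_inS (hj : Comp inputCtx j) :
    Test inputCtx fun x p => j x p < x.m ∧ x.clusN (x.headN (j x p)) ≠ 0 :=
  (Test.lt hj comp_m).and
    (Test.eq (comp_clusN (comp_headN hj)) (Comp.const 0 (by norm_num))).not

theorem clusterCode_eq_zero {k : ℕ} {a : Option (Fin k)} : clusterCode a = 0 ↔ a = none := by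
  cases a <;> simp [clusterCode]

theorem inS_iff (x : Input) (i : Fin (x.m + 1)) :
    ((i : ℕ) < x.m ∧ x.clusN (x.headN i) ≠ 0) ↔ x.chain.inS i := by
  change _ ↔ ∃ h : (i : ℕ) < x.m, x.part (x.G.dst ⟨i, h⟩) ≠ none
  rw [headN_fin, clusN_fin, ne_eq, clusterCode_eq_zero, WDigraph.head]
  constructor
  · rintro ⟨h, h'⟩
    exact ⟨h, by simpa [h] using h'⟩
  · rintro ⟨h, h'⟩
    exact ⟨h, by simpa [h] using h'⟩

theorem test_jmp (hj : Comp inputCtx j) :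
    Test inputCtx fun x p => j x p < x.m ∧ x.clusN (x.srcN (j x p)) ≠ x.clusN (x.headN (j x p)) :=
  (Test.lt hj comp_m).and
    (Test.eq (comp_clusN (comp_srcN hj)) (comp_clusN (comp_headN hj))).not

theorem jmp_iff (x : Input) (i : Fin (x.m + 1)) :
    ((i : ℕ) < x.m ∧ x.clusN (x.srcN i) ≠ x.clusN (x.headN i)) ↔ x.chain.jmp i := by
  change _ ↔ ∃ h : (i : ℕ) < x.m, x.part (x.G.src ⟨i, h⟩) ≠ x.part (x.G.dst ⟨i, h⟩)
  have : ∀ h : (i : ℕ) < x.m, x.srcN i = x.G.src ⟨i, h⟩ := fun h => x.srcN_fin ⟨i, h⟩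
  rw [headN_fin, clusN_fin, WDigraph.head]
  constructor
  · rintro ⟨h, h'⟩
    rw [this h, clusN_fin, clusterCode_injective.ne_iff] at h'
    exact ⟨h, by simpa [h] using h'⟩
  · rintro ⟨h, h'⟩
    rw [this h, clusN_fin, clusterCode_injective.ne_iff]
    exact ⟨h, by simpa [h] using h'⟩

end Input

end PRAM

/-- The next jumping edge after `i`, selected by the number `y`. -/
noncomputable def ExitChain.select {m : ℕ} (c : ExitChain (Fin (m + 1))) (i : ℕ) (y : ℝ) : ℕ :=
  if i = (c.e : ℕ) then (c.e : ℕ) else ∑ l ∈ Finset.range m,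
    if y < ∑ j ∈ Finset.range (l + 1), Matrix.pad c.q i j then 0 else 1

theorem ExitChain.select_lt {m : ℕ} (c : ExitChain (Fin (m + 1))) (i : ℕ) (y : ℝ) :
    c.select i y < m + 1 := by
  unfold select
  split_ifs
  · exact c.e.2
  · refine Nat.lt_succ_of_le ((Finset.sum_le_card_nsmul _ _ 1 fun l _ => ?_).trans (by simp))
    split_ifs <;> simp

/-! ### Computing the jump distribution, the states and the output -/

namespace PRAM.Input

variable {i j : Input → ℕ → ℕ}

theorem comp_m_add_one : Comp inputCtx fun x _ => x.m + 1 :=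
  comp_m.add (Comp.const 1 (by norm_num))
    fun x p _ => lt_trans (by have := x.m_lt_D; omega) (D_lt_W (inputCtx.mach x))

theorem comp_mulVec {A : ∀ x : Input, Matrix (Fin (x.m + 1)) (Fin (x.m + 1)) ℝ}
    (hA : MComp inputCtx A) (hi : Comp inputCtx i) (hiD : ∀ x p, i x p < (inputCtx.mach x).D) :
    Comp inputCtx fun x p =>
      ∑ l ∈ Finset.range (x.m + 1), (A x).pad (i x p) l * x.chain.T.pad l x.e := by
  have h : Arr inputCtx 2 fun x v => (A x).pad (v 1) (v 0) * x.chain.T.pad (v 0) x.e :=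
    (hA.get (Comp.digit 1) (Comp.digit 0) (digit_lt _ 1) (digit_lt _ 0)).mulR
      (comp_T.get (Comp.digit 0) comp_e (digit_lt _ 0) fun x p => by
        have := x.m_lt_D
        have := x.e.2
        omega)
  exact h.sum₁ comp_m_add_one (fun x _ => by have := x.m_lt_D; omega) hi hiD

theorem mulVec_eq (x : Input) (A : Matrix (Fin (x.m + 1)) (Fin (x.m + 1)) ℝ) (i : Fin (x.m + 1)) :
    ∑ l ∈ Finset.range (x.m + 1), A.pad i l * x.chain.T.pad l x.e =
      A.mulVec (fun l => x.chain.T l x.chain.e) i := by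
  rw [← Fin.sum_univ_eq_sum_range (fun l => A.pad i l * x.chain.T.pad l x.e)]
  refine Finset.sum_congr rfl fun l _ => ?_
  rw [Matrix.pad_fin]
  exact congrArg _ (Matrix.pad_fin x.chain.T l x.chain.e)

theorem test_reach (hi : Comp inputCtx i) (hiD : ∀ x p, i x p < (inputCtx.mach x).D) :
    Test inputCtx fun x p => 0 < ∑ l ∈ Finset.range (x.m + 1),
      ((1 + x.chain.mask x.chain.inS) ^ (x.m + 1)).pad (i x p) l * x.chain.T.pad l x.e := by
  have h1 : MComp inputCtx fun x => x.chain.mask x.chain.inS :=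
    comp_mask (okN := fun x j => j < x.m ∧ x.clusN (x.headN j) ≠ 0) (test_inS (Comp.digit 1))
      fun x i => x.inS_iff i
  have h2 := (h1.one_add comp_m_add_one).pow comp_m_add_one
    fun x => by have := x.m_lt_D; omega
  have h3 : MComp inputCtx fun x => (1 + x.chain.mask x.chain.inS) ^ (x.m + 1) :=
    Comp.get₃ h2 comp_m_add_one (Comp.digit 0) (Comp.digit 1)
      (fun x _ => by have := x.m_lt_D; omega) (digit_lt _ 0) (digit_lt _ 1)
  exact Test.lt_real Comp.zeroR (comp_mulVec h3 hi hiD)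

theorem reach_iff (x : Input) (i : Fin (x.m + 1)) :
    (0 < ∑ l ∈ Finset.range (x.m + 1),
      ((1 + x.chain.mask x.chain.inS) ^ (x.m + 1)).pad i l * x.chain.T.pad l x.e) ↔
      x.chain.Reach i := by
  rw [mulVec_eq, ← x.chain.reach_iff_pos, Fintype.card_fin]

theorem comp_inner : MComp inputCtx fun x => x.chain.inner :=
  comp_mask (okN := fun x j => (j < x.m ∧ x.clusN (x.headN j) ≠ 0) ∧
      0 < ∑ l ∈ Finset.range (x.m + 1),
        ((1 + x.chain.mask x.chain.inS) ^ (x.m + 1)).pad j l * x.chain.T.pad l x.e)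
    ((test_inS (Comp.digit 1)).and (test_reach (Comp.digit 1) (digit_lt _ 1)))
    fun x i => and_congr (x.inS_iff i) (x.reach_iff i)

theorem comp_stay : MComp inputCtx fun x => x.chain.stay :=
  comp_mask (okN := fun x j => (j < x.m ∧ x.clusN (x.headN j) ≠ 0) ∧
      (0 < ∑ l ∈ Finset.range (x.m + 1),
        ((1 + x.chain.mask x.chain.inS) ^ (x.m + 1)).pad j l * x.chain.T.pad l x.e) ∧
      ¬ (j < x.m ∧ x.clusN (x.srcN j) ≠ x.clusN (x.headN j)))
    ((test_inS (Comp.digit 1)).and ((test_reach (Comp.digit 1) (digit_lt _ 1)).and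
      (test_jmp (Comp.digit 1)).not))
    fun x i => and_congr (x.inS_iff i) (and_congr (x.reach_iff i) (not_congr (x.jmp_iff i)))

theorem comp_h (hi : Comp inputCtx i) (hiD : ∀ x p, i x p < (inputCtx.mach x).D) :
    Comp inputCtx fun x p => ∑ l ∈ Finset.range (x.m + 1),
      ((1 - x.chain.inner)⁻¹).pad (i x p) l * x.chain.T.pad l x.e :=
  comp_mulVec ((comp_inner.one_sub comp_m_add_one).inv comp_m_add_one
    fun x => by have := x.m_lt_D; omega) hi hiD

theorem comp_q : MComp inputCtx fun x => x.chain.q := by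
  classical
  have h0 := Comp.digit (C := inputCtx) 0
  have h1 := Comp.digit (C := inputCtx) 1
  have hQ := ((comp_stay.one_sub comp_m_add_one).inv comp_m_add_one
    fun x => by have := x.m_lt_D; omega).mul
    (comp_mask (ok := fun x => x.chain.jmp)
      (okN := fun x j => j < x.m ∧ x.clusN (x.srcN j) ≠ x.clusN (x.headN j))
      (test_jmp (Comp.digit 1)) fun x i => x.jmp_iff i) comp_m_add_one
    fun x => by have := x.m_lt_D; omega
  refine ((hQ.mulR ((Test.eq h1 comp_e).ite Comp.oneR
    ((test_inS h1).ite (comp_h h1 (digit_lt _ 1)) Comp.zeroR))).divR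
    (comp_h h0 (digit_lt _ 0))).congr fun x p _ => ?_
  change Matrix.pad ((1 - x.chain.stay)⁻¹ * x.chain.mask x.chain.jmp)
    (p / (inputCtx.mach x).D ^ 0 % (inputCtx.mach x).D)
    (p / (inputCtx.mach x).D ^ 1 % (inputCtx.mach x).D) * _ / _ =
    Matrix.pad (Matrix.of x.chain.q) (p / (inputCtx.mach x).D ^ 0 % (inputCtx.mach x).D)
      (p / (inputCtx.mach x).D ^ 1 % (inputCtx.mach x).D)
  generalize p / (inputCtx.mach x).D ^ 0 % (inputCtx.mach x).D = i
  generalize p / (inputCtx.mach x).D ^ 1 % (inputCtx.mach x).D = j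
  by_cases h : i < x.m + 1 ∧ j < x.m + 1
  · obtain ⟨hi, hj⟩ := h
    lift i to Fin (x.m + 1) using hi
    lift j to Fin (x.m + 1) using hj
    have hh : ∀ i : Fin (x.m + 1), ∑ l ∈ Finset.range (x.m + 1),
        ((1 - x.chain.inner)⁻¹).pad i l * x.chain.T.pad l x.e = x.chain.h i :=
      fun i => x.mulVec_eq _ i
    rw [Matrix.pad_fin, Matrix.pad_fin, hh, hh, Matrix.of_apply]
    unfold ExitChain.q ExitChain.g
    congr 2
    refine if_congr (Fin.ext_iff (a := j) (b := x.chain.e)).symm rfl ?_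
    exact if_congr (x.inS_iff j) rfl rfl
  · have hp : ∀ A : Matrix (Fin (x.m + 1)) (Fin (x.m + 1)) ℝ, A.pad i j = 0 := fun A => dif_neg h
    rw [hp, hp, zero_mul, zero_div]

/-- The states of the algorithm. -/
noncomputable def stateN (x : Input) (t : ℕ) : ℕ :=
  -- Time `t` and state `i` use the random number of processor `t + i * D`, and the start is the
  -- index `m`.
  trajectory (fun t i => x.chain.select i (x.u (encode (x.m + x.L + 4) ![t, i]))) x.m t

theorem stateN_lt (x : Input) (t : ℕ) : x.stateN t < x.m + 1 := by
  cases t with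
  | zero => exact Nat.lt_succ_self x.m
  | succ t => exact x.chain.select_lt _ _

/-- For all pairs `(t, i)` at once, the successor is obtained as a count of comparisons between one
random number and the partial sums of row `i` of `q`. Only then are the maps composed, by
`Comp.traj`. -/
theorem comp_stateN {T : Input → ℕ → ℕ} (hT : Comp inputCtx T)
    (hTD : ∀ x p, T x p < (inputCtx.mach x).D) : Comp inputCtx fun x p => x.stateN (T x p) := by
  classical
  have hmD : ∀ x : Input, x.m < (inputCtx.mach x).D := fun x => by have := x.m_lt_D; omega
  have h0 := Comp.digit (C := inputCtx) 0
  have h1 := Comp.digit (C := inputCtx) 1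
  have h2 := Comp.digit (C := inputCtx) 2
  have hq : Arr inputCtx 2 fun x v => Matrix.pad x.chain.q (v 1) (v 0) :=
    comp_q.get h1 h0 (digit_lt _ 1) (digit_lt _ 0)
  -- Only `l < m` matters for the count; the cap keeps the length of the partial sum below `D` on
  -- all processors.
  have hcut : Comp inputCtx fun x p => if p / (inputCtx.mach x).D ^ 0 % (inputCtx.mach x).D < x.m
      then p / (inputCtx.mach x).D ^ 0 % (inputCtx.mach x).D + 1 else x.m :=
    (Test.lt h0 comp_m).ite (h0.add (Comp.const 1 (by norm_num)) fun x p _ => by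
      have := digit_lt inputCtx 0 x p
      have := D_lt_W (inputCtx.mach x)
      omega) comp_m
  have hcum := hq.sum₁ hcut (fun x p => by have := hmD x; split_ifs <;> omega) h2 (digit_lt _ 2)
  have hlt := (Test.lt_real (Comp.read₂ Comp.u h1 h2 (digit_lt _ 1) (digit_lt _ 2)) hcum).not
  have hcount := Arr.count (C := inputCtx) (a := 2) (by norm_num)
    (q := fun x v => ¬ (x.u (encode (x.m + x.L + 4) ![v 1, v 2]) <
      ∑ l ∈ Finset.range (if v 0 < x.m then v 0 + 1 else x.m), Matrix.pad x.chain.q (v 2) l))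
    hlt comp_m (fun x _ => hmD x) ![fun x p => p / (inputCtx.mach x).D ^ 0 % (inputCtx.mach x).D,
      fun x p => p / (inputCtx.mach x).D ^ 1 % (inputCtx.mach x).D]
    (Fin.forall_fin_two.mpr ⟨h0, h1⟩)
    (Fin.forall_fin_two.mpr ⟨digit_lt inputCtx 0, digit_lt inputCtx 1⟩)
  refine Comp.traj (C := inputCtx)
    (F := fun x t i => x.chain.select i (x.u (encode (x.m + x.L + 4) ![t, i])))
    (i₀ := fun x => x.m) ?_ (fun x t i => (x.chain.select_lt _ _).trans ?_) comp_m hmD hT hTD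
  · refine ((Test.eq h1 comp_e).ite comp_e hcount).congr fun x p _ => ?_
    unfold ExitChain.select
    refine if_congr Iff.rfl rfl (Finset.sum_congr rfl fun l hl => ?_)
    have hl' := Finset.mem_range.mp hl
    simp only [Fin.cons_zero, if_pos hl', ite_not]
    rfl
  · have := x.m_lt_D
    omega

/-- The output of the algorithm. -/
noncomputable def outN (x : Input) (p : ℕ) : ℕ :=
  if p = 0 then ∑ t ∈ Finset.range (x.L + 1), if x.stateN t = x.e then 0 else 1
  -- Pair `i` of the output occupies the cells `1 + 2 * i` and `2 + 2 * i`: odd addresses hold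
  -- clusters, even ones edges.
  else if (p - 1) / 2 < x.L then
    if p % 2 = 1 then x.clusN (x.srcN (x.stateN ((p - 1) / 2 + 1))) else x.stateN ((p - 1) / 2 + 1)
  else if p % 2 = 1 then 0 else x.e

theorem comp_outN : Comp inputCtx fun x p => x.outN p := by
  classical
  have hLD : ∀ x : Input, x.L + 1 < (inputCtx.mach x).D := fun x => by
    change x.L + 1 < x.m + x.L + 4
    omega
  have h0 := Comp.digit (C := inputCtx) 0
  have hcount := Arr.count (C := inputCtx) (a := 0) (by norm_num)
    (q := fun x v => ¬ x.stateN (v 0) = x.e)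
    (Test.eq (comp_stateN h0 (digit_lt _ 0)) comp_e).not
    (comp_L.add (Comp.const 1 (by norm_num)) fun x p _ => (hLD x).trans (D_lt_W _))
    (fun x _ => hLD x) ![] (fun i => i.elim0) fun i => i.elim0
  have hone : Comp inputCtx fun _ _ => 1 := Comp.const 1 (by norm_num)
  have htwo : Comp inputCtx fun _ _ => 2 := Comp.const 2 (by norm_num)
  have hhalf : Comp inputCtx fun _ p => (p - 1) / 2 :=
    (Comp.pid.sub hone fun x p hp => lt_W hp).div htwo
      fun x p hp => (Nat.sub_le _ _).trans_lt (lt_W hp)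
  have hpar : Comp inputCtx fun _ p => p % 2 := Comp.pid.mod htwo fun x p hp => lt_W hp
  have hidx : Comp inputCtx fun x p => if (p - 1) / 2 < x.L then (p - 1) / 2 + 1 else 0 :=
    (Test.lt hhalf comp_L).ite (hhalf.add hone fun x p hp => by
      have := lt_W hp
      have := (inputCtx.mach x).sixty_four_le
      omega) (Comp.const 0 (by norm_num))
  have hst := comp_stateN hidx fun x p => by
    have := hLD x
    split_ifs <;> omega
  refine ((Test.eq Comp.pid (Comp.const 0 (by norm_num))).ite hcount
    ((Test.lt hhalf comp_L).ite
      ((Test.eq hpar hone).ite (comp_clusN (comp_srcN hst)) hst)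
      ((Test.eq hpar hone).ite (Comp.const 0 (by norm_num)) comp_e))).congr fun x p _ => ?_
  unfold outN
  refine if_congr Iff.rfl (Finset.sum_congr rfl fun t _ => ?_) ?_
  · simp only [Fin.cons_zero, ite_not]
  · by_cases h : (p - 1) / 2 < x.L <;> simp [h]

end PRAM.Input

/-! ### The program -/

namespace PRAM

theorem exec_locals {P W : ℕ} {l : List Instr} (hl : ∀ i ∈ l, i.IsLocal) (s : SIMD P) :
    Exec W l l.length s (l.foldl (fun s i => s.apply W i fun _ => True) s) := by
  induction l generalizing s with
  | nil => exact fun prog o _ => StepsTo.refl W prog (s.config o)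
  | cons i l ih =>
    have h := (exec_local (W := W) (hl i (by simp)) s).seq (ih (fun j hj => hl j (by simp [hj])) _)
    have hs : seq [i] l = i :: l := by
      rw [seq, List.map_congr_left (g := id) fun j hj => (hl j (by simp [hj])).shift _]
      simp
    rw [hs] at h
    simpa [add_comm] using h

theorem runWith_of_halted {P W : ℕ} {prog : List Instr} {c : Config P} (h : Halted prog c)
    (u : ℕ → Fin P → ℝ) (t : ℕ) : runWith W prog u t c = c := by
  induction t generalizing u with
  | zero => rfl
  | succ t ih =>
    have h0 : ∀ p, prog[(c.proc p).pc]? = none := fun p => List.getElem?_eq_none (h p)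
    have : step W prog (u 0) c = c := by simp [step, h0, resolve_none]
    rw [runWith, this, ih]

theorem hasAt_map_shift (i : Instr) (F : List Instr) :
    HasAt (i :: F.map (Instr.shift 1)) 1 F := fun j _ => by
  rw [add_comm 1 j, List.getElem?_cons_succ, List.getElem?_map]

/-- Initialisation of the reserved registers. -/
def setup : List Instr :=
  -- The registers `1`, `2`, `3` receive `B = n + 2 * m + 7`, `B + p` and `D = m + L + 4`.
  [.wconst 4 1, .wload 5 4, .wconst 4 3, .wload 6 4, .wconst 4 0, .wload 4 4, .wop .add 1 4 5,
    .wop .add 1 1 5, .wconst 4 7, .wop .add 1 1 4, .wop .add 2 1 0, .wop .add 3 5 6, .wconst 4 4,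
    .wop .add 3 3 4]

theorem exec_setup (x : Input) {s : SIMD x.mach.P} (h0 : ∀ p, s.word p 0 = p)
    (hr : ∀ p, s.real p 0 = x.u p) (hw : s.wmem = x.mach.win) (hm : s.rmem = x.mach.rin) :
    ∃ s', Exec x.mach.W setup setup.length s s' ∧ x.mach.Base s' := by
  refine ⟨_, exec_locals (by simp [setup, Instr.IsLocal]) s, fun p => ?_, fun a _ => ?_⟩
  · have hc : ∀ c < 64, c % x.mach.W = c := fun c hc =>
      Nat.mod_eq_of_lt (hc.trans_le x.mach.sixty_four_le)
    have hB : x.n + x.m + x.m + 7 = x.mach.B := by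
      change _ = 6 + 2 * x.m + x.n + 1
      omega
    have hD : x.m + x.L + 4 = x.mach.D := rfl
    have h1 : x.mach.B + p < x.mach.W := by
      have := x.mach.B_add_P_le
      have := p.2
      omega
    have w1 : s.wmem 1 = x.m := by rw [hw]; rfl
    have w3 : s.wmem 3 = x.L := by rw [hw]; rfl
    have w0 : s.wmem 0 = x.n := by rw [hw]; rfl
    have h3 := D_lt_W x.mach
    refine ⟨?_, ?_, ?_, ?_, ?_⟩
    · simp [setup, SIMD.apply, Instr.exec, Proc.setWord, h0]
    · simp only [setup, SIMD.apply, Instr.exec, Proc.setWord, List.foldl_cons, List.foldl_nil,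
        if_true, Function.update_apply, WordOp.eval]
      simp [hc, w1, w0, hB]
      exact Nat.mod_eq_of_lt (by omega)
    · simp only [setup, SIMD.apply, Instr.exec, Proc.setWord, List.foldl_cons, List.foldl_nil,
        if_true, Function.update_apply, WordOp.eval]
      simp [hc, w1, w0, h0, hB]
      exact Nat.mod_eq_of_lt (by omega)
    · simp only [setup, SIMD.apply, Instr.exec, Proc.setWord, List.foldl_cons, List.foldl_nil,
        if_true, Function.update_apply, WordOp.eval]
      simp [hc, w1, w3, hD]
      exact Nat.mod_eq_of_lt (by omega)
    · simp [setup, SIMD.apply, Instr.exec, Proc.setWord, hr]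
      rfl
  · simp [setup, SIMD.apply, hw, hm]

/-- All randomness is drawn by the very first instruction, one number for every processor. What
follows is deterministic given these numbers, and at the end processor `p` writes its value of
`outN` to cell `p`. -/
theorem exists_program : ∃ (prog : List Instr) (κ : ℕ), ∀ (x : Input) (ω : Randomness x.mach.P),
    (∀ p : Fin x.mach.P, x.u p = ω (0, p)) → ∀ T, κ * x.mach.lg ^ κ ≤ T →
    Halted prog (run x.mach.W prog (start x.mach.P x.mach.win x.mach.rin) ω T) ∧
    ∀ p < x.mach.P,
      (run x.mach.W prog (start x.mach.P x.mach.win x.mach.rin) ω T).wmem p = x.outN p := by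
  obtain ⟨F, κ, hF⟩ := Input.comp_outN 4 le_rfl
  -- The extra `16` pays for the draw, the fourteen instructions of `setup` and the final store.
  refine ⟨.rand 0 :: (seq setup (seq F [Cell.store ℕ 0 4])).map (Instr.shift 1), κ + 16,
    fun x ω hω T hT => ?_⟩
  set prog := Instr.rand 0 :: (seq setup (seq F [Cell.store ℕ 0 4])).map (Instr.shift 1) with hprog
  set s₀ : SIMD x.mach.P := ⟨fun p r => if r = 0 then (p : ℕ) else 0,
    fun p => Function.update (fun _ => 0) 0 (ω (0, p) : ℝ), x.mach.win, x.mach.rin⟩ with hs₀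
  have hfirst : step x.mach.W prog (fun p => (ω (0, p) : ℝ))
      (start x.mach.P x.mach.win x.mach.rin) = s₀.config 1 := by
    simp [step, start, hprog, Instr.wordWrite, Instr.realWrite, resolve_none, Instr.exec,
      Proc.setReal, SIMD.config, hs₀]
  obtain ⟨s₁, e₁, hb₁⟩ := exec_setup x (s := s₀) (fun p => by simp [hs₀])
    (fun p => by simp [hs₀, hω]) rfl rfl
  obtain ⟨t, s₂, ht, e₂, ha, ho⟩ := hF x s₁ hb₁ trivial
  have e₃ := Cell.exec_store (α := ℕ) x.mach.W 0 4 s₂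
  have hrun := (e₁.seq (e₂.seq e₃)) prog 1 (hasAt_map_shift _ _)
  have hlen : setup.length = 14 := rfl
  have htT : 1 + (setup.length + (t + 1)) ≤ T := by
    have h1 : κ * x.mach.lg ^ κ ≤ κ * x.mach.lg ^ (κ + 16) :=
      Nat.mul_le_mul_left _ (Nat.pow_le_pow_right x.mach.one_le_lg (by omega))
    have h2 : 1 ≤ x.mach.lg ^ (κ + 16) := Nat.pow_pos x.mach.one_le_lg
    have h3 : t ≤ κ * x.mach.lg ^ κ := ht
    rw [hlen]
    nlinarith
  obtain ⟨r, rfl⟩ := Nat.exists_eq_add_of_le htT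
  have hhalt : ∀ s : SIMD x.mach.P, Halted prog
      (s.config (1 + (seq setup (seq F [Cell.store ℕ 0 4])).length)) := fun s p => by
    simp [SIMD.config, hprog, add_comm]
  have hfinal : run x.mach.W prog (start x.mach.P x.mach.win x.mach.rin) ω
      (1 + (setup.length + (t + 1)) + r) = SIMD.config (Cell.setMem s₂
        (resolve (fun p => some (s₂.word p 0, (Cell.get s₂ p 4 : ℕ))) (Cell.mem s₂)))
        (1 + (seq setup (seq F [Cell.store ℕ 0 4])).length) := by
    rw [run_eq_runWith, runWith_add, runWith_add]
    rw [show runWith x.mach.W prog (fun i p => (ω (i, p) : ℝ)) 1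
      (start x.mach.P x.mach.win x.mach.rin) = s₀.config 1 from hfirst]
    exact (congrArg _ (hrun _)).trans (runWith_of_halted (hhalt _) _ _)
  rw [hfinal]
  refine ⟨hhalt _, fun p hp => ?_⟩
  have hw : ∀ p, s₂.word p 0 = p := fun p => by rw [(ha.1 p 0 (by norm_num)).1, (hb₁.1 p).1]
  have := resolve_of_injective (fun p => s₂.word p 0) (fun p => (Cell.get s₂ p 4 : ℕ))
    (Cell.mem s₂) (fun p q hpq => by simpa [hw, Fin.ext_iff] using hpq) ⟨p, hp⟩
  rw [hw] at this
  refine Eq.trans ?_ (this.trans (ho ⟨p, hp⟩))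
  rfl

end PRAM

/-! ### The law of the selected edges -/

/-- A number is located between consecutive terms of an increasing sequence by counting. -/
theorem sum_ite_lt_eq {S : ℕ → ℝ} (hS : Monotone S) {m j : ℕ} (hj : j < m) {y : ℝ} (h1 : S j ≤ y)
    (h2 : y < S (j + 1)) : (∑ l ∈ Finset.range m, if y < S (l + 1) then 0 else 1) = j := by
  have : ∀ l ∈ Finset.range m, (if y < S (l + 1) then 0 else 1) = if l < j then 1 else 0 := by
    intro l _
    by_cases hl : l < j
    · rw [if_pos hl, if_neg (not_lt.mpr ((hS hl).trans h1))]
    · rw [if_neg hl, if_pos (h2.trans_le (hS (by omega)))]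
  rw [Finset.sum_congr rfl this, Finset.sum_boole]
  have hf : (Finset.range m).filter (· < j) = Finset.range j := by
    ext l
    simp only [Finset.mem_filter, Finset.mem_range]
    omega
  rw [hf]
  simp

theorem exists_le_and_lt_succ {S : ℕ → ℝ} {m : ℕ} {y : ℝ} (h0 : S 0 ≤ y) (hm : y < S m) :
    ∃ j < m, S j ≤ y ∧ y < S (j + 1) := by
  induction m with
  | zero => exact absurd hm (not_lt.mpr h0)
  | succ m ih =>
    by_cases h : y < S m
    · obtain ⟨j, hj, h'⟩ := ih h
      exact ⟨j, by omega, h'⟩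
    · exact ⟨m, by omega, not_lt.mp h, hm⟩

namespace ExitChain

variable {m : ℕ} (c : ExitChain (Fin (m + 1)))

theorem measurable_select (i : ℕ) : Measurable (c.select i) := by
  unfold select
  split_ifs
  · exact measurable_const
  · exact Finset.measurable_sum _ fun l _ =>
      Measurable.ite measurableSet_Iio measurable_const measurable_const

theorem q_last (hlast : ∀ i, c.T i (Fin.last m) = 0) (i : Fin (m + 1)) :
    c.q i (Fin.last m) = 0 := by
  have : ∀ l, c.mask c.jmp l (Fin.last m) = 0 := fun l => by
    unfold mask
    rw [hlast, ite_self]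
  simp [q, Matrix.mul_apply, this]

/-- States that do not reach `e` have weight `g = 0`, so the conditioned chain never enters a state
whose row of `q` fails to be a probability distribution. -/
theorem kernel_ne_zero {i j : Fin (m + 1)} (h : c.kernel i j ≠ 0) : c.Reach j ∨ j = c.e := by
  by_cases hj : j = c.e
  · exact Or.inr hj
  · refine Or.inl ?_
    by_contra hR
    refine h ?_
    unfold kernel
    have hg : c.g j = 0 := by
      unfold g
      rw [if_neg hj, c.h_eq_zero hR, ite_self]
    rw [if_neg hj, q, hg]
    simp

/-- Inverse transform sampling: for `i ≠ e` and `j < m`, the edge `j` is selected for numbers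
between two consecutive partial sums of row `i`, an interval of length `q i j`. Reachability makes
the row sum to one, and as the last column is zero, the first `m` entries already do. -/
theorem volume_select (hlast : ∀ i, c.T i (Fin.last m) = 0) {i : Fin (m + 1)}
    (hi : c.Reach i ∨ i = c.e) (j : Fin (m + 1)) :
    volume {u : unitInterval | c.select i u = j} = ENNReal.ofReal (c.kernel i j) := by
  by_cases hie : i = c.e
  · subst hie
    by_cases hj : j = c.e
    · simp [select, kernel, hj]
    · have : (c.e : ℕ) ≠ j := fun h => hj (Fin.ext h.symm)
      simp [select, kernel, hj, this]
  · have hR : c.Reach i := hi.resolve_right hie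
    set S : ℕ → ℝ := fun j => ∑ l ∈ Finset.range j, Matrix.pad (Matrix.of c.q) i l with hS
    have hpad : ∀ l, 0 ≤ Matrix.pad (Matrix.of c.q) i l := fun l => by
      unfold Matrix.pad
      split_ifs
      exacts [c.q_nonneg _ _, le_rfl]
    have hmono : Monotone S := monotone_nat_of_le_succ fun n => by
      simp only [hS, Finset.sum_range_succ]
      linarith [hpad n]
    have hS0 : S 0 = 0 := by simp [hS]
    have hSm : S m = 1 := by
      have h1 : S (m + 1) = 1 := by
        rw [← c.sum_q hR, hS]
        dsimp only
        rw [← Fin.sum_univ_eq_sum_range (fun l => Matrix.pad (Matrix.of c.q) i l)]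
        exact Finset.sum_congr rfl fun l _ => Matrix.pad_fin ..
      have h2 : Matrix.pad (Matrix.of c.q) i m = 0 :=
        (Matrix.pad_fin (Matrix.of c.q) i (Fin.last m)).trans (c.q_last hlast i)
      simp only [hS, Finset.sum_range_succ, h2, add_zero] at h1
      exact h1
    have hsel : ∀ y : ℝ, c.select i y = ∑ l ∈ Finset.range m, if y < S (l + 1) then 0 else 1 :=
      fun y => if_neg fun h => hie (Fin.ext h)
    have hk : c.kernel i j = c.q i j := if_neg hie
    rw [hk]
    induction j using Fin.lastCases with
    | last =>
      rw [c.q_last hlast, ENNReal.ofReal_zero]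
      -- The index `m` is selected only if no partial sum exceeds the number, which forces the
      -- number to be the endpoint `1`.
      refine measure_mono_null (t := {1}) (fun u hu => ?_) (measure_singleton _)
      by_contra hne
      have hlt : (u : ℝ) < S m := by
        rw [hSm]
        exact lt_of_le_of_ne u.2.2 fun h => hne (Subtype.ext h)
      obtain ⟨l, hl, h1, h2⟩ := exists_le_and_lt_succ (S := S) (hS0.trans_le u.2.1) hlt
      have h3 := sum_ite_lt_eq hmono hl h1 h2
      rw [← hsel] at h3
      have h4 : c.select i u = m := hu
      omega
    | cast j =>
      have hmem : ∀ l ≤ m, S l ∈ unitInterval := fun l hl =>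
        ⟨hS0 ▸ hmono (Nat.zero_le l), hSm ▸ hmono hl⟩
      have hset : {u : unitInterval | c.select i u = (j.castSucc : Fin (m + 1))} =
          Set.Ico ⟨S j, hmem j j.2.le⟩ ⟨S (j + 1), hmem (j + 1) j.2⟩ := by
        ext u
        simp only [Set.mem_ofPred_eq, Fin.val_castSucc, Set.mem_Ico, ← Subtype.coe_le_coe,
          ← Subtype.coe_lt_coe]
        refine ⟨fun h => ?_, fun h => ?_⟩
        · by_cases hlt : (u : ℝ) < S m
          · obtain ⟨l, hl, h1, h2⟩ := exists_le_and_lt_succ (S := S) (hS0.trans_le u.2.1) hlt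
            have h3 := sum_ite_lt_eq hmono hl h1 h2
            rw [← hsel, h] at h3
            rw [h3]
            exact ⟨h1, h2⟩
          · have h3 : c.select i u = m := by
              rw [hsel, Finset.sum_congr rfl fun l hl => if_neg (not_lt.mpr
                ((hmono (Finset.mem_range.mp hl)).trans (not_lt.mp hlt)))]
              simp
            have := j.2
            omega
        · rw [hsel]
          exact sum_ite_lt_eq hmono j.2 h.1 h.2
      rw [hset, unitInterval.volume_Ico]
      congr 1
      simp only [hS, Finset.sum_range_succ, add_sub_cancel_left]
      exact Matrix.pad_fin (Matrix.of c.q) i j.castSucc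

/-- `volume_select` needs a state that reaches `e` or equals `e`. While the product is nonzero the
current state is such, by `kernel_ne_zero`; once it is zero, both sides remain zero. -/
theorem prod_volume_select (hlast : ∀ i, c.T i (Fin.last m) = 0) (s : ℕ → Fin (m + 1))
    (hs : c.Reach (s 0)) (N : ℕ) :
    ∏ t ∈ Finset.range N, volume {u : unitInterval | c.select (s t) u = s (t + 1)} =
      ENNReal.ofReal (∏ t ∈ Finset.range N, c.kernel (s t) (s (t + 1))) ∧
    (∏ t ∈ Finset.range N, c.kernel (s t) (s (t + 1)) ≠ 0 → c.Reach (s N) ∨ s N = c.e) := by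
  induction N with
  | zero => simpa using Or.inl hs
  | succ N ih =>
    simp only [Finset.prod_range_succ]
    refine ⟨?_, fun h => c.kernel_ne_zero (right_ne_zero_of_mul h)⟩
    rw [ih.1]
    by_cases h : ∏ t ∈ Finset.range N, c.kernel (s t) (s (t + 1)) = 0
    · simp [h]
    · rw [c.volume_select hlast (ih.2 h), ENNReal.ofReal_mul
        (Finset.prod_nonneg fun t _ => c.kernel_nonneg _ _)]

end ExitChain

theorem encode_two (D t i : ℕ) : PRAM.encode D ![t, i] = t + i * D := by
  simp [PRAM.encode, Fin.sum_univ_two]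

namespace PRAM.Input

/-- The states of the algorithm, as indices of the chain. -/
noncomputable def state (x : Input) (t : ℕ) : Fin (x.m + 1) := ⟨x.stateN t, x.stateN_lt t⟩

theorem outN_zero (x : Input) : x.outN 0 = WDigraph.pairCount x.e x.L x.state := by
  rw [outN, if_pos rfl, WDigraph.pairCount]
  refine Finset.sum_congr rfl fun t _ => if_congr ?_ rfl rfl
  exact (Fin.ext_iff (a := x.state t) (b := x.e.castSucc)).symm

theorem outN_pair (x : Input) (i : ℕ) :
    (x.outN (1 + 2 * i), x.outN (2 + 2 * i)) = x.G.pairAt x.part x.e x.L x.state i := by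
  unfold outN WDigraph.pairAt
  rw [if_neg (show 1 + 2 * i ≠ 0 by omega), if_neg (show 2 + 2 * i ≠ 0 by omega), show (1 + 2 * i - 1) / 2 = i by omega,
    show (2 + 2 * i - 1) / 2 = i by omega]
  by_cases hi : i < x.L
  · simp only [if_pos hi]
    rw [if_pos (show (1 + 2 * i) % 2 = 1 by omega), if_neg (show ¬ (2 + 2 * i) % 2 = 1 by omega)]
    refine Prod.ext ?_ rfl
    change x.clusN (x.srcN (x.stateN (i + 1))) = if h : x.stateN (i + 1) < x.m then
      clusterCode (x.part (x.G.src ⟨x.stateN (i + 1), h⟩)) else 0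
    by_cases h : x.stateN (i + 1) < x.m
    · rw [dif_pos h, srcN, dif_pos h, clusN_fin]
    · rw [dif_neg h, srcN, dif_neg h, clusN, dif_neg (lt_irrefl _)]
  · simp only [if_neg hi]
    rw [if_pos (show (1 + 2 * i) % 2 = 1 by omega), if_neg (show ¬ (2 + 2 * i) % 2 = 1 by omega)]

theorem pairCount_le {m L : ℕ} (e : Fin m) (s : ℕ → Fin (m + 1)) :
    WDigraph.pairCount e L s ≤ L + 1 := by
  refine (Finset.sum_le_card_nsmul _ _ 1 fun t _ => ?_).trans (by simp)
  split_ifs <;> simp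

theorem readPairs_eq (x : Input) {w : ℕ → ℕ} (hw : ∀ p < x.mach.P, w p = x.outN p) :
    readPairs w = (List.range (WDigraph.pairCount x.e x.L x.state)).map
      (x.G.pairAt x.part x.e x.L x.state) := by
  have hP : 2 * x.L + 4 ≤ x.mach.P := by
    have h1 := x.mach.pow_le_P (a := 2) (by norm_num)
    have h2 : (x.m + x.L + 4) ^ 2 ≤ x.mach.P := h1
    have h3 : (x.L + 4) * 4 ≤ (x.m + x.L + 4) ^ 2 := by
      rw [pow_two]
      exact Nat.mul_le_mul (by omega) (by omega)
    omega
  rw [readPairs, hw 0 (by omega), outN_zero]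
  refine List.map_congr_left fun i hi => ?_
  have h1 := pairCount_le (L := x.L) x.e x.state
  have h2 := List.mem_range.mp hi
  rw [hw _ (by omega), hw _ (by omega), outN_pair]

theorem pairs_congr {n m k : ℕ} (G : WDigraph n m) (part : Fin n → Option (Fin k)) (e : Fin m)
    {L : ℕ} {s s' : ℕ → Fin (m + 1)} (h : ∀ t ≤ L, s t = s' t) :
    (List.range (WDigraph.pairCount e L s)).map (G.pairAt part e L s) =
      (List.range (WDigraph.pairCount e L s')).map (G.pairAt part e L s') := by
  have h1 : WDigraph.pairCount e L s = WDigraph.pairCount e L s' :=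
    Finset.sum_congr rfl fun t ht => by rw [h t (by simpa [Nat.lt_succ_iff] using ht)]
  rw [h1]
  refine List.map_congr_left fun i _ => ?_
  unfold WDigraph.pairAt
  by_cases hi : i < L
  · simp only [if_pos hi, h (i + 1) hi]
  · simp only [if_neg hi]

/-- Following a prescribed sequence means that each selection made at the prescribed states has the
prescribed result. In this form the event no longer refers to the random trajectory, but only to one
number per time, at fixed places. -/
theorem state_eq_iff (x : Input) (a : Fin x.L → Fin (x.m + 1)) :
    (∀ t ≤ x.L, x.state t = WDigraph.stateSeq a t) ↔ ∀ t < x.L,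
      x.chain.select (WDigraph.stateSeq a t)
        (x.u (t + (WDigraph.stateSeq a t : ℕ) * (x.m + x.L + 4))) = WDigraph.stateSeq a (t + 1) := by
  have hstep : ∀ t, (x.state (t + 1) : ℕ) =
      x.chain.select (x.state t) (x.u (t + (x.state t : ℕ) * (x.m + x.L + 4))) := fun t => by
    rw [← encode_two]
    rfl
  constructor
  · intro h t ht
    rw [← h t ht.le, ← h (t + 1) ht, hstep]
  · intro h t
    induction t with
    | zero => exact fun _ => rfl
    | succ t ih =>
      intro ht
      refine Fin.ext ?_
      rw [hstep, ih (by omega), h t ht]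

end PRAM.Input

/-! ### The law of the random trajectory -/

namespace PRAM.Input

/-- The input together with the random numbers that the processors draw in the first step. -/
noncomputable def withRandom (x : Input) (ω : Randomness x.mach.P) : Input :=
  { x with u := fun p => if h : p < x.mach.P then (ω (0, ⟨p, h⟩) : ℝ) else 0 }

/-- Selection of given states is a condition on one random number for every step. -/
theorem randomLaw_states (x : Input) (a : Fin x.L → Fin (x.m + 1))
    (hreach : x.chain.Reach (Fin.last x.m)) :
    MeasurableSet {ω : Randomness x.mach.P |
      ∀ t ≤ x.L, (x.withRandom ω).state t = WDigraph.stateSeq a t} ∧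
    randomLaw x.mach.P {ω | ∀ t ≤ x.L, (x.withRandom ω).state t = WDigraph.stateSeq a t} =
      ENNReal.ofReal (∏ t ∈ Finset.range x.L,
        x.chain.kernel (WDigraph.stateSeq a t) (WDigraph.stateSeq a (t + 1))) := by
  classical
  have hD : 0 < x.m + x.L + 4 := by omega
  have hidx : ∀ t : Fin x.L,
      (t : ℕ) + (WDigraph.stateSeq a t : ℕ) * (x.m + x.L + 4) < x.mach.P := fun t => by
    have h1 : (x.m + x.L + 4) ^ 2 ≤ x.mach.P := x.mach.pow_le_P (a := 2) (by norm_num)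
    have h2 := (WDigraph.stateSeq a t).2
    have h3 := t.2
    have h4 : ((WDigraph.stateSeq a t : ℕ) + 1) * (x.m + x.L + 4) ≤ (x.m + x.L + 4) ^ 2 := by
      rw [pow_two]
      exact Nat.mul_le_mul_right _ (by omega)
    rw [add_mul] at h4
    omega
  set idx : Fin x.L → ℕ × Fin x.mach.P := fun t => (0, ⟨_, hidx t⟩) with hidxdef
  -- The lowest digit of the processor number is the time, so different times consult different,
  -- hence independent, random numbers.
  have hmod : ∀ t, ((idx t).2 : ℕ) % (x.m + x.L + 4) = t := fun t => by
    have h3 := t.2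
    simp only [hidxdef, Nat.add_mul_mod_self_right]
    exact Nat.mod_eq_of_lt (by omega)
  have hinj : Function.Injective idx := fun t t' h => by
    refine Fin.ext ?_
    rw [← hmod t, ← hmod t', h]
  let A : ℕ → Set unitInterval := fun t =>
    {u | x.chain.select (WDigraph.stateSeq a t) u = WDigraph.stateSeq a (t + 1)}
  have hA : ∀ t, MeasurableSet (A t) := fun t =>
    ((x.chain.measurable_select _).comp measurable_subtype_coe) (measurableSet_singleton _)
  have hset : {ω : Randomness x.mach.P |
      ∀ t ≤ x.L, (x.withRandom ω).state t = WDigraph.stateSeq a t} =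
      Set.pi (Finset.univ.image idx : Finset _) fun i => A ((i.2 : ℕ) % (x.m + x.L + 4)) := by
    ext ω
    have h := (x.withRandom ω).state_eq_iff a
    refine h.trans ?_
    simp only [Set.mem_pi, Finset.coe_image, Finset.coe_univ, Set.image_univ, Set.forall_mem_range,
      hmod]
    constructor
    · intro h t
      have h1 := h t t.2
      simp only [withRandom, dif_pos (hidx t)] at h1
      exact h1
    · intro h t ht
      have h1 := h ⟨t, ht⟩
      simp only [withRandom, dif_pos (hidx ⟨t, ht⟩)]
      exact h1
  rw [hset]
  refine ⟨MeasurableSet.pi (Finset.countable_toSet _) fun i _ => hA _, ?_⟩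
  rw [randomLaw, Measure.infinitePi_pi _ fun i _ => hA _, Finset.prod_image fun t _ t' _ h => hinj h]
  simp only [hmod]
  rw [Fin.prod_univ_eq_prod_range (fun t => volume (A t))]
  exact (x.chain.prod_volume_select (fun i => x.G.chain_T_last x.hsrc x.hdst i)
    (WDigraph.stateSeq a) hreach x.L).1

open Classical in
-- The output depends only on the first `L` states after the start, so the event is a disjoint union
-- over sequences `a`. The resulting sum has the same shape as the one in `condExitProb_transcript`.
theorem randomLaw_pairs (x : Input) (hreach : x.chain.Reach (Fin.last x.m))
    (l : List (ℕ × ℕ)) :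
    randomLaw x.mach.P {ω | (List.range (WDigraph.pairCount x.e x.L (x.withRandom ω).state)).map
      (x.G.pairAt x.part x.e x.L (x.withRandom ω).state) = l} =
      ∑ a : Fin x.L → Fin (x.m + 1),
        if (List.range (WDigraph.pairCount x.e x.L (WDigraph.stateSeq a))).map
          (x.G.pairAt x.part x.e x.L (WDigraph.stateSeq a)) = l then
        ENNReal.ofReal (∏ t ∈ Finset.range x.L,
          x.chain.kernel (WDigraph.stateSeq a t) (WDigraph.stateSeq a (t + 1))) else 0 := by
  let E : (Fin x.L → Fin (x.m + 1)) → Set (Randomness x.mach.P) := fun a =>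
    {ω | ∀ t ≤ x.L, (x.withRandom ω).state t = WDigraph.stateSeq a t}
  have hset : {ω | (List.range (WDigraph.pairCount x.e x.L (x.withRandom ω).state)).map
      (x.G.pairAt x.part x.e x.L (x.withRandom ω).state) = l} =
      ⋃ a ∈ Finset.univ.filter fun a : Fin x.L → Fin (x.m + 1) =>
        (List.range (WDigraph.pairCount x.e x.L (WDigraph.stateSeq a))).map
          (x.G.pairAt x.part x.e x.L (WDigraph.stateSeq a)) = l, E a := by
    ext ω
    simp only [Set.mem_iUnion, Finset.mem_filter, Finset.mem_univ, true_and, exists_prop]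
    constructor
    · intro h
      have hE : ∀ t ≤ x.L, (x.withRandom ω).state t =
          WDigraph.stateSeq (fun t : Fin x.L => (x.withRandom ω).state (t + 1)) t := by
        intro t ht
        cases t with
        | zero => rfl
        | succ t => simp [WDigraph.stateSeq, show t < x.L by omega]
      exact ⟨_, (pairs_congr x.G x.part x.e hE).symm.trans h, hE⟩
    · rintro ⟨a, ha, hE⟩
      exact (pairs_congr x.G x.part x.e hE).trans ha
  rw [hset, measure_biUnion_finset, Finset.sum_filter]
  · refine Finset.sum_congr rfl fun a _ => ?_
    rw [(x.randomLaw_states a hreach).2]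
  · intro a _ b _ hab
    rw [Function.onFun, Set.disjoint_left]
    intro ω ha hb
    refine hab (funext fun t => ?_)
    have h1 : WDigraph.stateSeq a (t + 1) = WDigraph.stateSeq b (t + 1) :=
      (ha (t + 1) t.2).symm.trans (hb (t + 1) t.2)
    simpa [WDigraph.stateSeq] using h1
  · exact fun a _ => (x.randomLaw_states a hreach).1

/-- The edge `e` forces `m ≥ 1`, so the logarithm on the right is at least one; the factor `3`
absorbs both the rounding and the step from `m + L + 2` to `m + L + 4`. -/
theorem lg_le (x : Input) : x.mach.lg ≤ 3 * Nat.log 2 (x.m + x.L + 2) := by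
  have hm := x.e.pos
  have h1 : 1 ≤ Nat.log 2 (x.m + x.L + 2) := Nat.log_pos (by norm_num) (by omega)
  refine Nat.clog_le_of_le_pow ?_
  have h2 : x.m + x.L + 2 < 2 ^ (Nat.log 2 (x.m + x.L + 2) + 1) :=
    Nat.lt_pow_succ_log_self (by norm_num) _
  have h3 : 2 ^ (Nat.log 2 (x.m + x.L + 2) + 2) ≤ 2 ^ (3 * Nat.log 2 (x.m + x.L + 2)) :=
    Nat.pow_le_pow_right (by norm_num) (by omega)
  change x.m + x.L + 4 ≤ _
  rw [pow_succ] at h2 h3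
  rw [pow_succ] at h3
  omega

theorem polylog_le (x : Input) {κ c : ℕ} (hc : κ * 3 ^ κ + κ ≤ c) :
    κ * x.mach.lg ^ κ ≤ c * Nat.log 2 (x.m + x.L + 2) ^ c := by
  have hm := x.e.pos
  have h1 : 1 ≤ Nat.log 2 (x.m + x.L + 2) := Nat.log_pos (by norm_num) (by omega)
  calc κ * x.mach.lg ^ κ ≤ κ * (3 * Nat.log 2 (x.m + x.L + 2)) ^ κ :=
        Nat.mul_le_mul_left _ (Nat.pow_le_pow_left x.lg_le _)
    _ = κ * 3 ^ κ * Nat.log 2 (x.m + x.L + 2) ^ κ := by rw [mul_pow, mul_assoc]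
    _ ≤ _ := Nat.mul_le_mul (by omega) (Nat.pow_le_pow_right h1 (by omega))

end PRAM.Input

theorem mainTheorem3 :
    ∃ (prog : List PRAM.Instr) (c : ℕ),
      ∀ (n m k L : ℕ) (G : WDigraph n m) (part : Fin n → Option (Fin k)) (v₀ : Fin n) (e : Fin m),
        G.StronglyConnected {v | part v ≠ none} →
        (∀ i : Fin k, G.StronglyConnected {v | part v = some i}) →
        part v₀ ≠ none →
        part (G.src e) ≠ none →
        part (G.dst e) = none →
        G.exitProb {v | part v ≠ none} v₀ e ≠ 0 →
        let P : ℕ := (m + L + 2) ^ c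
        let W : ℕ := (n + m + L + 2) ^ c
        let T : ℕ := c * Nat.log 2 (m + L + 2) ^ c
        let final : PRAM.Randomness P → PRAM.Config P := fun ω =>
          PRAM.run W prog (PRAM.start P (inputWords G part v₀ e L) (inputReals G)) ω T
        (∀ ω, PRAM.Halted prog (final ω)) ∧
        ∀ τ : List (Option (Fin k) × Fin m),
          PRAM.randomLaw P {ω | readPairs (final ω).wmem = transcriptCode τ} =
            G.condExitProb {v | part v ≠ none} v₀ e {p | G.transcript part e L p = τ} := by
  obtain ⟨prog, κ, hprog⟩ := PRAM.exists_program
  -- The program does not depend on `c`, so `c` can be chosen afterwards: large enough for the time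
  -- bound with its constant `3 ^ κ`, and for the machine size demanded by `Input`.
  obtain ⟨c, hκ, hc⟩ : ∃ c, κ * 3 ^ κ + κ ≤ c ∧ 13 ≤ c :=
    ⟨κ * 3 ^ κ + κ + 13, by omega, by omega⟩
  refine ⟨prog, c, ?_⟩
  intro n m k L G part v₀ e _ _ _ hsrc hdst hexit P W T final
  let x : PRAM.Input :=
    ⟨L, G, part, v₀, e, hsrc, hdst, c, hc, fun _ => 0⟩
  have hrun : ∀ ω : PRAM.Randomness P, PRAM.Halted prog (final ω) ∧
      ∀ p < P, (final ω).wmem p = (x.withRandom ω).outN p := fun ω =>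
    hprog (x.withRandom ω) ω (fun p => dif_pos p.2) T (x.polylog_le hκ)
  refine ⟨fun ω => (hrun ω).1, fun τ => ?_⟩
  have hreach : x.chain.Reach (Fin.last m) := by
    by_contra h
    have := G.pathSum_of_not_reach hsrc hdst h fun _ => 1
    rw [G.head_last, ← G.exitProb_eq_pathSum] at this
    exact hexit this
  have hpairs : ∀ ω, readPairs (final ω).wmem =
      (List.range (WDigraph.pairCount e L (x.withRandom ω).state)).map
        (G.pairAt part e L (x.withRandom ω).state) := fun ω =>
    (x.withRandom ω).readPairs_eq (hrun ω).2
  simp only [hpairs]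
  -- Both laws are now the same finite sum of products of `kernel` over sequences of `L` states.
  rw [G.condExitProb_transcript hsrc hdst hexit L τ]
  exact x.randomLaw_pairs hreach (transcriptCode τ)
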